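/- **Notation.** Let $K$ be a field complete with respect to a nontrivial non-archimedean absolute value $|\cdot|$, with residue field $k$. Let $\mathbb{C}_K$ be the completion of an algebraic closure of $K$, with the extended absolute value, ring of integers $\mathcal{O}=\{x\in\mathbb{C}_K:|x|\le 1\}$ and residue field $\hat k$. For $\bar a\in\mathbb{P}^1(\hat k)$ let $W_{\bar a}\subset\mathbb{P}^1(\mathbb{C}_K)$ be its residue class, i.e. its inverse image under the reduction map $\mathbb{P}^1(\mathbb{C}_K)\to\mathbb{P}^1(\hat k)$. A rational function $\phi\in\mathbb{C}_K(z)$ is written $\phi=f/g$ with $f,g\in\mathcal{O}[z]$, some coefficient of $f$ or $g$ having absolute value $1$; let $\bar f,\bar g\in\hat k[z]$ be the reductions and $\bar h=\gcd(\bar f,\bar g)$. If $\bar f/\bar h$ and $\bar g/\bar h$ are not both constant, $\phi$ has *nontrivial reduction* $\bar\phi=(\bar f/\bar h)/(\bar g/\bar h)\in\hat k(z)$. The *Fatou set* $\mathcal{F}$ of $\phi$ is the set of points of $\mathbb{P}^1(\mathbb{C}_K)$ having a neighbourhood on which $\{\phi^n:n\ge 0\}$ is equicontinuous for the spherical metric;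 the *Julia set* $\mathcal{J}$ is its complement. A *disk* in $\mathbb{P}^1(\mathbb{C}_K)$ is an open or closed disk of positive radius in $\mathbb{C}_K$ or the complement of one. A *rational open* (respectively *rational closed*) disk is an open (respectively closed) disk in $\mathbb{C}_K$ with radius in $|\mathbb{C}_K^*|$, or the complement of a closed (respectively open) such disk. A *connected affinoid* is the complement of a finite (possibly empty) union of pairwise disjoint disks; it is a *rational open* connected affinoid if these disks can be taken rational closed. For $x\in\mathcal{F}$: - the *analytic component* (respectively *D-component*) containing $x$ is the union of all connected affinoids (respectively disks) $U$ with $x\in U\subset\mathcal{F}$; - the *dynamical component* (respectively *dynamical D-component*) containing $x$ is the union of all rational open connected affinoids (respectively rational open disks) $U\ni x$ such that $\mathbb{P}^1(\mathbb{C}_K)\setminus\bigcup_{n\ge 0}\phi^n(U)$ is infinite. For each type of component, $\phi$ acts on the set of components of that type by sending $V$ to the component containing $\phi(V)$. For a self-map $\Phi$ of a set, $x$ is *wandering* if no $\Phi^m(x)$, $m\ge 0$, is periodic, and $x,y$ lie in the same *grand orbit* if $\Phi^m(x)=\Phi^n(y)$ for some $m,n\ge 0$. **Theorem.** Suppose that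 $k$ is not an algebraic extension of a finite field. Let $\phi\in K(z)$ have nontrivial reduction $\bar\phi$ with $\deg\bar\phi\ge 2$. Then there is a family $(\bar b_i)_{i\in\mathbb{Z}}$ in $\mathbb{P}^1(\hat k)$ such that the points $\bar\phi^n(\bar b_i)$, for $i\in\mathbb{Z}$ and $n\ge 0$, are pairwise distinct, such that $\phi^n(W_{\bar b_i})=W_{\bar\phi^n(\bar b_i)}$ for all $n\ge 0$ and $i\in\mathbb{Z}$, and such that the following hold. (a) Each $W_{\bar b_i}$ is a wandering dynamical component and a wandering dynamical D-component of $\phi$, and, for each of these two types, the $W_{\bar b_i}$ lie in pairwise different grand orbits of components. (b) If $\mathcal{J}$ meets at least two different residue classes, then each $W_{\bar b_i}$ is also a wandering D-component, and the $W_{\bar b_i}$ lie in pairwise different grand orbits of D-components. (c) If $\mathcal{J}$ meets infinitely many different residue classes, then each $W_{\bar b_i}$ is also a wandering analytic component, and the $W_{\bar b_i}$ lie in pairwise different grand orbits of analytic components. -/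

import Mathlib

open Polynomial

noncomputable section

namespace NonArch

/-! ### The field `C_K` -/

/-- An algebraic closure of `K`, normed by the unique extension of the absolute value of `K`. -/
abbrev AlgClos (K : Type*) [Field K] : Type _ := AlgebraicClosure K

instance AlgClos.instNormedField (K : Type*) [NontriviallyNormedField K] [IsUltrametricDist K]
    [CompleteSpace K] : NormedField (AlgClos K) :=
  spectralNorm.normedField K (AlgClos K)

instance AlgClos.instIsUltrametricDist (K : Type*) [NontriviallyNormedField K]
    [IsUltrametricDist K] [CompleteSpace K] : IsUltrametricDist (AlgClos K) :=
  IsUltrametricDist.isUltrametricDist_of_forall_norm_add_le_max_norm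
    (isNonarchimedean_spectralNorm (K := K) (L := AlgClos K))

/-- `C_K`, the completion of an algebraic closure of `K`. -/
abbrev CK (K : Type*) [NontriviallyNormedField K] [IsUltrametricDist K] [CompleteSpace K] :
    Type _ :=
  UniformSpace.Completion (AlgClos K)

instance CK.instIsUltrametricDist (K : Type*) [NontriviallyNormedField K]
    [IsUltrametricDist K] [CompleteSpace K] : IsUltrametricDist (CK K) := by
  refine IsUltrametricDist.isUltrametricDist_of_forall_norm_add_le_max_norm fun x y => ?_
  induction x, y using UniformSpace.Completion.induction_on₂ with
  | hp => exact isClosed_le (by fun_prop) (by fun_prop)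
  | ih a b =>
    rw [← UniformSpace.Completion.coe_add]
    simpa only [UniformSpace.Completion.norm_coe] using IsUltrametricDist.norm_add_le_max a b

/-- The inclusion of `K` in `C_K`. -/
def toCK (K : Type*) [NontriviallyNormedField K] [IsUltrametricDist K] [CompleteSpace K] :
    K →+* CK K :=
  (UniformSpace.Completion.coeRingHom (α := AlgClos K)).comp (algebraMap K (AlgClos K))

/-! ### Ring of integers and residue field -/

/-- The ring of integers `{x : |x| ≤ 1}` of a non-archimedean field. -/
abbrev IntRing (C : Type*) [NormedField C] [IsUltrametricDist C] : ValuationSubring C :=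
  (NormedField.valuation (K := C)).valuationSubring

/-- The residue field of a non-archimedean field: integers modulo the maximal ideal. -/
abbrev ResField (C : Type*) [NormedField C] [IsUltrametricDist C] : Type _ :=
  IsLocalRing.ResidueField (IntRing C)

/-- `k` is an algebraic extension of a finite field. -/
def IsAlgebraicOverFinite (k : Type*) [Field k] : Prop :=
  ∃ F : Subfield k, Finite F ∧ Algebra.IsAlgebraic F k

/-! ### Rational functions acting on the projective line -/

/-- The projective line `F ∪ {∞}`, used only as a set; its topology is never that of a one-point
compactification but the one of the chordal distance below. -/
abbrev P1 (F : Type*) : Type _ := OnePoint F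

/-- The degree of a rational function: with coprime numerator and denominator, the maximum of
their degrees. -/
def ratDegree {F : Type*} [Field F] (φ : RatFunc F) : ℕ :=
  max φ.num.natDegree φ.denom.natDegree

open Classical in
/-- The action of a rational function `f / g` (with `f`, `g` coprime) on the projective line.
At `∞` the value is `∞` if `deg g < deg f`, and otherwise the quotient of the coefficients of
degree `deg g`. -/
def ratMap {F : Type*} [Field F] (φ : RatFunc F) : P1 F → P1 F
  | OnePoint.infty =>
      if φ.denom.natDegree < φ.num.natDegree then OnePoint.infty
      else ((φ.num.coeff φ.denom.natDegree / φ.denom.leadingCoeff : F) : P1 F)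
  | OnePoint.some x =>
      if φ.denom.eval x = 0 then OnePoint.infty
      else ((φ.num.eval x / φ.denom.eval x : F) : P1 F)

/-- A rational function over `F`, viewed over an extension field `E`. -/
def baseChange {F E : Type*} [Field F] [Field E] (i : F →+* E) (φ : RatFunc F) : RatFunc E :=
  algebraMap E[X] (RatFunc E) (φ.num.map i) / algebraMap E[X] (RatFunc E) (φ.denom.map i)

/-! ### Reduction -/

section Reduction

variable {C : Type*} [NormedField C] [IsUltrametricDist C]

open Classical in
/-- `φ` has nontrivial reduction, and its reduction is `ψ`: one can write `φ = f / g` with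
integral `f`, `g`, some coefficient of which has absolute value `1`, such that after dividing the
reductions of `f` and `g` by their gcd, they are not both constant and have quotient `ψ`. -/
def IsNontrivialReduction (φ : RatFunc C) (ψ : RatFunc (ResField C)) : Prop :=
  ∃ f g : (IntRing C)[X], g ≠ 0 ∧
    φ = algebraMap C[X] (RatFunc C) (f.map (IntRing C).subtype) /
        algebraMap C[X] (RatFunc C) (g.map (IntRing C).subtype) ∧
    (∃ n : ℕ, ‖(f.coeff n : C)‖ = 1 ∨ ‖(g.coeff n : C)‖ = 1) ∧
    ∃ f₁ g₁ h f₀ g₀ : (ResField C)[X],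
      f₁ = f.map (IsLocalRing.residue (IntRing C)) ∧
      g₁ = g.map (IsLocalRing.residue (IntRing C)) ∧
      h = EuclideanDomain.gcd f₁ g₁ ∧
      f₀ = f₁ / h ∧ g₀ = g₁ / h ∧
      ¬ (f₀.natDegree = 0 ∧ g₀.natDegree = 0) ∧
      ψ = algebraMap (ResField C)[X] (RatFunc (ResField C)) f₀ /
          algebraMap (ResField C)[X] (RatFunc (ResField C)) g₀

open Classical in
/-- The reduction map from the projective line over `C` to that over the residue field. -/
def red : P1 C → P1 (ResField C)
  | OnePoint.infty => OnePoint.infty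
  | OnePoint.some x =>
      if hx : x ∈ IntRing C then ((IsLocalRing.residue (IntRing C) ⟨x, hx⟩ : ResField C) :
        P1 (ResField C))
      else OnePoint.infty

/-- The residue class `W_a`. -/
def residueClass (a : P1 (ResField C)) : Set (P1 C) := red ⁻¹' {a}

end Reduction

/-! ### Fatou and Julia sets -/

section Fatou

variable {C : Type*} [NormedField C]

/-- The spherical (chordal) distance on the projective line over a non-archimedean field. -/
def chordalDist : P1 C → P1 C → ℝ
  | OnePoint.infty, OnePoint.infty => 0
  | OnePoint.infty, OnePoint.some y => 1 / max ‖y‖ 1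
  | OnePoint.some x, OnePoint.infty => 1 / max ‖x‖ 1
  | OnePoint.some x, OnePoint.some y => ‖x - y‖ / (max ‖x‖ 1 * max ‖y‖ 1)

/-- The family of the iterates of `φ` is equicontinuous at `x`, for the chordal distance. -/
def IteratesEquicontinuousAt (φ : RatFunc C) (x : P1 C) : Prop :=
  ∀ ε > 0, ∃ δ > 0, ∀ n : ℕ, ∀ y : P1 C, chordalDist x y < δ →
    chordalDist ((ratMap φ)^[n] x) ((ratMap φ)^[n] y) < ε

/-- The Fatou set: the points with a neighbourhood on which the iterates are equicontinuous. -/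
def fatou (φ : RatFunc C) : Set (P1 C) :=
  {x | ∃ r > 0, ∀ y : P1 C, chordalDist x y < r → IteratesEquicontinuousAt φ y}

/-- The Julia set. -/
def julia (φ : RatFunc C) : Set (P1 C) := (fatou φ)ᶜ

/-! ### Disks and connected affinoids -/

/-- The open disk `D(a, r)`, as a subset of the projective line. -/
def openDisk (a : C) (r : ℝ) : Set (P1 C) := (fun x : C => (x : P1 C)) '' Metric.ball a r

/-- The closed disk of centre `a` and radius `r`, as a subset of the projective line. -/
def closedDisk (a : C) (r : ℝ) : Set (P1 C) :=
  (fun x : C => (x : P1 C)) '' Metric.closedBall a r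

/-- Disks in the projective line: open or closed disks of positive radius in `C`, and the
complements of these. -/
def IsDisk (U : Set (P1 C)) : Prop :=
  ∃ (a : C) (r : ℝ), 0 < r ∧
    (U = openDisk a r ∨ U = closedDisk a r ∨ Uᶜ = openDisk a r ∨ Uᶜ = closedDisk a r)

/-- Rational open disks: open disks in `C` with radius in `|C^*|`, and complements of closed
disks in `C` with radius in `|C^*|`. -/
def IsRationalOpenDisk (U : Set (P1 C)) : Prop :=
  ∃ a c : C, c ≠ 0 ∧ (U = openDisk a ‖c‖ ∨ Uᶜ = closedDisk a ‖c‖)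

/-- Rational closed disks: closed disks in `C` with radius in `|C^*|`, and complements of open
disks in `C` with radius in `|C^*|`. -/
def IsRationalClosedDisk (U : Set (P1 C)) : Prop :=
  ∃ a c : C, c ≠ 0 ∧ (U = closedDisk a ‖c‖ ∨ Uᶜ = openDisk a ‖c‖)

/-- Connected affinoids: complements of finitely many (possibly no) pairwise disjoint disks. -/
def IsConnectedAffinoid (W : Set (P1 C)) : Prop :=
  ∃ S : Set (Set (P1 C)), S.Finite ∧ S.PairwiseDisjoint id ∧ (∀ U ∈ S, IsDisk U) ∧ W = (⋃₀ S)ᶜ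

/-- Rational open connected affinoids: complements of finitely many (possibly no) pairwise
disjoint rational closed disks. -/
def IsRationalOpenConnectedAffinoid (W : Set (P1 C)) : Prop :=
  ∃ S : Set (Set (P1 C)), S.Finite ∧ S.PairwiseDisjoint id ∧
    (∀ U ∈ S, IsRationalClosedDisk U) ∧ W = (⋃₀ S)ᶜ

/-! ### Components of the Fatou set -/

/-- The complement of the union of all forward images of `U` is infinite. -/
def OrbitOmitsInfinitely (φ : RatFunc C) (U : Set (P1 C)) : Prop :=
  ((⋃ n : ℕ, (ratMap φ)^[n] '' U)ᶜ).Infinite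

/-- The analytic component containing `x`. -/
def analyticComponent (φ : RatFunc C) (x : P1 C) : Set (P1 C) :=
  ⋃₀ {W | IsConnectedAffinoid W ∧ x ∈ W ∧ W ⊆ fatou φ}

/-- The D-component containing `x`. -/
def dComponent (φ : RatFunc C) (x : P1 C) : Set (P1 C) :=
  ⋃₀ {U | IsDisk U ∧ x ∈ U ∧ U ⊆ fatou φ}

/-- The dynamical component containing `x`. -/
def dynComponent (φ : RatFunc C) (x : P1 C) : Set (P1 C) :=
  ⋃₀ {W | IsRationalOpenConnectedAffinoid W ∧ x ∈ W ∧ OrbitOmitsInfinitely φ W}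

/-- The dynamical D-component containing `x`. -/
def dynDComponent (φ : RatFunc C) (x : P1 C) : Set (P1 C) :=
  ⋃₀ {U | IsRationalOpenDisk U ∧ x ∈ U ∧ OrbitOmitsInfinitely φ U}

/-- The set of analytic components of the Fatou set. -/
def analyticComponents (φ : RatFunc C) : Set (Set (P1 C)) := analyticComponent φ '' fatou φ

/-- The set of D-components of the Fatou set. -/
def dComponents (φ : RatFunc C) : Set (Set (P1 C)) := dComponent φ '' fatou φ

/-- The set of dynamical components of the Fatou set. -/
def dynComponents (φ : RatFunc C) : Set (Set (P1 C)) := dynComponent φ '' fatou φ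

/-- The set of dynamical D-components of the Fatou set. -/
def dynDComponents (φ : RatFunc C) : Set (Set (P1 C)) := dynDComponent φ '' fatou φ

/-- The action of `φ` on a set `𝒞` of components: `V` goes to the component containing `φ(V)`.
(The union picks out that component, as `componentMap_eq` shows.) -/
def componentMap (φ : RatFunc C) (𝒞 : Set (Set (P1 C))) (V : Set (P1 C)) : Set (P1 C) :=
  ⋃₀ {V' | V' ∈ 𝒞 ∧ ratMap φ '' V ⊆ V'}

theorem componentMap_eq (φ : RatFunc C) (𝒞 : Set (Set (P1 C))) (V V' : Set (P1 C))
    (hV' : V' ∈ 𝒞) (hsub : ratMap φ '' V ⊆ V')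
    (huniq : ∀ V'' ∈ 𝒞, ratMap φ '' V ⊆ V'' → V'' = V') : componentMap φ 𝒞 V = V' := by
  have h : {V'' | V'' ∈ 𝒞 ∧ ratMap φ '' V ⊆ V''} = {V'} := by
    ext V''
    constructor
    · rintro ⟨h1, h2⟩
      exact huniq V'' h1 h2
    · rintro rfl
      exact ⟨hV', hsub⟩
  rw [componentMap, h, Set.sUnion_singleton]

end Fatou

/-! ### Wandering points and grand orbits of a self-map of a set -/

/-- `x` is preperiodic: some iterate `f^m(x)`, `m ≥ 0`, is periodic of some period `n ≥ 1`. -/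
def IsPreperiodic {X : Type*} (f : X → X) (x : X) : Prop :=
  ∃ m : ℕ, f^[m] x ∈ Function.periodicPts f

/-- The grand orbit of `x`. -/
def grandOrbit {X : Type*} (f : X → X) (x : X) : Set X :=
  {y | ∃ m n : ℕ, f^[m] x = f^[n] y}

/-- `V` belongs to the set `𝒞` of components and is not preperiodic under the action of `φ`
on `𝒞`. -/
def IsWanderingComponent {C : Type*} [NormedField C] (φ : RatFunc C) (𝒞 : Set (Set (P1 C)))
    (V : Set (P1 C)) : Prop :=
  V ∈ 𝒞 ∧ ¬ IsPreperiodic (componentMap φ 𝒞) V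

/-- The sets `V i` are wandering components from `𝒞`, and lie in pairwise different grand orbits
of the action of `φ` on `𝒞`. -/
def WanderInDistinctGrandOrbits {C ι : Type*} [NormedField C] (φ : RatFunc C)
    (𝒞 : Set (Set (P1 C))) (V : ι → Set (P1 C)) : Prop :=
  (∀ i, IsWanderingComponent φ 𝒞 (V i)) ∧
    ∀ i j, i ≠ j → V j ∉ grandOrbit (componentMap φ 𝒞) (V i)

end NonArch

end

/-!
# Wandering residue classes

Here `φ` is a rational function over an algebraically closed non-archimedean field (in the theorem,
the base change of the given one to `C_K`), and `ψ` is its reduction. Away from the finitely many *bad* classes, the zeros of the common factor of the reductions of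
numerator and denominator, `φ` maps residue classes onto residue classes as `ψ`
prescribes. The fibres of `φ`, as multisets of `deg φ` points on the projective line, reduce to the bad
classes together with the fibres of `ψ` (`nonempty_reducedFibres`); this statement about multisets
replaces an analysis of Newton polygons. A class whose `ψ`-orbit avoids the bad classes therefore
lies in the Fatou set and its images are again classes (`ReducedFibres.residueClass_subset_fatou`,
`ReducedFibres.iterate_image_residueClass`).

*Maximality.* Suppose that a connected affinoid or a disk meets a class without being contained in
it. Then each of the disks that form its complement lies in a single residue class, so it contains
all but finitely many classes, and all but one class in the case of a disk. If it is contained in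
the Fatou set, this is impossible when the Julia set meets infinitely many classes, or two classes
respectively. For a rational open affinoid `U`, consider the points that are on no image `φ^n(U)`.
They form a backward invariant set `E` contained in finitely many disks, each smaller than its
class. The class of a point of `E` has a single preimage class under `ψ`, so that `d = deg ψ`
preimages of the point lie there, close to each other; this improves a bound `r < 1` for the
diameter of the parts of `E` in single classes to `r ^ d` (`ReducedFibres.chordalDist_le_pow`).
Hence `E` has at most one point in each class, and is finite. So a wandering class is a component
of each type (`wanderInDistinctGrandOrbits_of_maximal`).

*Residue dynamics.* It remains to find infinitely many points over the residue field with disjoint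
infinite orbits avoiding the bad classes. The residue field of `C_K` is algebraically closed and not
algebraic over a finite field, so it is algebraic over the field of fractions of `A`, where `A` is
`ℤ` or `k[t]` with `t` transcendental over `k`. The points are powers `t ^ a` (with `t = 2` for
`A = ℤ`), told apart by their heights: the height of `ψ^n (t ^ a)` is that of `t` times
`a d ^ n`, up to `O(d ^ n)` (`PlaceFamily.exists_coincidence_bound`), and suitable exponents `a` do
not agree up to powers of `d`, even within this error (`eq_of_near_power`). Heights
enter only through a comparison of two sets of homogeneous coordinates of one point: their ratio is
integral over `A` up to a bounded factor, and an element that is integral over `A` and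
nonzero is not small at all places at infinity. A `PlaceFamily` records what this needs.
-/

noncomputable section

namespace NonArch

/-! ### Rational functions as pairs of binary forms -/

section Forms

variable {E : Type*} [Field E]

/-- The value at a point of the projective line of `f`, regarded as a binary form of degree `D`:
the form is evaluated at `(x, 1)` for `x ∈ E` and at `(1, 0)` for the point `∞`. -/
def ev (D : ℕ) (f : E[X]) : P1 E → E
  | OnePoint.infty => f.coeff D
  | OnePoint.some x => f.eval x

@[simp] lemma ev_infty (D : ℕ) (f : E[X]) : ev D f OnePoint.infty = f.coeff D := rfl

@[simp] lemma ev_coe (D : ℕ) (f : E[X]) (x : E) : ev D f (x : P1 E) = f.eval x := rfl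

/-- The multiset of zeros on the projective line of `f`, regarded as a binary form of degree `D`;
the point `∞` has multiplicity `D - deg f`. -/
def formRoots (D : ℕ) (f : E[X]) : Multiset (P1 E) :=
  f.roots.map (fun x : E => (x : P1 E)) + Multiset.replicate (D - f.natDegree) OnePoint.infty

lemma mem_formRoots {D : ℕ} {f : E[X]} (hf : f ≠ 0) (hD : f.natDegree ≤ D) (P : P1 E) :
    P ∈ formRoots D f ↔ ev D f P = 0 := by
  induction P using OnePoint.rec with
  | infty =>
    simp only [formRoots, Multiset.mem_add, Multiset.mem_map, Multiset.mem_replicate, ev_infty]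
    constructor
    · rintro (⟨x, -, hx⟩ | ⟨h, -⟩)
      · exact absurd hx (OnePoint.coe_ne_infty x)
      · exact coeff_eq_zero_of_natDegree_lt (by omega)
    · intro h
      refine Or.inr ⟨?_, trivial⟩
      intro h0
      have : D = f.natDegree := by omega
      rw [this] at h
      exact hf (leadingCoeff_eq_zero.mp h)
  | coe x =>
    simp only [formRoots, Multiset.mem_add, Multiset.mem_map, Multiset.mem_replicate, ev_coe]
    constructor
    · rintro (⟨y, hy, hyx⟩ | ⟨-, h⟩)
      · rw [← OnePoint.coe_injective hyx]
        exact (mem_roots hf).mp hy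
      · exact absurd h (OnePoint.coe_ne_infty x)
    · intro h
      exact Or.inl ⟨x, (mem_roots hf).mpr h, rfl⟩

lemma card_formRoots [IsAlgClosed E] {D : ℕ} {f : E[X]} (hD : f.natDegree ≤ D) :
    Multiset.card (formRoots D f) = D := by
  have := (IsAlgClosed.splits f).natDegree_eq_card_roots
  simp only [formRoots, Multiset.card_add, Multiset.card_map, Multiset.card_replicate]
  omega

lemma formRoots_mul {D₁ D₂ : ℕ} {f g : E[X]} (hf : f ≠ 0) (hg : g ≠ 0) (hfD : f.natDegree ≤ D₁)
    (hgD : g.natDegree ≤ D₂) :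
    formRoots (D₁ + D₂) (f * g) = formRoots D₁ f + formRoots D₂ g := by
  have h : D₁ + D₂ - (f.natDegree + g.natDegree) = (D₁ - f.natDegree) + (D₂ - g.natDegree) := by
    omega
  rw [formRoots, roots_mul (mul_ne_zero hf hg), natDegree_mul hf hg, h, Multiset.replicate_add,
    Multiset.map_add, formRoots, formRoots]
  abel

lemma formRoots_C_mul {c : E} (hc : c ≠ 0) (D : ℕ) (f : E[X]) :
    formRoots D (C c * f) = formRoots D f := by
  rw [formRoots, roots_C_mul f hc, natDegree_C_mul hc, formRoots]

/-- The member of the pencil spanned by `f` and `g` whose zeros are the points where `f / g` takes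
the value `y`. -/
def pencil (f g : E[X]) : P1 E → E[X]
  | OnePoint.infty => g
  | OnePoint.some y => f - C y * g

@[simp] lemma pencil_infty (f g : E[X]) : pencil f g OnePoint.infty = g := rfl

@[simp] lemma pencil_coe (f g : E[X]) (y : E) : pencil f g (y : P1 E) = f - C y * g := rfl

lemma natDegree_pencil_le {D : ℕ} {f g : E[X]} (hf : f.natDegree ≤ D) (hg : g.natDegree ≤ D)
    (y : P1 E) : (pencil f g y).natDegree ≤ D := by
  induction y using OnePoint.rec with
  | infty => exact hg
  | coe y => exact (natDegree_sub_le _ _).trans (max_le hf ((natDegree_C_mul_le _ _).trans hg))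

lemma pencil_mul_left (h f g : E[X]) (y : P1 E) :
    pencil (h * f) (h * g) y = h * pencil f g y := by
  induction y using OnePoint.rec with
  | infty => rfl
  | coe y => simp only [pencil_coe]; ring

/-- The members of the pencil of a coprime pair, not both constant, are nonzero. -/
lemma pencil_ne_zero {f g : E[X]} (hfg : IsCoprime f g)
    (hdeg : max f.natDegree g.natDegree ≠ 0) (y : P1 E) : pencil f g y ≠ 0 := by
  induction y using OnePoint.rec with
  | infty =>
    rintro h
    simp only [pencil_infty] at h
    subst h
    have := natDegree_eq_zero_of_isUnit (isCoprime_zero_right.mp hfg)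
    simp [this] at hdeg
  | coe y =>
    intro h
    simp only [pencil_coe] at h
    have hf : f = C y * g := sub_eq_zero.mp h
    have hg : IsUnit g := hfg.isUnit_of_dvd' ⟨C y, by rw [hf, mul_comm]⟩ dvd_rfl
    have h1 := natDegree_eq_zero_of_isUnit hg
    have h2 : f.natDegree ≤ 0 := by
      rw [hf, ← h1]
      exact natDegree_C_mul_le _ _
    simp [h1, Nat.le_zero.mp h2] at hdeg

lemma ev_pencil_coe (D : ℕ) (f g : E[X]) (y : E) (P : P1 E) :
    ev D (pencil f g (y : P1 E)) P = ev D f P - y * ev D g P := by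
  induction P using OnePoint.rec <;> simp

/-- A coprime pair has no common zero on the projective line. -/
lemma ev_ne_zero_or {f g : E[X]} (hfg : IsCoprime f g) {D : ℕ}
    (hD : D = max f.natDegree g.natDegree) (P : P1 E) : ev D f P ≠ 0 ∨ ev D g P ≠ 0 := by
  induction P using OnePoint.rec with
  | infty =>
    by_contra! h
    simp only [ev_infty] at h
    obtain ⟨h1, h2⟩ := h
    rcases le_total f.natDegree g.natDegree with hle | hle
    · rw [hD, max_eq_right hle] at h1 h2
      have hg : g = 0 := leadingCoeff_eq_zero.mp h2
      have hf : f = 0 := leadingCoeff_eq_zero.mp (by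
        have : f.natDegree = g.natDegree := le_antisymm hle (by simp [hg])
        rw [leadingCoeff, this, h1])
      subst hf hg
      exact not_isCoprime_zero_zero hfg
    · rw [hD, max_eq_left hle] at h1 h2
      have hf : f = 0 := leadingCoeff_eq_zero.mp h1
      have hg : g = 0 := leadingCoeff_eq_zero.mp (by
        have : g.natDegree = f.natDegree := le_antisymm hle (by simp [hf])
        rw [leadingCoeff, this, h2])
      subst hf hg
      exact not_isCoprime_zero_zero hfg
  | coe x =>
    by_contra! h
    simp only [ev_coe] at h
    obtain ⟨a, b, hab⟩ := hfg
    have := congrArg (Polynomial.eval x) hab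
    simp [h.1, h.2] at this

/-- A coprime pair with quotient `φ` is a constant multiple of the numerator and denominator. -/
lemma exists_C_mul_num_denom {f g : E[X]} (hfg : IsCoprime f g) (hg : g ≠ 0) {φ : RatFunc E}
    (hφ : φ = algebraMap E[X] (RatFunc E) f / algebraMap E[X] (RatFunc E) g) :
    ∃ c : E, c ≠ 0 ∧ f = C c * φ.num ∧ g = C c * φ.denom := by
  have h1 : φ.num * g = f * φ.denom := (RatFunc.num_mul_eq_mul_denom_iff hg).mpr hφ
  have h2 : φ.denom ∣ g :=
    (RatFunc.isCoprime_num_denom φ).symm.dvd_of_dvd_mul_left ⟨f, by rw [h1, mul_comm]⟩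
  have h3 : g ∣ φ.denom := hfg.symm.dvd_of_dvd_mul_left ⟨φ.num, by rw [← h1, mul_comm]⟩
  obtain ⟨u, hu⟩ := associated_of_dvd_dvd h2 h3
  obtain ⟨c, hc, hcu⟩ := Polynomial.isUnit_iff.mp u.isUnit
  refine ⟨c, hc.ne_zero, ?_, by rw [hcu, mul_comm]; exact hu.symm⟩
  have hd := φ.denom_ne_zero
  apply mul_right_cancel₀ hd
  rw [← h1, ← hu, hcu]
  ring

lemma ratDegree_eq {f g : E[X]} (hfg : IsCoprime f g) (hg : g ≠ 0) {φ : RatFunc E}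
    (hφ : φ = algebraMap E[X] (RatFunc E) f / algebraMap E[X] (RatFunc E) g) :
    ratDegree φ = max f.natDegree g.natDegree := by
  obtain ⟨c, hc, hf, hg'⟩ := exists_C_mul_num_denom hfg hg hφ
  rw [hf, hg', natDegree_C_mul hc, natDegree_C_mul hc, ratDegree]

open Classical in
/-- The point of the projective line with homogeneous coordinates `(a, b)`. -/
def ofCoords (a b : E) : P1 E := if b = 0 then OnePoint.infty else ((a / b : E) : P1 E)

@[simp] lemma ofCoords_zero (a : E) : ofCoords a 0 = OnePoint.infty := by simp [ofCoords]

lemma ofCoords_of_ne_zero (a : E) {b : E} (hb : b ≠ 0) :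
    ofCoords a b = ((a / b : E) : P1 E) := by simp [ofCoords, hb]

lemma ofCoords_mul_left {c : E} (hc : c ≠ 0) (a b : E) :
    ofCoords (c * a) (c * b) = ofCoords a b := by
  by_cases hb : b = 0
  · simp [hb]
  · rw [ofCoords_of_ne_zero _ hb, ofCoords_of_ne_zero _ (mul_ne_zero hc hb),
      mul_div_mul_left _ _ hc]

lemma ratMap_eq {f g : E[X]} (hfg : IsCoprime f g) (hg : g ≠ 0) {φ : RatFunc E}
    (hφ : φ = algebraMap E[X] (RatFunc E) f / algebraMap E[X] (RatFunc E) g) {D : ℕ}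
    (hD : D = max f.natDegree g.natDegree) (P : P1 E) :
    ratMap φ P = ofCoords (ev D f P) (ev D g P) := by
  obtain ⟨c, hc, hf, hg'⟩ := exists_C_mul_num_denom hfg hg hφ
  have hd := φ.denom_ne_zero
  rw [hf, hg', natDegree_C_mul hc, natDegree_C_mul hc] at hD
  have h1 : ∀ h : E[X], ev D (C c * h) P = c * ev D h P := by
    intro h
    induction P using OnePoint.rec <;> simp
  rw [hf, hg', h1, h1, ofCoords_mul_left hc]
  induction P using OnePoint.rec with
  | infty =>
    simp only [ratMap, ev_infty]
    by_cases hlt : φ.denom.natDegree < φ.num.natDegree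
    · rw [if_pos hlt, hD, max_eq_left hlt.le, coeff_eq_zero_of_natDegree_lt hlt, ofCoords_zero]
    · rw [if_neg hlt, hD, max_eq_right (not_lt.mp hlt),
        ofCoords_of_ne_zero _ (by simpa using hd)]
      rfl
  | coe x =>
    simp only [ratMap, ev_coe, ofCoords]
    rfl

/-- The fibre of `f / g` over `y`, with multiplicities. -/
lemma mem_formRoots_pencil {f g : E[X]} (hfg : IsCoprime f g) (hg : g ≠ 0) {φ : RatFunc E}
    (hφ : φ = algebraMap E[X] (RatFunc E) f / algebraMap E[X] (RatFunc E) g) {D : ℕ}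
    (hD : D = max f.natDegree g.natDegree) (hD0 : D ≠ 0) (P y : P1 E) :
    P ∈ formRoots D (pencil f g y) ↔ ratMap φ P = y := by
  rw [mem_formRoots (pencil_ne_zero hfg (hD ▸ hD0) y)
    (natDegree_pencil_le (hD ▸ le_max_left _ _) (hD ▸ le_max_right _ _) y),
    ratMap_eq hfg hg hφ hD]
  by_cases h : ev D g P = 0
  · have := (ev_ne_zero_or hfg hD P).resolve_right (not_not.mpr h)
    induction y using OnePoint.rec with
    | infty => simp [h]
    | coe y => rw [ev_pencil_coe]; simp [h, this]
  · rw [ofCoords_of_ne_zero _ h]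
    induction y using OnePoint.rec with
    | infty => simp [h]
    | coe y => simp only [ev_pencil_coe, OnePoint.coe_eq_coe, div_eq_iff h, sub_eq_zero]

end Forms

/-! ### The chordal distance and the reduction map -/

section Chordal

variable {C : Type*} [NormedField C]

/-- Homogeneous coordinates of a point of the projective line, of maximal norm `1`. -/
def coords : P1 C → C × C
  | OnePoint.infty => (1, 0)
  | OnePoint.some x => if ‖x‖ ≤ 1 then (x, 1) else (1, x⁻¹)

lemma coords_infty : coords (OnePoint.infty : P1 C) = (1, 0) := rfl

lemma coords_of_le {x : C} (hx : ‖x‖ ≤ 1) : coords (x : P1 C) = (x, 1) := if_pos hx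

lemma coords_of_lt {x : C} (hx : 1 < ‖x‖) : coords (x : P1 C) = (1, x⁻¹) := if_neg hx.not_ge

lemma norm_coords_le (P : P1 C) : ‖(coords P).1‖ ≤ 1 ∧ ‖(coords P).2‖ ≤ 1 := by
  induction P using OnePoint.rec with
  | infty => simp [coords_infty]
  | coe x =>
    rcases le_or_gt ‖x‖ 1 with h | h
    · simp [coords_of_le h, h]
    · simp [coords_of_lt h, inv_le_one_of_one_le₀ h.le]

lemma coords_eq_one (P : P1 C) : (coords P).1 = 1 ∨ (coords P).2 = 1 := by
  induction P using OnePoint.rec with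
  | infty => simp [coords_infty]
  | coe x =>
    rcases le_or_gt ‖x‖ 1 with h | h
    · simp [coords_of_le h]
    · simp [coords_of_lt h]

/-- The chordal distance is the norm of the determinant of normalized coordinates. -/
lemma chordalDist_eq (P Q : P1 C) : chordalDist P Q =
    ‖(coords P).1 * (coords Q).2 - (coords P).2 * (coords Q).1‖ := by
  have key : ∀ x : C, 1 < ‖x‖ → x ≠ 0 := fun x hx h => by
    rw [h, norm_zero] at hx; linarith
  induction P using OnePoint.rec with
  | infty =>
    induction Q using OnePoint.rec with
    | infty => simp [coords_infty, chordalDist]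
    | coe y =>
      rcases le_or_gt ‖y‖ 1 with h | h
      · simp [coords_infty, chordalDist, coords_of_le h, h]
      · simp [coords_infty, chordalDist, coords_of_lt h, h.le]
  | coe x =>
    induction Q using OnePoint.rec with
    | infty =>
      rcases le_or_gt ‖x‖ 1 with h | h
      · simp [coords_infty, chordalDist, coords_of_le h, h]
      · simp [coords_infty, chordalDist, coords_of_lt h, h.le]
    | coe y =>
      change ‖x - y‖ / (max ‖x‖ 1 * max ‖y‖ 1) = _
      rcases le_or_gt ‖x‖ 1 with h | h <;> rcases le_or_gt ‖y‖ 1 with h' | h'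
      · simp [coords_of_le h, coords_of_le h', h, h']
      · have : x * y⁻¹ - 1 = (x - y) / y := by field_simp [key y h']
        simp [coords_of_le h, coords_of_lt h', h, h'.le, this]
      · have : 1 - x⁻¹ * y = (x - y) / x := by field_simp [key x h]
        simp [coords_of_lt h, coords_of_le h', h.le, h', this]
      · have : y⁻¹ - x⁻¹ = (x - y) / (x * y) := by field_simp [key x h, key y h']
        simp [coords_of_lt h, coords_of_lt h', h.le, h'.le, this]

lemma chordalDist_comm (P Q : P1 C) : chordalDist P Q = chordalDist Q P := by
  rw [chordalDist_eq, chordalDist_eq, ← norm_neg]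
  congr 1
  ring

lemma chordalDist_nonneg (P Q : P1 C) : 0 ≤ chordalDist P Q := by
  rw [chordalDist_eq]; exact norm_nonneg _

lemma exists_norm_eq_chordalDist (P Q : P1 C) : ∃ e : C, ‖e‖ = chordalDist P Q :=
  ⟨_, (chordalDist_eq P Q).symm⟩

lemma eq_of_chordalDist_eq_zero {P Q : P1 C} (h : chordalDist P Q = 0) : P = Q := by
  have pos : ∀ x : C, 1 / max ‖x‖ 1 ≠ 0 := fun x => by positivity
  induction P using OnePoint.rec with
  | infty =>
    induction Q using OnePoint.rec with
    | infty => rfl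
    | coe y => exact absurd h (pos y)
  | coe x =>
    induction Q using OnePoint.rec with
    | infty => exact absurd h (pos x)
    | coe y =>
      change ‖x - y‖ / (max ‖x‖ 1 * max ‖y‖ 1) = 0 at h
      have h0 : max ‖x‖ 1 * max ‖y‖ 1 ≠ 0 := by positivity
      rw [div_eq_zero_iff, or_iff_left h0, norm_eq_zero, sub_eq_zero] at h
      rw [h]

lemma chordalDist_self (P : P1 C) : chordalDist P P = 0 := by
  rw [chordalDist_eq, mul_comm, sub_self, norm_zero]

variable [IsUltrametricDist C]

lemma mem_intRing {x : C} : x ∈ IntRing C ↔ ‖x‖ ≤ 1 := by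
  rw [Valuation.mem_valuationSubring_iff, NormedField.valuation_apply]
  rfl

lemma residue_eq_zero_iff {x : IntRing C} :
    IsLocalRing.residue (IntRing C) x = 0 ↔ ‖(x : C)‖ < 1 := by
  rw [IsLocalRing.residue_eq_zero_iff, IsLocalRing.mem_maximalIdeal, mem_nonunits_iff,
    ← not_iff_not, not_not, not_lt]
  constructor
  · intro h
    obtain ⟨y, hy⟩ := h.exists_right_inv
    have h1 : ‖(x : C)‖ * ‖(y : C)‖ = 1 := by
      rw [← norm_mul, ← norm_one (α := C)]
      exact congrArg (fun z : IntRing C => ‖(z : C)‖) hy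
    have h2 := mem_intRing.mp x.2
    have h3 := mem_intRing.mp y.2
    nlinarith [norm_nonneg (x : C), norm_nonneg (y : C)]
  · intro h
    have hx : (x : C) ≠ 0 := by
      intro h0
      rw [h0, norm_zero] at h
      linarith
    have hinv : (x : C)⁻¹ ∈ IntRing C := by
      rw [mem_intRing, norm_inv]
      exact inv_le_one_of_one_le₀ h
    exact IsUnit.of_mul_eq_one ⟨_, hinv⟩ (Subtype.ext (mul_inv_cancel₀ hx))

lemma norm_sub_le_max' (x y : C) : ‖x - y‖ ≤ max ‖x‖ ‖y‖ := by
  rw [sub_eq_add_neg, ← norm_neg y]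
  exact IsUltrametricDist.norm_add_le_max _ _

lemma chordalDist_le_one (P Q : P1 C) : chordalDist P Q ≤ 1 := by
  rw [chordalDist_eq]
  refine (norm_sub_le_max' _ _).trans (max_le ?_ ?_) <;> rw [norm_mul] <;>
    apply mul_le_one₀ <;> simp [norm_coords_le]

lemma chordalDist_le_max (P Q R : P1 C) :
    chordalDist P R ≤ max (chordalDist P Q) (chordalDist Q R) := by
  simp only [chordalDist_eq]
  set p := coords P
  set q := coords Q
  set r := coords R
  have hp := norm_coords_le P
  have hr := norm_coords_le R
  have aux : ∀ a b x y : C, ‖x‖ ≤ 1 → ‖y‖ ≤ 1 → ‖a * x + b * y‖ ≤ max ‖a‖ ‖b‖ := by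
    intro a b x y hx hy
    refine (IsUltrametricDist.norm_add_le_max _ _).trans (max_le_max ?_ ?_) <;> rw [norm_mul]
    · exact mul_le_of_le_one_right (norm_nonneg _) hx
    · exact mul_le_of_le_one_right (norm_nonneg _) hy
  -- the Plücker relation, in a coordinate where `q` has the entry `1`
  rcases coords_eq_one Q with h | h
  · have : p.1 * r.2 - p.2 * r.1 =
        (p.1 * q.2 - p.2 * q.1) * r.1 + (q.1 * r.2 - q.2 * r.1) * p.1 := by
      rw [show q.1 = 1 from h]; ring
    rw [this]
    exact aux _ _ _ _ hr.1 hp.1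
  · have : p.1 * r.2 - p.2 * r.1 =
        (p.1 * q.2 - p.2 * q.1) * r.2 + (q.1 * r.2 - q.2 * r.1) * p.2 := by
      rw [show q.2 = 1 from h]; ring
    rw [this]
    exact aux _ _ _ _ hr.2 hp.2

lemma red_infty : red (OnePoint.infty : P1 C) = OnePoint.infty := rfl

lemma red_of_le {x : C} (hx : ‖x‖ ≤ 1) : red (x : P1 C) =
    ((IsLocalRing.residue (IntRing C) ⟨x, mem_intRing.mpr hx⟩ : ResField C) : P1 (ResField C)) :=
  dif_pos (mem_intRing.mpr hx)

lemma red_of_lt {x : C} (hx : 1 < ‖x‖) : red (x : P1 C) = OnePoint.infty :=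
  dif_neg (fun h => hx.not_ge (mem_intRing.mp h))

lemma red_surjective : Function.Surjective (red (C := C)) := by
  intro a
  induction a using OnePoint.rec with
  | infty => exact ⟨OnePoint.infty, rfl⟩
  | coe a =>
    obtain ⟨x, rfl⟩ := IsLocalRing.residue_surjective a
    exact ⟨((x : C) : P1 C), red_of_le (mem_intRing.mp x.2)⟩

lemma norm_one_sub_of_lt {z : C} (hz : ‖z‖ < 1) : ‖1 - z‖ = 1 := by
  have h : ‖(1 : C)‖ ≠ ‖-z‖ := by rw [norm_one, norm_neg]; exact hz.ne'
  rw [sub_eq_add_neg, IsUltrametricDist.norm_add_eq_max_of_norm_ne_norm h, norm_one, norm_neg,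
    max_eq_left hz.le]

/-- Residue classes are the open unit balls of the chordal distance. -/
lemma chordalDist_lt_one_iff (P Q : P1 C) : chordalDist P Q < 1 ↔ red P = red Q := by
  have key : ∀ x : C, 1 < ‖x‖ → ‖x⁻¹‖ < 1 := fun x hx => by
    rw [norm_inv]; exact inv_lt_one_of_one_lt₀ hx
  have mixed : ∀ x y : C, ‖x‖ ≤ 1 → 1 < ‖y‖ → ‖1 - y⁻¹ * x‖ = 1 := fun x y hx hy => by
    refine norm_one_sub_of_lt ?_
    rw [norm_mul]
    exact mul_lt_one_of_nonneg_of_lt_one_left (norm_nonneg _) (key y hy) hx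
  rw [chordalDist_eq]
  induction P using OnePoint.rec with
  | infty =>
    induction Q using OnePoint.rec with
    | infty => simp [coords_infty]
    | coe y =>
      rcases le_or_gt ‖y‖ 1 with h | h
      · simp [coords_infty, coords_of_le h, red_of_le h, red_infty]
      · simpa [coords_infty, coords_of_lt h, red_of_lt h, red_infty] using key y h
  | coe x =>
    induction Q using OnePoint.rec with
    | infty =>
      rcases le_or_gt ‖x‖ 1 with h | h
      · simp [coords_infty, coords_of_le h, red_of_le h, red_infty]
      · simpa [coords_infty, coords_of_lt h, red_of_lt h, red_infty] using key x h
    | coe y =>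
      rcases le_or_gt ‖x‖ 1 with h | h <;> rcases le_or_gt ‖y‖ 1 with h' | h'
      · rw [coords_of_le h, coords_of_le h', red_of_le h, red_of_le h', OnePoint.coe_eq_coe,
          ← sub_eq_zero, ← map_sub, residue_eq_zero_iff]
        simp
      · rw [coords_of_le h, coords_of_lt h', red_of_le h, red_of_lt h']
        have := mixed x y h h'
        rw [← norm_neg, neg_sub, mul_comm] at this
        simp [this]
      · rw [coords_of_lt h, coords_of_le h', red_of_lt h, red_of_le h']
        have := mixed y x h' h
        simp [this]
      · rw [coords_of_lt h, coords_of_lt h', red_of_lt h, red_of_lt h']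
        simpa using (norm_sub_le_max' _ _).trans_lt (max_lt (key y h') (key x h))

lemma chordalDist_eq_one {P Q : P1 C} (h : red P ≠ red Q) : chordalDist P Q = 1 :=
  le_antisymm (chordalDist_le_one P Q) (not_lt.mp fun hlt => h ((chordalDist_lt_one_iff P Q).mp hlt))

end Chordal

/-! ### Factorization of binary forms and reduction of their zeros -/

section Factorization

variable {C : Type*} [NormedField C]

/-- The maximum norm of the coordinates `(x, 1)`, or `(1, 0)`, of a point. -/
def weight : P1 C → ℝ
  | OnePoint.infty => 1
  | OnePoint.some x => max ‖x‖ 1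

@[simp] lemma weight_infty : weight (OnePoint.infty : P1 C) = 1 := rfl

@[simp] lemma weight_coe (x : C) : weight (x : P1 C) = max ‖x‖ 1 := rfl

lemma weight_pos (P : P1 C) : 0 < weight P := by
  induction P using OnePoint.rec <;> simp

/-- The Gauss norm of `f`, computed as its Mahler measure: the norm of the leading coefficient
times the product of the factors `max |u| 1` over the roots `u`. -/
def mahler (f : C[X]) : ℝ := ‖f.leadingCoeff‖ * (f.roots.map fun u => max ‖u‖ 1).prod

lemma mahler_C_mul {c : C} (hc : c ≠ 0) (f : C[X]) : mahler (Polynomial.C c * f) = ‖c‖ * mahler f := by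
  rw [mahler, mahler, roots_C_mul f hc, leadingCoeff_mul, leadingCoeff_C, norm_mul, mul_assoc]

/-- Up to normalization, the absolute value of a binary form at a point is the product of the
chordal distances to its zeros. -/
lemma norm_ev_eq [IsAlgClosed C] {D : ℕ} {f : C[X]} (hD : f.natDegree ≤ D)
    (P : P1 C) :
    ‖ev D f P‖ = mahler f * weight P ^ D * ((formRoots D f).map (chordalDist P)).prod := by
  have hs := IsAlgClosed.splits f
  have hcard := hs.natDegree_eq_card_roots
  rw [formRoots, Multiset.map_add, Multiset.prod_add, Multiset.map_map, Multiset.map_replicate,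
    Multiset.prod_replicate, mahler]
  induction P using OnePoint.rec with
  | infty =>
    have h1 : (f.roots.map fun u => max ‖u‖ 1).prod *
        (f.roots.map (chordalDist OnePoint.infty ∘ fun x : C => (x : P1 C))).prod = 1 := by
      rw [← Multiset.prod_map_mul]
      refine Multiset.prod_eq_one fun z hz => ?_
      obtain ⟨u, -, rfl⟩ := Multiset.mem_map.mp hz
      change max ‖u‖ 1 * (1 / max ‖u‖ 1) = 1
      exact mul_one_div_cancel (by positivity)
    have h2 : chordalDist (OnePoint.infty : P1 C) OnePoint.infty = 0 := rfl
    rw [weight_infty, one_pow, mul_one, mul_assoc, ← mul_assoc _ _ ((_ : ℝ) ^ _), h1, one_mul, h2,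
      ev_infty]
    rcases hD.eq_or_lt with h | h
    · rw [← h, Nat.sub_self, pow_zero, mul_one]
      rfl
    · rw [coeff_eq_zero_of_natDegree_lt h, norm_zero, zero_pow (by omega), mul_zero]
  | coe x =>
    have h1 : (f.roots.map fun u => ‖x - u‖).prod = (f.roots.map fun u => max ‖u‖ 1).prod *
        weight (x : P1 C) ^ f.natDegree *
        (f.roots.map (chordalDist (x : P1 C) ∘ fun x : C => (x : P1 C))).prod := by
      rw [hcard, ← Multiset.prod_replicate, ← Multiset.map_const', ← Multiset.prod_map_mul,
        ← Multiset.prod_map_mul]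
      congr 1
      refine Multiset.map_congr rfl fun u _ => ?_
      change ‖x - u‖ = max ‖u‖ 1 * max ‖x‖ 1 * (‖x - u‖ / (max ‖x‖ 1 * max ‖u‖ 1))
      field_simp
    have h2 : weight (x : P1 C) * chordalDist (x : P1 C) OnePoint.infty = 1 := by
      change max ‖x‖ 1 * (1 / max ‖x‖ 1) = 1
      exact mul_one_div_cancel (by positivity)
    have h3 : ‖f.eval x‖ = ‖f.leadingCoeff‖ * (f.roots.map fun u => ‖x - u‖).prod := by
      conv_lhs => rw [hs.eval_eq_prod_roots]
      have h := map_multiset_prod (normHom : C →*₀ ℝ) (f.roots.map fun u => x - u)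
      rw [Multiset.map_map] at h
      rw [norm_mul]
      exact congrArg (‖f.leadingCoeff‖ * ·) h
    have h4 : weight (x : P1 C) ^ D =
        weight (x : P1 C) ^ f.natDegree * weight (x : P1 C) ^ (D - f.natDegree) := by
      rw [← pow_add]; congr 1; omega
    rw [ev_coe, h3, h1, h4]
    have h5 : weight (x : P1 C) ^ (D - f.natDegree) *
        chordalDist (x : P1 C) OnePoint.infty ^ (D - f.natDegree) = 1 := by
      rw [← mul_pow, h2, one_pow]
    linear_combination (-‖f.leadingCoeff‖ * (f.roots.map fun u => max ‖u‖ 1).prod *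
      weight (x : P1 C) ^ f.natDegree *
      (f.roots.map (chordalDist (x : P1 C) ∘ fun x : C => (x : P1 C))).prod) * h5

end Factorization

section Reduction

variable {L : Type*} [NormedField L] [IsUltrametricDist L]

open Classical in
/-- A linear polynomial of Gauss norm `1` with root `u`. -/
def integralFactor (u : L) : (IntRing L)[X] :=
  if h : ‖u‖ ≤ 1 then X - C ⟨u, mem_intRing.mpr h⟩
  else C ⟨u⁻¹, mem_intRing.mpr (by
    rw [norm_inv]; exact inv_le_one_of_one_le₀ (not_le.mp h).le)⟩ * X - 1

lemma exists_integralFactor_map (u : L) : ∃ κ : L, ‖κ‖ = max ‖u‖ 1 ∧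
    X - C u = C κ * (integralFactor u).map (IntRing L).subtype := by
  rcases le_or_gt ‖u‖ 1 with h | h
  · exact ⟨1, by simp [h], by simp [integralFactor, h]⟩
  · refine ⟨u, by simp [h.le], ?_⟩
    have hu : u ≠ 0 := fun h0 => by
      rw [h0, norm_zero] at h; linarith
    simp [integralFactor, not_le.mpr h, mul_sub, ← mul_assoc, ← C_mul, hu]

lemma integralFactor_residue_ne_zero (u : L) :
    (integralFactor u).map (IsLocalRing.residue (IntRing L)) ≠ 0 := by
  rcases le_or_gt ‖u‖ 1 with h | h
  · simpa [integralFactor, h] using X_sub_C_ne_zero _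
  · have h0 : IsLocalRing.residue (IntRing L) ⟨u⁻¹, mem_intRing.mpr (by
        rw [norm_inv]; exact inv_le_one_of_one_le₀ h.le)⟩ = 0 := by
      rw [residue_eq_zero_iff, norm_inv]
      exact inv_lt_one_of_one_lt₀ h
    simp [integralFactor, not_le.mpr h, h0]

lemma formRoots_integralFactor_residue (u : L) :
    (integralFactor u).map (IsLocalRing.residue (IntRing L)) ≠ 0 ∧
    ((integralFactor u).map (IsLocalRing.residue (IntRing L))).natDegree ≤ 1 ∧
    formRoots 1 ((integralFactor u).map (IsLocalRing.residue (IntRing L))) =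
      {red (u : P1 L)} := by
  refine ⟨integralFactor_residue_ne_zero u, ?_⟩
  rcases le_or_gt ‖u‖ 1 with h | h
  · simp [integralFactor, h, formRoots, red_of_le h]
  · have h0 : IsLocalRing.residue (IntRing L) ⟨u⁻¹, mem_intRing.mpr (by
        rw [norm_inv]; exact inv_le_one_of_one_le₀ h.le)⟩ = 0 := by
      rw [residue_eq_zero_iff, norm_inv]
      exact inv_lt_one_of_one_lt₀ h
    have h1 : (integralFactor u).map (IsLocalRing.residue (IntRing L)) = C (-1) := by
      simp [integralFactor, not_le.mpr h, h0]
    rw [h1]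
    simp [formRoots, red_of_lt h]

/-- The polynomial with roots `s` and Gauss norm `1`. -/
lemma exists_integral_prod (s : Multiset L) : ∃ (κ : L) (G : (IntRing L)[X]),
    ‖κ‖ = (s.map fun u => max ‖u‖ 1).prod ∧
    (s.map fun u => X - C u).prod = C κ * G.map (IntRing L).subtype ∧
    G.map (IsLocalRing.residue (IntRing L)) ≠ 0 ∧
    (G.map (IsLocalRing.residue (IntRing L))).natDegree ≤ Multiset.card s ∧
    formRoots (Multiset.card s) (G.map (IsLocalRing.residue (IntRing L))) =
      s.map (fun u : L => red (u : P1 L)) := by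
  induction s using Multiset.induction with
  | empty => exact ⟨1, 1, by simp, by simp, by simp, by simp, by simp [formRoots]⟩
  | cons u s ih =>
    obtain ⟨κ, G, h1, h2, h3, h4, h5⟩ := ih
    obtain ⟨κ', h1', h2'⟩ := exists_integralFactor_map u
    obtain ⟨h3', h4', h5'⟩ := formRoots_integralFactor_residue u
    refine ⟨κ' * κ, integralFactor u * G, ?_, ?_, ?_, ?_, ?_⟩
    · rw [norm_mul, h1, h1', Multiset.map_cons, Multiset.prod_cons]
    · rw [Multiset.map_cons, Multiset.prod_cons, h2, h2', Polynomial.map_mul, C_mul]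
      ring
    · rw [Polynomial.map_mul]
      exact mul_ne_zero h3' h3
    · rw [Polynomial.map_mul, natDegree_mul h3' h3, Multiset.card_cons]
      omega
    · rw [Polynomial.map_mul, Multiset.card_cons, add_comm, formRoots_mul h3' h3 h4' h4, h5, h5',
        Multiset.map_cons, Multiset.singleton_add]

lemma exists_norm_coeff_eq_one {F : (IntRing L)[X]}
    (hF : F.map (IsLocalRing.residue (IntRing L)) ≠ 0) : ∃ i, ‖(F.coeff i : L)‖ = 1 := by
  by_contra! h
  refine hF (Polynomial.ext fun i => ?_)
  rw [coeff_map, coeff_zero, residue_eq_zero_iff]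
  exact lt_of_le_of_ne (mem_intRing.mp (F.coeff i).2) (h i)

/-- If two pairs of integral polynomials of Gauss norm `1` are proportional, then the factor has
norm `1`. -/
lemma norm_eq_one_of_map_eq {κ : L} {F F' G G' : (IntRing L)[X]}
    (hF : ∃ i, ‖(F.coeff i : L)‖ = 1 ∨ ‖(F'.coeff i : L)‖ = 1)
    (hG : ∃ i, ‖(G.coeff i : L)‖ = 1 ∨ ‖(G'.coeff i : L)‖ = 1)
    (h : F.map (IntRing L).subtype = C κ * G.map (IntRing L).subtype)
    (h' : F'.map (IntRing L).subtype = C κ * G'.map (IntRing L).subtype) : ‖κ‖ = 1 := by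
  have coeff_eq : ∀ {F G : (IntRing L)[X]},
      F.map (IntRing L).subtype = C κ * G.map (IntRing L).subtype →
      ∀ i, (F.coeff i : L) = κ * (G.coeff i : L) := fun h i => by
    simpa using congrArg (fun p => p.coeff i) h
  have le_one : ∀ {F G : (IntRing L)[X]},
      F.map (IntRing L).subtype = C κ * G.map (IntRing L).subtype →
      ∀ i, ‖(G.coeff i : L)‖ = 1 → ‖κ‖ ≤ 1 := fun {F G} h i hi => by
    have := mem_intRing.mp (F.coeff i).2
    rwa [coeff_eq h, norm_mul, hi, mul_one] at this
  have one_le : ∀ {F G : (IntRing L)[X]},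
      F.map (IntRing L).subtype = C κ * G.map (IntRing L).subtype →
      ∀ i, ‖(F.coeff i : L)‖ = 1 → 1 ≤ ‖κ‖ := fun {F G} h i hi => by
    rw [coeff_eq h, norm_mul] at hi
    rw [← hi]
    exact mul_le_of_le_one_right (norm_nonneg _) (mem_intRing.mp (G.coeff i).2)
  obtain ⟨i, hi⟩ := hG
  obtain ⟨j, hj⟩ := hF
  exact le_antisymm (hi.elim (le_one h i) (le_one h' i)) (hj.elim (one_le h j) (one_le h' j))

lemma map_subtype_injective :
    Function.Injective (Polynomial.map (IntRing L).subtype) :=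
  Polynomial.map_injective _ Subtype.val_injective

lemma natDegree_map_subtype (F : (IntRing L)[X]) :
    (F.map (IntRing L).subtype).natDegree = F.natDegree :=
  natDegree_map_eq_of_injective Subtype.val_injective F

/-- The zeros of the reduction of a binary form of Gauss norm `1` are the reductions of its
zeros. -/
lemma formRoots_map_residue [IsAlgClosed L] {D : ℕ} {F : (IntRing L)[X]}
    (hF : F.map (IsLocalRing.residue (IntRing L)) ≠ 0) (hD : F.natDegree ≤ D) :
    mahler (F.map (IntRing L).subtype) = 1 ∧
    formRoots D (F.map (IsLocalRing.residue (IntRing L))) =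
      (formRoots D (F.map (IntRing L).subtype)).map red := by
  set f := F.map (IntRing L).subtype with hf
  obtain ⟨κ, G, h1, h2, h3, h4, h5⟩ := exists_integral_prod f.roots
  have hs := IsAlgClosed.splits f
  have hfG : f = C (f.leadingCoeff * κ) * G.map (IntRing L).subtype := by
    conv_lhs => rw [hs.eq_prod_roots]
    rw [h2, C_mul, mul_assoc]
  have hκ : ‖f.leadingCoeff * κ‖ = 1 :=
    norm_eq_one_of_map_eq ((exists_norm_coeff_eq_one hF).imp fun _ => Or.inl)
      ((exists_norm_coeff_eq_one h3).imp fun _ => Or.inl) hfG hfG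
  refine ⟨by rw [mahler, ← h1, ← norm_mul, hκ], ?_⟩
  have hFG : F = C ⟨f.leadingCoeff * κ, mem_intRing.mpr hκ.le⟩ * G := by
    apply map_subtype_injective
    rw [← hf, Polynomial.map_mul, map_C]
    exact hfG
  have hres : IsLocalRing.residue (IntRing L) ⟨f.leadingCoeff * κ, mem_intRing.mpr hκ.le⟩ ≠ 0 := by
    rw [Ne, residue_eq_zero_iff, hκ]
    exact lt_irrefl _
  have hdeg : f.natDegree = Multiset.card f.roots := hs.natDegree_eq_card_roots
  have hsplit : D = Multiset.card f.roots + (D - f.natDegree) := by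
    rw [hf, natDegree_map_subtype] at *
    omega
  have h1' : formRoots (D - f.natDegree) (1 : (ResField L)[X]) =
      Multiset.replicate (D - f.natDegree) OnePoint.infty := by simp [formRoots]
  have h6 : formRoots D (G.map (IsLocalRing.residue (IntRing L))) =
      formRoots (Multiset.card f.roots) (G.map (IsLocalRing.residue (IntRing L))) +
        formRoots (D - f.natDegree) (1 : (ResField L)[X]) := by
    rw [← formRoots_mul h3 one_ne_zero h4 (by simp), mul_one, ← hsplit]
  rw [hFG, Polynomial.map_mul, map_C, formRoots_C_mul hres, h6, h5, h1', formRoots,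
    Multiset.map_add, Multiset.map_map, Multiset.map_replicate, red_infty]
  rfl

/-- Scaling to Gauss norm `1`. -/
lemma exists_integral_of_ne_zero [IsAlgClosed L] {p : L[X]} (hp : p ≠ 0) :
    ∃ (c : L) (P : (IntRing L)[X]), c ≠ 0 ∧ p = C c * P.map (IntRing L).subtype ∧
      P.map (IsLocalRing.residue (IntRing L)) ≠ 0 := by
  obtain ⟨κ, G, h1, h2, h3, h4, h5⟩ := exists_integral_prod p.roots
  have hs := IsAlgClosed.splits p
  have hpG : p = C (p.leadingCoeff * κ) * G.map (IntRing L).subtype := by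
    conv_lhs => rw [hs.eq_prod_roots]
    rw [h2, C_mul, mul_assoc]
  refine ⟨_, G, fun h0 => hp ?_, hpG, h3⟩
  rw [hpG, h0, C_0, zero_mul]

end Reduction

section Fibres

variable {L : Type*} [NormedField L] [IsUltrametricDist L]

/-- Scaling a pair of polynomials to Gauss norm `1`. -/
lemma exists_integral_pair [IsAlgClosed L] (p : L[X]) {q : L[X]} (hq : q ≠ 0) :
    ∃ (c : L) (P Q : (IntRing L)[X]), c ≠ 0 ∧ p = C c * P.map (IntRing L).subtype ∧
      q = C c * Q.map (IntRing L).subtype ∧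
      (P.map (IsLocalRing.residue (IntRing L)) ≠ 0 ∨
        Q.map (IsLocalRing.residue (IntRing L)) ≠ 0) := by
  obtain ⟨c, Q, hc, hQ, hQ0⟩ := exists_integral_of_ne_zero hq
  by_cases hp : p = 0
  · exact ⟨c, 0, Q, hc, by simp [hp], hQ, Or.inr hQ0⟩
  obtain ⟨c', P, hc', hP, hP0⟩ := exists_integral_of_ne_zero hp
  have div_mem : ∀ a b : L, b ≠ 0 → ‖a‖ ≤ ‖b‖ → a / b ∈ IntRing L := fun a b hb hab => by
    rw [mem_intRing, norm_div]
    exact (div_le_one (norm_pos_iff.mpr hb)).mpr hab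
  have scale : ∀ (a b : L) (hb : b ≠ 0) (hab : ‖a‖ ≤ ‖b‖) (R : (IntRing L)[X]),
      C a * R.map (IntRing L).subtype =
        C b * (C (⟨a / b, div_mem a b hb hab⟩ : IntRing L) * R).map (IntRing L).subtype := by
    intro a b hb hab R
    rw [Polynomial.map_mul, map_C, ← mul_assoc, ← C_mul]
    congr 2
    change a = b * (a / b)
    field_simp
  rcases le_total ‖c'‖ ‖c‖ with h | h
  · exact ⟨c, _, Q, hc, hP.trans (scale c' c hc h P), hQ, Or.inr hQ0⟩
  · exact ⟨c', P, _, hc', hP, hQ.trans (scale c c' hc' h Q), Or.inl hP0⟩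

/-- A rational function with nontrivial reduction can be written as a quotient of coprime
polynomials exhibiting that reduction: the common factors of any representation can be divided
out. -/
lemma exists_coprime_integral_pair [IsAlgClosed L] {φ : RatFunc L} {ψ : RatFunc (ResField L)}
    (h : IsNontrivialReduction φ ψ) :
    ∃ F G : (IntRing L)[X],
      IsCoprime (F.map (IntRing L).subtype) (G.map (IntRing L).subtype) ∧
      G.map (IntRing L).subtype ≠ 0 ∧
      φ = algebraMap L[X] (RatFunc L) (F.map (IntRing L).subtype) /
        algebraMap L[X] (RatFunc L) (G.map (IntRing L).subtype) ∧
      ∃ f₀ g₀ h : (ResField L)[X], h ≠ 0 ∧ IsCoprime f₀ g₀ ∧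
        F.map (IsLocalRing.residue (IntRing L)) = h * f₀ ∧
        G.map (IsLocalRing.residue (IntRing L)) = h * g₀ ∧
        ψ = algebraMap (ResField L)[X] (RatFunc (ResField L)) f₀ /
          algebraMap (ResField L)[X] (RatFunc (ResField L)) g₀ := by
  classical
  obtain ⟨f, g, hg0, hφ, hone, f₁, g₁, h, f₀, g₀, hf₁, hg₁, hh, hf₀, hg₀, -, hψ⟩ := h
  have hgL : g.map (IntRing L).subtype ≠ 0 := fun h0 =>
    hg0 (map_subtype_injective (by rw [h0, Polynomial.map_zero]))
  -- `f = φ.num * q` and `g = φ.denom * q`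
  obtain ⟨q, hq⟩ : φ.denom ∣ g.map (IntRing L).subtype := by
    rw [hφ]; exact RatFunc.denom_div_dvd _ _
  have hq0 : q ≠ 0 := fun h0 => hgL (by rw [hq, h0, mul_zero])
  have hfq : f.map (IntRing L).subtype = φ.num * q := by
    have h1 := (RatFunc.num_mul_eq_mul_denom_iff hgL).mpr hφ
    apply mul_right_cancel₀ φ.denom_ne_zero
    rw [← h1, hq]
    ring
  obtain ⟨c, N, E, hc, hN, hE, hNE⟩ := exists_integral_pair φ.num φ.denom_ne_zero
  obtain ⟨c', Q, hc', hQ, hQ0⟩ := exists_integral_of_ne_zero hq0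
  have hf' : f.map (IntRing L).subtype = C (c * c') * (N * Q).map (IntRing L).subtype := by
    rw [hfq, hN, hQ, Polynomial.map_mul, C_mul]; ring
  have hg' : g.map (IntRing L).subtype = C (c * c') * (E * Q).map (IntRing L).subtype := by
    rw [hq, hE, hQ, Polynomial.map_mul, C_mul]; ring
  have hNEQ : ∃ i, ‖((N * Q).coeff i : L)‖ = 1 ∨ ‖((E * Q).coeff i : L)‖ = 1 := by
    rcases hNE with h | h
    · exact (exists_norm_coeff_eq_one (F := N * Q)
        (by rw [Polynomial.map_mul]; exact mul_ne_zero h hQ0)).imp fun _ => Or.inl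
    · exact (exists_norm_coeff_eq_one (F := E * Q)
        (by rw [Polynomial.map_mul]; exact mul_ne_zero h hQ0)).imp fun _ => Or.inr
  have hnorm : ‖c * c'‖ = 1 := norm_eq_one_of_map_eq hone hNEQ hf' hg'
  set u : IntRing L := ⟨c * c', mem_intRing.mpr hnorm.le⟩ with hu
  have hcc : c * c' ≠ 0 := mul_ne_zero hc hc'
  have hF : f = C u * N * Q := by
    apply map_subtype_injective
    rw [hf', Polynomial.map_mul, Polynomial.map_mul, Polynomial.map_mul, map_C, mul_assoc]
    rfl
  have hG : g = C u * E * Q := by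
    apply map_subtype_injective
    rw [hg', Polynomial.map_mul, Polynomial.map_mul, Polynomial.map_mul, map_C, mul_assoc]
    rfl
  have hFL : (C u * N).map (IntRing L).subtype = C c' * φ.num := by
    rw [hN, Polynomial.map_mul, map_C, ← mul_assoc, ← C_mul, mul_comm c' c]
    rfl
  have hGL : (C u * E).map (IntRing L).subtype = C c' * φ.denom := by
    rw [hE, Polynomial.map_mul, map_C, ← mul_assoc, ← C_mul, mul_comm c' c]
    rfl
  have hcu : IsUnit (C c' : L[X]) := isUnit_C.mpr hc'.isUnit
  -- the gcd `h` of the reductions is nonzero, and divisible by the reduction of `Q`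
  have hh0 : h ≠ 0 := by
    intro h0
    obtain ⟨h1, h2⟩ := EuclideanDomain.gcd_eq_zero_iff.mp (hh.symm.trans h0)
    obtain ⟨i, hi⟩ := hone
    have key : ∀ {p : (IntRing L)[X]}, p.map (IsLocalRing.residue (IntRing L)) = 0 →
        ‖(p.coeff i : L)‖ ≠ 1 := fun {p} hp => by
      have := congrArg (fun r => r.coeff i) hp
      simp only [coeff_map, coeff_zero] at this
      exact (residue_eq_zero_iff.mp this).ne
    exact hi.elim (key (hf₁ ▸ h1)) (key (hg₁ ▸ h2))
  have hf₁h : f₁ = h * f₀ := by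
    rw [hf₀, EuclideanDomain.mul_div_cancel' hh0 (hh ▸ EuclideanDomain.gcd_dvd_left f₁ g₁)]
  have hg₁h : g₁ = h * g₀ := by
    rw [hg₀, EuclideanDomain.mul_div_cancel' hh0 (hh ▸ EuclideanDomain.gcd_dvd_right f₁ g₁)]
  have hcop : IsCoprime f₀ g₀ := by
    refine ⟨EuclideanDomain.gcdA f₁ g₁, EuclideanDomain.gcdB f₁ g₁, ?_⟩
    apply mul_left_cancel₀ hh0
    have := EuclideanDomain.gcd_eq_gcd_ab f₁ g₁
    rw [← hh] at this
    calc _ = h * f₀ * EuclideanDomain.gcdA f₁ g₁ + h * g₀ * EuclideanDomain.gcdB f₁ g₁ := by ring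
      _ = _ := by rw [← hf₁h, ← hg₁h, ← this, mul_one]
  set Qr := Q.map (IsLocalRing.residue (IntRing L)) with hQr
  have hf₁Q : f₁ = (C u * N).map (IsLocalRing.residue (IntRing L)) * Qr := by
    rw [hf₁, hF, Polynomial.map_mul]
  have hg₁Q : g₁ = (C u * E).map (IsLocalRing.residue (IntRing L)) * Qr := by
    rw [hg₁, hG, Polynomial.map_mul]
  obtain ⟨h', hh'⟩ : Qr ∣ h := by
    rw [hh]
    exact EuclideanDomain.dvd_gcd ⟨_, by rw [hf₁Q, mul_comm]⟩ ⟨_, by rw [hg₁Q, mul_comm]⟩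
  refine ⟨C u * N, C u * E, ?_, ?_, ?_, f₀, g₀, h', ?_, hcop, ?_, ?_, hψ⟩
  · rw [hFL, hGL]
    exact (isCoprime_mul_unit_left hcu _ _).mpr (RatFunc.isCoprime_num_denom φ)
  · rw [hGL]
    exact mul_ne_zero hcu.ne_zero φ.denom_ne_zero
  · rw [hFL, hGL, map_mul, map_mul, mul_div_mul_left, RatFunc.num_div_denom]
    simpa using hc'
  · rintro rfl
    exact hh0 (by rw [hh', mul_zero])
  · apply mul_right_cancel₀ hQ0
    rw [← hf₁Q, hf₁h, hh']; ring
  · apply mul_right_cancel₀ hQ0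
    rw [← hg₁Q, hg₁h, hh']; ring

/-- The fibres of a rational map `φ` with nontrivial reduction `ψ`, as multisets, with their
relation to the fibres of `ψ`. -/
structure ReducedFibres (φ : RatFunc L) (ψ : RatFunc (ResField L)) where
  /-- The zeros of the common factor of the reductions of numerator and denominator: the classes
  on which `φ` need not behave as `ψ`. -/
  bad : Multiset (P1 (ResField L))
  /-- The fibres of `φ`. -/
  fib : P1 L → Multiset (P1 L)
  /-- The fibres of `ψ`. -/
  fibBar : P1 (ResField L) → Multiset (P1 (ResField L))
  /-- The norm of the pair of numerator and denominator at normalized coordinates of a point. -/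
  size : P1 L → ℝ
  mem_fib : ∀ P y, P ∈ fib y ↔ ratMap φ P = y
  mem_fibBar : ∀ a c, a ∈ fibBar c ↔ ratMap ψ a = c
  card_fibBar : ∀ c, Multiset.card (fibBar c) = ratDegree ψ
  map_red_fib : ∀ y, (fib y).map red = bad + fibBar (red y)
  size_mul : ∀ P y, size P * chordalDist (ratMap φ P) y = ((fib y).map (chordalDist P)).prod

/-- A member of the pencil of the lift reduces to a member of the pencil of the reductions. -/
lemma exists_integral_pencil (F G : (IntRing L)[X]) (y : P1 L) :
    ∃ (c : L) (e : ResField L) (R : (IntRing L)[X]), c ≠ 0 ∧ ‖c‖ = weight y ∧ e ≠ 0 ∧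
      pencil (F.map (IntRing L).subtype) (G.map (IntRing L).subtype) y =
        C c * R.map (IntRing L).subtype ∧
      R.map (IsLocalRing.residue (IntRing L)) =
        C e * pencil (F.map (IsLocalRing.residue (IntRing L)))
          (G.map (IsLocalRing.residue (IntRing L))) (red y) := by
  induction y using OnePoint.rec with
  | infty => exact ⟨1, 1, G, one_ne_zero, by simp, one_ne_zero, by simp, by simp [red_infty]⟩
  | coe y =>
    rcases le_or_gt ‖y‖ 1 with h | h
    · refine ⟨1, 1, F - C ⟨y, mem_intRing.mpr h⟩ * G, one_ne_zero, by simp [h], one_ne_zero,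
        by simp, by simp [red_of_le h]⟩
    · have hy : y ≠ 0 := fun h0 => by
        rw [h0, norm_zero] at h; linarith
      have hy1 : ‖y⁻¹‖ < 1 := by rw [norm_inv]; exact inv_lt_one_of_one_lt₀ h
      have h0 : IsLocalRing.residue (IntRing L) ⟨y⁻¹, mem_intRing.mpr hy1.le⟩ = 0 :=
        residue_eq_zero_iff.mpr hy1
      refine ⟨y, -1, C ⟨y⁻¹, mem_intRing.mpr hy1.le⟩ * F - G, hy, by simp [h.le], by simp, ?_,
        by simp [red_of_lt h, h0]⟩
      simp [mul_sub, ← mul_assoc, ← C_mul, hy]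

omit [IsUltrametricDist L] in
lemma norm_sub_mul_eq (a b y : L) (hab : a ≠ 0 ∨ b ≠ 0) :
    ‖a - y * b‖ = max ‖a‖ ‖b‖ * chordalDist (ofCoords a b) (y : P1 L) * max ‖y‖ 1 := by
  by_cases hb : b = 0
  · subst hb
    rw [ofCoords_zero]
    change _ = max ‖a‖ ‖(0 : L)‖ * (1 / max ‖y‖ 1) * max ‖y‖ 1
    simp only [mul_zero, sub_zero, norm_zero, norm_nonneg, sup_of_le_left]
    field_simp
  · rw [ofCoords_of_ne_zero _ hb]
    change _ = max ‖a‖ ‖b‖ * (‖a / b - y‖ / (max ‖a / b‖ 1 * max ‖y‖ 1)) * max ‖y‖ 1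
    have hb' : 0 < ‖b‖ := norm_pos_iff.mpr hb
    have h1 : max ‖a / b‖ 1 = max ‖a‖ ‖b‖ / ‖b‖ := by
      rw [norm_div, ← max_div_div_right hb'.le, div_self hb'.ne']
    have h2 : ‖a / b - y‖ = ‖a - y * b‖ / ‖b‖ := by
      rw [← norm_div]; congr 1; field_simp
    have h3 : 0 < max ‖a‖ ‖b‖ := lt_max_of_lt_right hb'
    rw [h1, h2]
    field_simp

omit [IsUltrametricDist L] in
lemma norm_eq_mul_chordalDist_infty (a b : L) :
    ‖b‖ = max ‖a‖ ‖b‖ * chordalDist (ofCoords a b) OnePoint.infty := by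
  by_cases hb : b = 0
  · subst hb
    rw [ofCoords_zero]
    change _ = max ‖a‖ ‖(0 : L)‖ * 0
    simp
  · rw [ofCoords_of_ne_zero _ hb]
    change _ = max ‖a‖ ‖b‖ * (1 / max ‖a / b‖ 1)
    have hb' : 0 < ‖b‖ := norm_pos_iff.mpr hb
    have h1 : max ‖a / b‖ 1 = max ‖a‖ ‖b‖ / ‖b‖ := by
      rw [norm_div, ← max_div_div_right hb'.le, div_self hb'.ne']
    have h3 : 0 < max ‖a‖ ‖b‖ := lt_max_of_lt_right hb'
    rw [h1]
    field_simp

omit [IsUltrametricDist L] in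
lemma norm_ev_pencil (D : ℕ) (f g : L[X]) (P y : P1 L) (h : ev D f P ≠ 0 ∨ ev D g P ≠ 0) :
    ‖ev D (pencil f g y) P‖ = max ‖ev D f P‖ ‖ev D g P‖ *
      chordalDist (ofCoords (ev D f P) (ev D g P)) y * weight y := by
  induction y using OnePoint.rec with
  | infty => simpa using norm_eq_mul_chordalDist_infty (ev D f P) (ev D g P)
  | coe y => rw [ev_pencil_coe, norm_sub_mul_eq _ _ _ h, weight_coe]

theorem nonempty_reducedFibres [IsAlgClosed L] [IsAlgClosed (ResField L)] {φ : RatFunc L}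
    {ψ : RatFunc (ResField L)} (h : IsNontrivialReduction φ ψ) (hdeg : 2 ≤ ratDegree ψ) :
    Nonempty (ReducedFibres φ ψ) := by
  obtain ⟨F, G, hFG, hG0, hφ, f₀, g₀, h, hh0, hcop, hF, hG, hψ⟩ := exists_coprime_integral_pair h
  have hg₀ : g₀ ≠ 0 := by
    rintro rfl
    rw [map_zero, div_zero] at hψ
    simp [hψ, ratDegree] at hdeg
  have hd := ratDegree_eq hcop hg₀ hψ
  have hd0 : ratDegree ψ ≠ 0 := by omega
  set D := max F.natDegree G.natDegree with hDdef
  have hFD : (F.map (IntRing L).subtype).natDegree ≤ D := by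
    rw [natDegree_map_subtype]; exact le_max_left _ _
  have hGD : (G.map (IntRing L).subtype).natDegree ≤ D := by
    rw [natDegree_map_subtype]; exact le_max_right _ _
  have hD : D = max (F.map (IntRing L).subtype).natDegree (G.map (IntRing L).subtype).natDegree := by
    rw [natDegree_map_subtype, natDegree_map_subtype]
  have hle : h.natDegree + ratDegree ψ ≤ D := by
    have aux : ∀ (p : (IntRing L)[X]) (p₀ : (ResField L)[X]), p₀ ≠ 0 → p.natDegree ≤ D →
        p.map (IsLocalRing.residue (IntRing L)) = h * p₀ → h.natDegree + p₀.natDegree ≤ D := by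
      intro p p₀ hp₀ hpD hp
      rw [← natDegree_mul hh0 hp₀, ← hp]
      exact natDegree_map_le.trans hpD
    have hGle := aux G g₀ hg₀ (le_max_right _ _) hG
    by_cases hf₀ : f₀ = 0
    · rw [hd, hf₀, natDegree_zero, Nat.zero_max]
      exact hGle
    · have hFle := aux F f₀ hf₀ (le_max_left _ _) hF
      rw [hd]
      omega
  have hD0 : D ≠ 0 := by omega
  have hpbar : ∀ c, pencil f₀ g₀ c ≠ 0 := pencil_ne_zero hcop (hd ▸ hd0)
  have hpdeg : ∀ c, (pencil f₀ g₀ c).natDegree ≤ ratDegree ψ :=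
    natDegree_pencil_le (hd ▸ le_max_left _ _) (hd ▸ le_max_right _ _)
  have key : ∀ y, mahler (pencil (F.map (IntRing L).subtype) (G.map (IntRing L).subtype) y) =
      weight y ∧
      (formRoots D (pencil (F.map (IntRing L).subtype) (G.map (IntRing L).subtype) y)).map red =
        formRoots (D - ratDegree ψ) h + formRoots (ratDegree ψ) (pencil f₀ g₀ (red y)) := by
    intro y
    obtain ⟨c, e, R, hc, hcw, he, hR, hRbar⟩ := exists_integral_pencil F G y
    rw [hF, hG, pencil_mul_left] at hRbar
    have hRbar0 : R.map (IsLocalRing.residue (IntRing L)) ≠ 0 := by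
      rw [hRbar]
      exact mul_ne_zero (C_ne_zero.mpr he) (mul_ne_zero hh0 (hpbar _))
    have hRD : R.natDegree ≤ D := by
      rw [← natDegree_map_subtype, ← natDegree_C_mul hc, ← hR]
      exact natDegree_pencil_le hFD hGD y
    obtain ⟨h1, h2⟩ := formRoots_map_residue hRbar0 hRD
    rw [hR, mahler_C_mul hc, h1, mul_one, hcw, formRoots_C_mul hc, ← h2, hRbar,
      formRoots_C_mul he, ← formRoots_mul hh0 (hpbar _) (by omega) (hpdeg _)]
    exact ⟨rfl, by congr 1; omega⟩
  exact ⟨{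
    bad := formRoots (D - ratDegree ψ) h
    fib := fun y => formRoots D
      (pencil (F.map (IntRing L).subtype) (G.map (IntRing L).subtype) y)
    fibBar := fun c => formRoots (ratDegree ψ) (pencil f₀ g₀ c)
    size := fun P => max ‖ev D (F.map (IntRing L).subtype) P‖
      ‖ev D (G.map (IntRing L).subtype) P‖ / weight P ^ D
    mem_fib := mem_formRoots_pencil hFG hG0 hφ hD hD0
    mem_fibBar := mem_formRoots_pencil hcop hg₀ hψ hd hd0
    card_fibBar := fun c => card_formRoots (hpdeg c)
    map_red_fib := fun y => (key y).2
    size_mul := fun P y => by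
      have h1 := norm_ev_pencil D _ _ P y (ev_ne_zero_or hFG hD P)
      rw [norm_ev_eq (natDegree_pencil_le hFD hGD y), (key y).1,
        ← ratMap_eq hFG hG0 hφ hD] at h1
      have hy := weight_pos y
      have hP := weight_pos P
      rw [div_mul_eq_mul_div, div_eq_iff (by positivity)]
      apply mul_left_cancel₀ hy.ne'
      linear_combination -h1 }⟩

end Fibres

/-! ### Good residue classes -/

section Good

variable {L : Type*} [NormedField L] [IsUltrametricDist L]

lemma mem_residueClass {a : P1 (ResField L)} {P : P1 L} : P ∈ residueClass a ↔ red P = a := Iff.rfl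

lemma residueClass_nonempty (a : P1 (ResField L)) : (residueClass a).Nonempty :=
  red_surjective a

lemma residueClass_injective : Function.Injective (residueClass (C := L)) := by
  intro a b h
  obtain ⟨P, rfl⟩ := red_surjective (C := L) a
  exact (h ▸ mem_residueClass.mpr rfl : P ∈ residueClass b)

lemma exists_red_ne (a : P1 (ResField L)) : ∃ y : P1 L, red y ≠ a := by
  by_cases h : a = OnePoint.infty
  · exact ⟨((0 : L) : P1 L), by rw [red_of_le (by simp), h]; exact OnePoint.coe_ne_infty _⟩
  · exact ⟨OnePoint.infty, by rw [red_infty]; exact fun h' => h h'.symm⟩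

section Products

variable {α β : Type*} [DecidableEq β]

lemma prod_map_nonneg_le_one {f : α → ℝ} (h0 : ∀ x, 0 ≤ f x) (h1 : ∀ x, f x ≤ 1)
    (m : Multiset α) : 0 ≤ (m.map f).prod ∧ (m.map f).prod ≤ 1 := by
  induction m using Multiset.induction with
  | empty => simp
  | cons x m ih =>
    rw [Multiset.map_cons, Multiset.prod_cons]
    exact ⟨mul_nonneg (h0 x) ih.1, mul_le_one₀ (h1 x) ih.1 ih.2⟩

lemma prod_map_le_pow_count {f : α → ℝ} (h0 : ∀ x, 0 ≤ f x) (h1 : ∀ x, f x ≤ 1) (r : α → β)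
    (c : β) {t : ℝ} (m : Multiset α) (ht : ∀ x ∈ m, r x = c → f x ≤ t) :
    (m.map f).prod ≤ t ^ (m.map r).count c := by
  induction m using Multiset.induction with
  | empty => simp
  | cons x m ih =>
    have ih := ih fun y hy => ht y (Multiset.mem_cons_of_mem hy)
    have hm := prod_map_nonneg_le_one h0 h1 m
    simp only [Multiset.map_cons, Multiset.prod_cons, Multiset.count_cons]
    by_cases h : r x = c
    · rw [if_pos h.symm, pow_succ, mul_comm]
      have hx := ht x (Multiset.mem_cons_self x m) h
      exact mul_le_mul ih hx (h0 x) (hm.1.trans ih)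
    · rw [if_neg (Ne.symm h), add_zero]
      exact (mul_le_of_le_one_left hm.1 (h1 x)).trans ih

lemma pow_count_le_prod_map {f : α → ℝ} (r : α → β) (c : β) {t : ℝ} (ht0 : 0 ≤ t)
    (m : Multiset α) (ht : ∀ x ∈ m, r x = c → t ≤ f x) (h1 : ∀ x ∈ m, r x ≠ c → f x = 1) :
    t ^ (m.map r).count c ≤ (m.map f).prod := by
  induction m using Multiset.induction with
  | empty => simp
  | cons x m ih =>
    have ih := ih (fun y hy => ht y (Multiset.mem_cons_of_mem hy))
      (fun y hy => h1 y (Multiset.mem_cons_of_mem hy))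
    simp only [Multiset.map_cons, Multiset.prod_cons, Multiset.count_cons]
    by_cases h : r x = c
    · rw [if_pos h.symm, pow_succ, mul_comm]
      have hx := ht x (Multiset.mem_cons_self x m) h
      exact mul_le_mul hx ih (pow_nonneg ht0 _) (ht0.trans hx)
    · rw [if_neg (Ne.symm h), add_zero, h1 x (Multiset.mem_cons_self x m) h, one_mul]
      exact ih

end Products

namespace ReducedFibres

variable {φ : RatFunc L} {ψ : RatFunc (ResField L)} (R : ReducedFibres φ ψ)
include R

lemma red_mem (P : P1 L) : red P ∈ R.bad ∨ ratMap ψ (red P) = red (ratMap φ P) := by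
  have h : red P ∈ (R.fib (ratMap φ P)).map red :=
    Multiset.mem_map_of_mem _ ((R.mem_fib P _).mpr rfl)
  rw [R.map_red_fib, Multiset.mem_add, R.mem_fibBar] at h
  exact h

lemma red_ratMap {P : P1 L} (hP : red P ∉ R.bad) : red (ratMap φ P) = ratMap ψ (red P) :=
  ((R.red_mem P).resolve_left hP).symm

lemma exists_preimage {y : P1 L} {c : P1 (ResField L)} (hc : ratMap ψ c = red y) :
    ∃ Q, ratMap φ Q = y ∧ red Q = c := by
  have h : c ∈ (R.fib y).map red := by
    rw [R.map_red_fib, Multiset.mem_add, R.mem_fibBar]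
    exact Or.inr hc
  obtain ⟨Q, hQ, rfl⟩ := Multiset.mem_map.mp h
  exact ⟨Q, (R.mem_fib Q y).mp hQ, rfl⟩

lemma image_residueClass {c : P1 (ResField L)} (hc : c ∉ R.bad) :
    ratMap φ '' residueClass c = residueClass (ratMap ψ c) := by
  ext y
  constructor
  · rintro ⟨P, rfl, rfl⟩
    exact R.red_ratMap hc
  · intro hy
    obtain ⟨Q, hQ, hQc⟩ := R.exists_preimage (y := y) (c := c) hy.symm
    exact ⟨Q, hQc, hQ⟩

lemma iterate_image_residueClass {c : P1 (ResField L)}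
    (hc : ∀ n : ℕ, (ratMap ψ)^[n] c ∉ R.bad) (n : ℕ) :
    (ratMap φ)^[n] '' residueClass c = residueClass ((ratMap ψ)^[n] c) := by
  induction n with
  | zero => simp
  | succ n ih =>
    rw [Function.iterate_succ', Function.iterate_succ', Set.image_comp, ih,
      R.image_residueClass (hc n)]
    rfl

lemma size_eq_one {P : P1 L} (hP : red P ∉ R.bad) : R.size P = 1 := by
  obtain ⟨y, hy⟩ := exists_red_ne (L := L) (ratMap ψ (red P))
  have h1 := R.size_mul P y
  have h2 : chordalDist (ratMap φ P) y = 1 :=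
    chordalDist_eq_one (by rw [R.red_ratMap hP]; exact hy.symm)
  rw [h2, mul_one] at h1
  rw [h1]
  refine Multiset.prod_eq_one fun z hz => ?_
  obtain ⟨Q, hQ, rfl⟩ := Multiset.mem_map.mp hz
  refine chordalDist_eq_one fun hPQ => ?_
  have h : red Q ∈ (R.fib y).map red := Multiset.mem_map_of_mem _ hQ
  rw [R.map_red_fib, Multiset.mem_add, R.mem_fibBar, ← hPQ] at h
  exact h.elim hP fun h => hy h.symm

/-- A rational function does not increase distances on a good residue class. -/
lemma chordalDist_ratMap_le {P Q : P1 L} (hP : red P ∉ R.bad) :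
    chordalDist (ratMap φ P) (ratMap φ Q) ≤ chordalDist P Q := by
  have h := R.size_mul P (ratMap φ Q)
  rw [R.size_eq_one hP, one_mul] at h
  obtain ⟨m, hm⟩ := Multiset.exists_cons_of_mem ((R.mem_fib Q _).mpr rfl)
  rw [h, hm, Multiset.map_cons, Multiset.prod_cons]
  exact mul_le_of_le_one_right (chordalDist_nonneg _ _)
    (prod_map_nonneg_le_one (chordalDist_nonneg P) (chordalDist_le_one P) m).2

lemma red_iterate {P : P1 L} (hP : ∀ n : ℕ, (ratMap ψ)^[n] (red P) ∉ R.bad) (n : ℕ) :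
    red ((ratMap φ)^[n] P) = (ratMap ψ)^[n] (red P) := by
  induction n with
  | zero => rfl
  | succ n ih =>
    rw [Function.iterate_succ_apply', Function.iterate_succ_apply', R.red_ratMap (ih ▸ hP n), ih]

lemma chordalDist_iterate_le {P Q : P1 L} (hP : ∀ n : ℕ, (ratMap ψ)^[n] (red P) ∉ R.bad)
    (n : ℕ) : chordalDist ((ratMap φ)^[n] P) ((ratMap φ)^[n] Q) ≤ chordalDist P Q := by
  induction n with
  | zero => exact le_rfl
  | succ n ih =>
    rw [Function.iterate_succ_apply', Function.iterate_succ_apply']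
    exact (R.chordalDist_ratMap_le (by rw [R.red_iterate hP]; exact hP n)).trans ih

lemma residueClass_subset_fatou {c : P1 (ResField L)}
    (hc : ∀ n : ℕ, (ratMap ψ)^[n] c ∉ R.bad) : residueClass c ⊆ fatou φ := by
  intro x hx
  refine ⟨1, one_pos, fun y hy ε hε => ⟨ε, hε, fun n z hz => ?_⟩⟩
  have hyc : red y = c := by
    rw [← (chordalDist_lt_one_iff x y).mp hy]
    exact hx
  exact (R.chordalDist_iterate_le (by rwa [hyc]) n).trans_lt hz

end ReducedFibres

end Good

/-! ### Backward invariant sets -/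

section Backward

variable {L : Type*} [NormedField L] [IsUltrametricDist L]

omit [IsUltrametricDist L] in
lemma norm_det_eq (a b a' b' : L) (h : a ≠ 0 ∨ b ≠ 0) :
    ‖a * b' - a' * b‖ =
      max ‖a‖ ‖b‖ * max ‖a'‖ ‖b'‖ * chordalDist (ofCoords a b) (ofCoords a' b') := by
  by_cases hb' : b' = 0
  · subst hb'
    rw [mul_zero, zero_sub, norm_neg, norm_mul, ofCoords_zero, norm_zero,
      max_eq_left (norm_nonneg _)]
    linear_combination ‖a'‖ * norm_eq_mul_chordalDist_infty a b
  · rw [ofCoords_of_ne_zero _ hb']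
    have h1 := norm_sub_mul_eq a b (a' / b') h
    have h2 : ‖a * b' - a' * b‖ = ‖a - a' / b' * b‖ * ‖b'‖ := by
      rw [← norm_mul]; congr 1; field_simp
    have h0 : 0 < ‖b'‖ := norm_pos_iff.mpr hb'
    have h3 : max ‖a' / b'‖ 1 * ‖b'‖ = max ‖a'‖ ‖b'‖ := by
      rw [max_mul_of_nonneg _ _ h0.le, norm_div, div_mul_cancel₀ _ h0.ne', one_mul]
    rw [h2, h1, ← h3]
    ring

omit [IsUltrametricDist L] in
lemma ofCoords_coords (P : P1 L) : ofCoords (coords P).1 (coords P).2 = P := by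
  induction P using OnePoint.rec with
  | infty => simp [coords_infty]
  | coe x =>
    rcases le_or_gt ‖x‖ 1 with h | h
    · simp [coords_of_le h, ofCoords]
    · have : x ≠ 0 := fun h0 => by
        rw [h0, norm_zero] at h; linarith
      simp [coords_of_lt h, ofCoords, this]

/-- On the circle of radius `‖s‖` about `q` there are points at distance at least `‖s‖` from any
given finite set: the circle contains infinitely many points with mutual distances `‖s‖`. -/
lemma exists_generic_point [Infinite (ResField L)] (q : P1 L) {s : L} (hs0 : 0 < ‖s‖)
    (hs1 : ‖s‖ ≤ 1) {Z : Set (P1 L)} (hZ : Z.Finite) :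
    ∃ P, chordalDist q P ≤ ‖s‖ ∧ ∀ Q ∈ Z, ‖s‖ ≤ chordalDist P Q := by
  -- points near `q` with mutual distances prescribed by a parameter in the ring of integers
  obtain ⟨pt, hpt⟩ : ∃ pt : IntRing L → P1 L, pt 0 = q ∧
      ∀ u v : IntRing L, chordalDist (pt u) (pt v) = ‖s‖ * ‖((u - v : IntRing L) : L)‖ := by
    have hle : ∀ x : L, ‖x‖ ≤ 1 → ∀ u : IntRing L, ‖x + s * u‖ ≤ 1 := by
      intro x hx u
      refine (IsUltrametricDist.norm_add_le_max _ _).trans (max_le hx ?_)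
      rw [norm_mul]
      exact mul_le_one₀ hs1 (norm_nonneg _) (mem_intRing.mp u.2)
    have hn := norm_coords_le q
    have hq := ofCoords_coords q
    rcases coords_eq_one q with h | h
    · refine ⟨fun u => ofCoords 1 ((coords q).2 + s * u), by simp [← h, hq], fun u v => ?_⟩
      have hd := norm_det_eq 1 ((coords q).2 + s * u) 1 ((coords q).2 + s * v) (by simp)
      rw [norm_one, max_eq_left (hle _ hn.2 u), max_eq_left (hle _ hn.2 v), ← norm_neg] at hd
      simp only [one_mul, mul_one] at hd ⊢
      rw [← hd, ← norm_mul]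
      congr 1
      push_cast
      ring
    · refine ⟨fun u => ofCoords ((coords q).1 + s * u) 1, by simp [← h, hq], fun u v => ?_⟩
      have hd := norm_det_eq ((coords q).1 + s * u) 1 ((coords q).1 + s * v) 1 (by simp)
      rw [norm_one, max_eq_right (hle _ hn.1 u), max_eq_right (hle _ hn.1 v)] at hd
      simp only [one_mul, mul_one] at hd ⊢
      rw [← hd, ← norm_mul]
      congr 1
      push_cast
      ring
  obtain ⟨hpt0, hpt⟩ := hpt
  by_contra! hcon
  choose lift hlift using IsLocalRing.residue_surjective (R := IntRing L)
  have hnear : ∀ u, chordalDist q (pt u) ≤ ‖s‖ := fun u => by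
    rw [← hpt0, hpt]
    exact mul_le_of_le_one_right hs0.le (mem_intRing.mp (0 - u).2)
  choose f hfZ hf using fun a => hcon (pt (lift a)) (hnear _)
  have := hZ.to_subtype
  obtain ⟨a, b, hab, hfab⟩ :=
    Finite.exists_ne_map_eq_of_infinite (fun a => (⟨f a, hfZ a⟩ : Z))
  have hfab : f a = f b := congrArg Subtype.val hfab
  have h1 : chordalDist (pt (lift a)) (pt (lift b)) < ‖s‖ := by
    refine (chordalDist_le_max _ (f a) _).trans_lt (max_lt (hf a) ?_)
    rw [hfab, chordalDist_comm]
    exact hf b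
  have h2 : ‖((lift a - lift b : IntRing L) : L)‖ = 1 := by
    refine le_antisymm (mem_intRing.mp (lift a - lift b).2) (not_lt.mp fun hlt => hab ?_)
    rw [← residue_eq_zero_iff, map_sub, hlift, hlift, sub_eq_zero] at hlt
    exact hlt
  rw [hpt, h2, mul_one] at h1
  exact lt_irrefl _ h1

namespace ReducedFibres

variable {φ : RatFunc L} {ψ : RatFunc (ResField L)} (R : ReducedFibres φ ψ)
include R

/-- If a backward invariant set reduces to a finite set, then every class it meets has only one
preimage class. -/
lemma preimage_unique (hdeg : 2 ≤ ratDegree ψ) {E : Set (P1 L)}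
    (hE : ∀ P, ratMap φ P ∈ E → P ∈ E) (hfin : (red '' E).Finite) {c c' : P1 (ResField L)}
    (hc : ratMap ψ c ∈ red '' E) (hcc' : ratMap ψ c = ratMap ψ c') : c = c' := by
  have hback : ∀ c, ratMap ψ c ∈ red '' E → c ∈ red '' E := by
    rintro c ⟨y, hy, hyc⟩
    obtain ⟨Q, hQ, rfl⟩ := R.exists_preimage hyc.symm
    exact ⟨Q, hE Q (hQ ▸ hy), rfl⟩
  have hsurj : ∀ a, ∃ c, ratMap ψ c = a := fun a => by
    have : R.fibBar a ≠ 0 := fun h0 => by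
      have := R.card_fibBar a
      rw [h0, Multiset.card_zero] at this
      omega
    obtain ⟨c, hc⟩ := Multiset.exists_mem_of_ne_zero this
    exact ⟨c, (R.mem_fibBar c a).mp hc⟩
  choose σ hσ using hsurj
  have := hfin.to_subtype
  let τ : red '' E → red '' E := fun a => ⟨σ a, hback _ (by rw [hσ]; exact a.2)⟩
  have hτ : Function.Injective τ := fun a b h => by
    have h : σ a = σ b := congrArg Subtype.val h
    exact Subtype.ext (by rw [← hσ a, h, hσ])
  have hτs : ∀ c, ratMap ψ c ∈ red '' E → σ (ratMap ψ c) = c := fun c hc => by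
    obtain ⟨a, ha⟩ := Finite.surjective_of_injective hτ ⟨c, hback c hc⟩
    have ha : σ a = c := congrArg Subtype.val ha
    rw [← ha, hσ]
  rw [← hτs c hc, hcc', hτs c' (hcc' ▸ hc)]

/-- For a backward invariant set `E` reducing to a finite set, a bound `‖s‖` for the distances
between points of `E` in the same residue class improves to `‖s‖ ^ deg ψ`.  Indeed, let `c` be the
only class mapping to the class of `y₁` and `y₂`.  At a generic point `P` at distance `‖s‖` from
`E ∩ W_c` the function `φ` is as close to `y₁` and `y₂` as the numbers of preimages of these points
in `W_c` prescribe; the size of the pair of numerator and denominator at `P` is determined by the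
number of preimages in `W_c` of a point `y₃` of another class. -/
lemma chordalDist_le_pow [Infinite (ResField L)] (hdeg : 2 ≤ ratDegree ψ) {E : Set (P1 L)}
    (hE : ∀ P, ratMap φ P ∈ E → P ∈ E) (hfin : (red '' E).Finite) {s : L} (hs0 : 0 < ‖s‖)
    (hs1 : ‖s‖ < 1) (hs : ∀ P ∈ E, ∀ Q ∈ E, red P = red Q → chordalDist P Q ≤ ‖s‖)
    {y₁ y₂ : P1 L} (hy₁ : y₁ ∈ E) (hy₂ : y₂ ∈ E) (hy : red y₁ = red y₂) :
    chordalDist y₁ y₂ ≤ ‖s‖ ^ ratDegree ψ := by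
  classical
  set d := ratDegree ψ with hd
  obtain ⟨c, hc⟩ : ∃ c, ratMap ψ c = red y₁ := by
    have : R.fibBar (red y₁) ≠ 0 := fun h0 => by
      have := R.card_fibBar (red y₁)
      rw [h0, Multiset.card_zero] at this
      omega
    obtain ⟨c, hc⟩ := Multiset.exists_mem_of_ne_zero this
    exact ⟨c, (R.mem_fibBar c _).mp hc⟩
  have hfibBar : R.fibBar (red y₁) = Multiset.replicate d c := by
    rw [Multiset.eq_replicate]
    refine ⟨R.card_fibBar _, fun c' hc' => ?_⟩
    rw [R.mem_fibBar] at hc'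
    exact (R.preimage_unique hdeg hE hfin ⟨y₁, hy₁, hc.symm⟩ (hc.trans hc'.symm)).symm
  have hcount : ∀ y, red y = red y₁ →
      ((R.fib y).map red).count c = R.bad.count c + d := fun y hy => by
    rw [R.map_red_fib, hy, hfibBar, Multiset.count_add, Multiset.count_replicate_self]
  obtain ⟨y₃, hy₃⟩ := exists_red_ne (red y₁)
  have hcount₃ : ((R.fib y₃).map red).count c = R.bad.count c := by
    have h0 : c ∉ R.fibBar (red y₃) := by
      rw [R.mem_fibBar, hc]
      exact hy₃.symm
    rw [R.map_red_fib, Multiset.count_add, Multiset.count_eq_zero_of_notMem h0, add_zero]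
  obtain ⟨q, hqy, hqc⟩ := R.exists_preimage (y := y₁) hc
  have hqE : q ∈ E := hE q (hqy ▸ hy₁)
  obtain ⟨P, hPq, hP⟩ := exists_generic_point q hs0 hs1.le
    (Z := {Q | Q ∈ R.fib y₃}) (Multiset.finite_toSet _)
  have hPc : red P = c := by
    rw [← hqc, eq_comm, ← chordalDist_lt_one_iff]
    exact hPq.trans_lt hs1
  have hsize : ‖s‖ ^ R.bad.count c ≤ R.size P := by
    have h1 := R.size_mul P y₃
    have h2 : chordalDist (ratMap φ P) y₃ ≤ 1 := chordalDist_le_one _ _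
    have h3 : ‖s‖ ^ R.bad.count c ≤ R.size P * chordalDist (ratMap φ P) y₃ := by
      rw [h1, ← hcount₃]
      refine pow_count_le_prod_map red c hs0.le _ (fun Q hQ _ => hP Q hQ) fun Q _ hQc => ?_
      exact chordalDist_eq_one (by rw [hPc]; exact hQc.symm)
    have h4 : 0 < ‖s‖ ^ R.bad.count c := pow_pos hs0 _
    have h5 := chordalDist_nonneg (ratMap φ P) y₃
    rcases le_total 0 (R.size P) with h | h
    · exact h3.trans (mul_le_of_le_one_right h h2)
    · exact absurd (h3.trans (mul_nonpos_of_nonpos_of_nonneg h h5)) h4.not_ge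
  have hpow : 0 < ‖s‖ ^ R.bad.count c := pow_pos hs0 _
  have hle : ∀ y ∈ E, red y = red y₁ → chordalDist (ratMap φ P) y ≤ ‖s‖ ^ d := by
    intro y hyE hy
    have h1 := R.size_mul P y
    have h2 : ((R.fib y).map (chordalDist P)).prod ≤ ‖s‖ ^ (R.bad.count c + d) := by
      rw [← hcount y hy]
      refine prod_map_le_pow_count (chordalDist_nonneg P) (chordalDist_le_one P) red c _
        fun Q hQ hQc => ?_
      have hQE : Q ∈ E := hE Q (by rw [(R.mem_fib Q y).mp hQ]; exact hyE)
      refine (chordalDist_le_max P q Q).trans (max_le ?_ (hs q hqE Q hQE (by rw [hqc, hQc])))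
      rw [chordalDist_comm]
      exact hPq
    rw [← h1, pow_add] at h2
    have h3 := chordalDist_nonneg (ratMap φ P) y
    have h4 : ‖s‖ ^ R.bad.count c * chordalDist (ratMap φ P) y ≤
        ‖s‖ ^ R.bad.count c * ‖s‖ ^ d := (mul_le_mul_of_nonneg_right hsize h3).trans h2
    exact le_of_mul_le_mul_left h4 hpow
  refine (chordalDist_le_max y₁ (ratMap φ P) y₂).trans (max_le ?_ (hle y₂ hy₂ hy.symm))
  rw [chordalDist_comm]
  exact hle y₁ hy₁ rfl

/-- A backward invariant set that is contained in finitely many disks, each of radius less than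
`1` in its residue class, is finite: it has at most one point in each class. -/
lemma finite_of_backward_invariant [Infinite (ResField L)] (hdeg : 2 ≤ ratDegree ψ)
    {E : Set (P1 L)} (hE : ∀ P, ratMap φ P ∈ E → P ∈ E) (hfin : (red '' E).Finite) {s : L}
    (hs0 : 0 < ‖s‖) (hs1 : ‖s‖ < 1)
    (hs : ∀ P ∈ E, ∀ Q ∈ E, red P = red Q → chordalDist P Q ≤ ‖s‖) : E.Finite := by
  have hiter : ∀ n : ℕ, ∀ P ∈ E, ∀ Q ∈ E, red P = red Q →
      chordalDist P Q ≤ ‖s ^ (ratDegree ψ) ^ n‖ := by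
    intro n
    induction n with
    | zero => simpa using hs
    | succ n ih =>
      intro P hP Q hQ hPQ
      have hpos : 0 < ratDegree ψ ^ n := pow_pos (by omega) n
      rw [pow_succ, pow_mul, norm_pow]
      refine R.chordalDist_le_pow hdeg hE hfin ?_ ?_ ih hP hQ hPQ
      · rw [norm_pow]; exact pow_pos hs0 _
      · rw [norm_pow]; exact pow_lt_one₀ hs0.le hs1 hpos.ne'
  refine Set.Finite.of_finite_image hfin fun P hP Q hQ hPQ => ?_
  refine eq_of_chordalDist_eq_zero (le_antisymm (le_of_forall_pos_lt_add fun ε hε => ?_)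
    (chordalDist_nonneg P Q))
  obtain ⟨n, hn⟩ := exists_pow_lt_of_lt_one hε hs1
  rw [zero_add]
  refine (hiter n P hP Q hQ hPQ).trans_lt (lt_of_le_of_lt ?_ hn)
  rw [norm_pow]
  exact pow_le_pow_of_le_one hs0.le hs1.le (Nat.lt_pow_self (by omega)).le

end ReducedFibres

end Backward

/-! ### Disks, affinoids and residue classes -/

section Disks

variable {L : Type*} [NormedField L] [IsUltrametricDist L]

lemma red_eq_infty_iff {x : L} : red (x : P1 L) = OnePoint.infty ↔ 1 < ‖x‖ := by
  refine ⟨fun h => ?_, red_of_lt⟩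
  by_contra hx
  rw [red_of_le (not_lt.mp hx)] at h
  exact OnePoint.coe_ne_infty _ h

lemma norm_eq_of_norm_sub_lt {x a : L} (h : ‖x - a‖ < ‖a‖) : ‖x‖ = ‖a‖ := by
  have := IsUltrametricDist.norm_add_eq_max_of_norm_ne_norm h.ne
  rw [sub_add_cancel, max_eq_right h.le] at this
  exact this

/-- A disk in the affine line, or its complement, lies in a single residue class.  The hypothesis
says that `B` contains every point of the closed disk spanned by two of its points. -/
lemma ball_dichotomy (B : Set L)
    (hB : ∀ x ∈ B, ∀ y ∈ B, ∀ z, ‖z - x‖ ≤ ‖x - y‖ → z ∈ B) :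
    ∃ a : P1 (ResField L), (fun x : L => (x : P1 L)) '' B ⊆ residueClass a ∨
      ((fun x : L => (x : P1 L)) '' B)ᶜ ⊆ residueClass a := by
  by_cases h : ∀ x ∈ B, ∀ y ∈ B, chordalDist (x : P1 L) (y : P1 L) < 1
  · rcases B.eq_empty_or_nonempty with rfl | ⟨x₀, hx₀⟩
    · exact ⟨OnePoint.infty, Or.inl (by simp)⟩
    · refine ⟨red (x₀ : P1 L), Or.inl ?_⟩
      rintro _ ⟨x, hx, rfl⟩
      exact (chordalDist_lt_one_iff _ _).mp (h x hx x₀ hx₀)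
  · push Not at h
    obtain ⟨x, hx, y, hy, hxy⟩ := h
    have h1 : max ‖x‖ 1 * max ‖y‖ 1 ≤ ‖x - y‖ := by
      have : 1 ≤ ‖x - y‖ / (max ‖x‖ 1 * max ‖y‖ 1) := hxy
      rwa [one_le_div (by positivity)] at this
    have h2 : 1 ≤ ‖x - y‖ := le_trans (by
      have ha := le_max_right ‖x‖ 1
      have hb := le_max_right ‖y‖ 1
      nlinarith) h1
    -- one of the two points is integral, so that `B` contains the closed unit disk
    have key : ∃ w ∈ B, ∃ w' ∈ B, ‖w‖ ≤ 1 ∧ 1 ≤ ‖w - w'‖ := by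
      by_cases hx1 : ‖x‖ ≤ 1
      · exact ⟨x, hx, y, hy, hx1, h2⟩
      by_cases hy1 : ‖y‖ ≤ 1
      · exact ⟨y, hy, x, hx, hy1, by rwa [norm_sub_rev]⟩
      exfalso
      push Not at hx1 hy1
      rw [max_eq_left hx1.le, max_eq_left hy1.le] at h1
      have h3 := h1.trans (norm_sub_le_max' x y)
      rcases le_max_iff.mp h3 with h | h <;> nlinarith
    obtain ⟨w, hw, w', hw', hw1, hww⟩ := key
    refine ⟨OnePoint.infty, Or.inr fun P hP => ?_⟩
    induction P using OnePoint.rec with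
    | infty => rfl
    | coe z =>
      refine red_eq_infty_iff.mpr ?_
      by_contra hz
      refine hP ⟨z, hB w hw w' hw' z ?_, rfl⟩
      exact (norm_sub_le_max' z w).trans ((max_le (not_lt.mp hz) hw1).trans hww)

lemma ball_spanned (a : L) (r : ℝ) : ∀ x ∈ Metric.ball a r, ∀ y ∈ Metric.ball a r,
    ∀ z, ‖z - x‖ ≤ ‖x - y‖ → z ∈ Metric.ball a r := by
  intro x hx y hy z hz
  rw [mem_ball_iff_norm] at *
  have h1 : ‖x - y‖ < r := by
    rw [← sub_sub_sub_cancel_right x y a]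
    exact (norm_sub_le_max' _ _).trans_lt (max_lt hx hy)
  rw [← sub_add_sub_cancel z x a]
  exact (IsUltrametricDist.norm_add_le_max _ _).trans_lt (max_lt (hz.trans_lt h1) hx)

lemma closedBall_spanned (a : L) (r : ℝ) : ∀ x ∈ Metric.closedBall a r,
    ∀ y ∈ Metric.closedBall a r, ∀ z, ‖z - x‖ ≤ ‖x - y‖ → z ∈ Metric.closedBall a r := by
  intro x hx y hy z hz
  rw [mem_closedBall_iff_norm] at *
  have h1 : ‖x - y‖ ≤ r := by
    rw [← sub_sub_sub_cancel_right x y a]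
    exact (norm_sub_le_max' _ _).trans (max_le hx hy)
  rw [← sub_add_sub_cancel z x a]
  exact (IsUltrametricDist.norm_add_le_max _ _).trans (max_le (hz.trans h1) hx)

lemma IsDisk.dichotomy {U : Set (P1 L)} (hU : IsDisk U) :
    ∃ a : P1 (ResField L), U ⊆ residueClass a ∨ Uᶜ ⊆ residueClass a := by
  obtain ⟨a, r, -, h⟩ := hU
  have h1 := ball_dichotomy _ (ball_spanned a r)
  have h2 := ball_dichotomy _ (closedBall_spanned a r)
  rcases h with h | h | h | h
  · rw [h]; exact h1
  · rw [h]; exact h2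
  · rw [h, ← compl_compl U, h]; exact h1.imp fun _ => Or.symm
  · rw [h, ← compl_compl U, h]; exact h2.imp fun _ => Or.symm

omit [IsUltrametricDist L] in
lemma IsRationalClosedDisk.isDisk {U : Set (P1 L)} (hU : IsRationalClosedDisk U) : IsDisk U := by
  obtain ⟨a, c, hc, h | h⟩ := hU
  · exact ⟨a, ‖c‖, norm_pos_iff.mpr hc, Or.inr (Or.inl h)⟩
  · exact ⟨a, ‖c‖, norm_pos_iff.mpr hc, Or.inr (Or.inr (Or.inl h))⟩

omit [IsUltrametricDist L] in
lemma IsDisk.compl {U : Set (P1 L)} (hU : IsDisk U) : IsDisk Uᶜ := by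
  obtain ⟨a, r, hr, h⟩ := hU
  refine ⟨a, r, hr, ?_⟩
  rw [compl_compl]
  tauto

omit [IsUltrametricDist L] in
lemma IsRationalOpenDisk.compl {U : Set (P1 L)} (hU : IsRationalOpenDisk U) :
    IsRationalClosedDisk Uᶜ := by
  obtain ⟨a, c, hc, h⟩ := hU
  refine ⟨a, c, hc, ?_⟩
  rw [compl_compl]
  tauto

omit [IsUltrametricDist L] in
lemma IsDisk.isConnectedAffinoid {U : Set (P1 L)} (hU : IsDisk U) : IsConnectedAffinoid U :=
  ⟨{Uᶜ}, Set.finite_singleton _, Set.pairwiseDisjoint_singleton _ _,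
    by rintro _ rfl; exact hU.compl, by rw [Set.sUnion_singleton, compl_compl]⟩

omit [IsUltrametricDist L] in
lemma IsRationalOpenDisk.isRationalOpenConnectedAffinoid {U : Set (P1 L)}
    (hU : IsRationalOpenDisk U) : IsRationalOpenConnectedAffinoid U :=
  ⟨{Uᶜ}, Set.finite_singleton _, Set.pairwiseDisjoint_singleton _ _,
    by rintro _ rfl; exact hU.compl, by rw [Set.sUnion_singleton, compl_compl]⟩

lemma isRationalOpenDisk_residueClass (a : P1 (ResField L)) :
    IsRationalOpenDisk (residueClass a : Set (P1 L)) := by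
  induction a using OnePoint.rec with
  | infty =>
    refine ⟨0, 1, one_ne_zero, Or.inr ?_⟩
    ext P
    induction P using OnePoint.rec with
    | infty => simp [mem_residueClass, red_infty, closedDisk]
    | coe x => simp [mem_residueClass, red_eq_infty_iff, closedDisk]
  | coe a =>
    obtain ⟨x, rfl⟩ := IsLocalRing.residue_surjective a
    have hx := mem_intRing.mp x.2
    refine ⟨x, 1, one_ne_zero, Or.inl ?_⟩
    ext P
    induction P using OnePoint.rec with
    | infty => simp [mem_residueClass, red_infty, openDisk]
    | coe y =>
      have hy1 : ‖y - (x : L)‖ < 1 → ‖y‖ ≤ 1 := fun h => by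
        have := IsUltrametricDist.norm_add_le_max (y - (x : L)) (x : L)
        rw [sub_add_cancel] at this
        exact this.trans (max_le h.le hx)
      have hmem : (y : P1 L) ∈ openDisk (x : L) ‖(1 : L)‖ ↔ ‖y - (x : L)‖ < 1 := by
        simp [openDisk, dist_eq_norm]
      have hred : red ((x : L) : P1 L) =
          ((IsLocalRing.residue (IntRing L) x : ResField L) : P1 (ResField L)) := red_of_le hx
      rw [hmem, mem_residueClass, ← hred]
      constructor
      · intro h
        have hy : ‖y‖ ≤ 1 := by
          by_contra hy
          rw [red_of_lt (not_le.mp hy), hred] at h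
          exact OnePoint.coe_ne_infty _ h.symm
        have h1 : ‖y - (x : L)‖ / (max ‖y‖ 1 * max ‖(x : L)‖ 1) < 1 :=
          (chordalDist_lt_one_iff (y : P1 L) ((x : L) : P1 L)).mpr h
        rwa [max_eq_right hy, max_eq_right hx, one_mul, div_one] at h1
      · intro h
        rw [← chordalDist_lt_one_iff]
        change ‖y - (x : L)‖ / (max ‖y‖ 1 * max ‖(x : L)‖ 1) < 1
        rwa [max_eq_right (hy1 h), max_eq_right hx, one_mul, div_one]

lemma isDisk_residueClass (a : P1 (ResField L)) : IsDisk (residueClass a : Set (P1 L)) := by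
  have := (isRationalOpenDisk_residueClass (L := L) a).compl.isDisk.compl
  rwa [compl_compl] at this

/-- A rational closed disk in a residue class has radius less than `1` there. -/
lemma IsRationalClosedDisk.exists_bound {U : Set (P1 L)} (hU : IsRationalClosedDisk U)
    {a : P1 (ResField L)} (ha : U ⊆ residueClass a) :
    ∃ e : L, 0 < ‖e‖ ∧ ‖e‖ < 1 ∧ ∀ P ∈ U, ∀ Q ∈ U, chordalDist P Q ≤ ‖e‖ := by
  obtain ⟨x₀, c, hc, rfl | h⟩ := hU
  · have hc0 : 0 < ‖c‖ := norm_pos_iff.mpr hc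
    have hmem : ∀ x : L, ‖x - x₀‖ ≤ ‖c‖ → red (x : P1 L) = a := fun x hx =>
      ha ⟨x, by rwa [mem_closedBall_iff_norm], rfl⟩
    have h0 : red (x₀ : P1 L) = a := hmem x₀ (by simp)
    have h0c : red ((x₀ + c : L) : P1 L) = a := hmem (x₀ + c) (by simp)
    rcases le_or_gt ‖x₀‖ 1 with hx₀ | hx₀
    · have hint : ∀ x : L, ‖x - x₀‖ ≤ ‖c‖ → ‖x‖ ≤ 1 := fun x hx => by
        by_contra h1
        rw [red_of_le hx₀, ← hmem x hx, red_of_lt (not_le.mp h1)] at h0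
        exact OnePoint.coe_ne_infty _ h0
      refine ⟨c, hc0, ?_, ?_⟩
      · have h1 : ‖x₀ - (x₀ + c)‖ / (max ‖x₀‖ 1 * max ‖x₀ + c‖ 1) < 1 :=
          (chordalDist_lt_one_iff _ _).mpr (h0.trans h0c.symm)
        rwa [max_eq_right hx₀, max_eq_right (hint _ (by simp)), one_mul, div_one,
          sub_add_cancel_left, norm_neg] at h1
      · rintro _ ⟨x, hx, rfl⟩ _ ⟨y, hy, rfl⟩
        rw [mem_closedBall_iff_norm] at hx hy
        change ‖x - y‖ / (max ‖x‖ 1 * max ‖y‖ 1) ≤ _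
        rw [max_eq_right (hint x hx), max_eq_right (hint y hy), one_mul, div_one,
          ← sub_sub_sub_cancel_right x y x₀]
        exact (norm_sub_le_max' _ _).trans (max_le hx hy)
    · have hx₀0 : x₀ ≠ 0 := fun h => by
        rw [h, norm_zero] at hx₀; linarith
      have hcx : ‖c‖ < ‖x₀‖ := by
        by_contra h1
        have h2 := hmem 0 (by rw [zero_sub, norm_neg]; exact not_lt.mp h1)
        rw [← h0, red_of_lt hx₀, red_of_le (by simp)] at h2
        exact OnePoint.coe_ne_infty _ h2
      refine ⟨c / (x₀ * x₀), norm_pos_iff.mpr (by positivity), ?_, ?_⟩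
      · rw [norm_div, norm_mul, div_lt_one (by positivity)]
        nlinarith
      · rintro _ ⟨x, hx, rfl⟩ _ ⟨y, hy, rfl⟩
        rw [mem_closedBall_iff_norm] at hx hy
        change ‖x - y‖ / (max ‖x‖ 1 * max ‖y‖ 1) ≤ _
        rw [norm_eq_of_norm_sub_lt (hx.trans_lt hcx), norm_eq_of_norm_sub_lt (hy.trans_lt hcx),
          max_eq_left hx₀.le, norm_div, norm_mul, ← sub_sub_sub_cancel_right x y x₀]
        gcongr
        exact (norm_sub_le_max' _ _).trans (max_le hx hy)
  · have hmem : ∀ P, P ∉ openDisk x₀ ‖c‖ → red P = a := fun P hP => ha (by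
      rw [← compl_compl U, h]; exact hP)
    have hmem' : ∀ x : L, ‖c‖ ≤ ‖x - x₀‖ → red (x : P1 L) = OnePoint.infty := fun x hx => by
      rw [← red_infty, hmem OnePoint.infty (by simp [openDisk])]
      exact hmem _ (by simpa [openDisk, dist_eq_norm] using hx)
    have hx₀ : ‖x₀‖ < ‖c‖ := by
      by_contra h1
      have h2 := hmem' 0 (by rw [zero_sub, norm_neg]; exact not_lt.mp h1)
      rw [red_eq_infty_iff, norm_zero] at h2
      linarith
    have hlow : ∀ x : L, ‖c‖ ≤ ‖x - x₀‖ → ‖c‖ ≤ ‖x‖ := fun x hx => by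
      by_contra h1
      exact absurd hx (not_le.mpr ((norm_sub_le_max' x x₀).trans_lt (max_lt (not_le.mp h1) hx₀)))
    have hc1 : 1 < ‖c‖ := by
      rw [← red_eq_infty_iff]
      apply hmem'
      have h2 : ‖c‖ = max ‖c - x₀‖ ‖x₀‖ ∨ ‖c‖ ≤ ‖c - x₀‖ := by
        by_cases h3 : ‖c - x₀‖ = ‖x₀‖
        · right
          have := IsUltrametricDist.norm_add_le_max (c - x₀) x₀
          rw [sub_add_cancel, h3, max_self] at this
          exact absurd this hx₀.not_ge
        · left
          rw [← IsUltrametricDist.norm_add_eq_max_of_norm_ne_norm h3, sub_add_cancel]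
      rcases h2 with h2 | h2
      · rcases le_max_iff.mp h2.le with h3 | h3
        · exact h3
        · exact absurd h3 hx₀.not_ge
      · exact h2
    have hinfty : ∀ P ∈ U, chordalDist P OnePoint.infty ≤ ‖c⁻¹‖ := fun P hP => by
      have hP' : P ∉ openDisk x₀ ‖c‖ := by rw [← h]; exact fun h' => h' hP
      induction P using OnePoint.rec with
      | infty => rw [chordalDist_self]; exact norm_nonneg _
      | coe x =>
        have hx : ‖c‖ ≤ ‖x - x₀‖ := by simpa [openDisk, dist_eq_norm] using hP'
        change 1 / max ‖x‖ 1 ≤ _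
        rw [norm_inv, ← one_div]
        exact one_div_le_one_div_of_le (by linarith) ((hlow x hx).trans (le_max_left _ _))
    refine ⟨c⁻¹, by rw [norm_inv]; positivity, by rw [norm_inv]; exact inv_lt_one_of_one_lt₀ hc1,
      fun P hP Q hQ => ?_⟩
    refine (chordalDist_le_max P OnePoint.infty Q).trans (max_le (hinfty P hP) ?_)
    rw [chordalDist_comm]
    exact hinfty Q hQ

/-- A common bound for the distances between points of the same residue class in a finite union of
rational closed disks, each lying in a residue class. -/
lemma exists_bound_sUnion (hL : ∃ e : L, 0 < ‖e‖ ∧ ‖e‖ < 1) {S : Set (Set (P1 L))}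
    (hS : S.Finite) (hdisk : ∀ U ∈ S, IsRationalClosedDisk U)
    (hclass : ∀ U ∈ S, ∃ a : P1 (ResField L), U ⊆ residueClass a) :
    ∃ e : L, 0 < ‖e‖ ∧ ‖e‖ < 1 ∧
      ∀ P ∈ ⋃₀ S, ∀ Q ∈ ⋃₀ S, red P = red Q → chordalDist P Q ≤ ‖e‖ := by
  have hmax : ∀ e₁ e₂ : L, 0 < ‖e₁‖ → ‖e₁‖ < 1 → ‖e₂‖ < 1 →
      ∃ e : L, 0 < ‖e‖ ∧ ‖e‖ < 1 ∧ ‖e₁‖ ≤ ‖e‖ ∧ ‖e₂‖ ≤ ‖e‖ := by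
    intro e₁ e₂ h0 h1 h2
    rcases le_total ‖e₁‖ ‖e₂‖ with h | h
    · exact ⟨e₂, h0.trans_le h, h2, h, le_rfl⟩
    · exact ⟨e₁, h0, h1, le_rfl, h⟩
  induction S, hS using Set.Finite.induction_on with
  | empty =>
    obtain ⟨e, h0, h1⟩ := hL
    exact ⟨e, h0, h1, by simp⟩
  | @insert U S _ _ ih =>
    obtain ⟨e₁, h10, h11, h1⟩ := ih (fun V hV => hdisk V (Set.mem_insert_of_mem _ hV))
      (fun V hV => hclass V (Set.mem_insert_of_mem _ hV))
    obtain ⟨a, ha⟩ := hclass U (Set.mem_insert _ _)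
    obtain ⟨e₂, h20, h21, h2⟩ := (hdisk U (Set.mem_insert _ _)).exists_bound ha
    -- the distance between `U` and the points of its class in the other disks
    obtain ⟨e₃, h31, h3⟩ : ∃ e₃ : L, ‖e₃‖ < 1 ∧ ∀ P ∈ U, ∀ Q ∈ ⋃₀ S, red P = red Q →
        chordalDist P Q ≤ max ‖e₂‖ (max ‖e₃‖ ‖e₁‖) := by
      by_cases h : ∃ P₀ ∈ U, ∃ Q₀ ∈ ⋃₀ S, red P₀ = red Q₀
      · obtain ⟨P₀, hP₀, Q₀, hQ₀, hPQ⟩ := h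
        obtain ⟨e₃, he₃⟩ := exists_norm_eq_chordalDist P₀ Q₀
        refine ⟨e₃, by rw [he₃]; exact (chordalDist_lt_one_iff _ _).mpr hPQ,
          fun P hP Q hQ hPQ' => ?_⟩
        refine (chordalDist_le_max P P₀ Q).trans (max_le_max (h2 P hP P₀ hP₀) ?_)
        refine (chordalDist_le_max P₀ Q₀ Q).trans (max_le_max he₃.ge (h1 Q₀ hQ₀ Q hQ ?_))
        rw [← hPQ, ← hPQ', mem_residueClass.mp (ha hP₀), mem_residueClass.mp (ha hP)]
      · push Not at h
        exact ⟨0, by simp, fun P hP Q hQ hPQ => absurd hPQ (h P hP Q hQ)⟩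
    obtain ⟨e₄, h40, h41, h42, h43⟩ := hmax e₁ e₂ h10 h11 h21
    obtain ⟨e, he0, he1, he4, he3⟩ := hmax e₄ e₃ h40 h41 h31
    have hle : max ‖e₂‖ (max ‖e₃‖ ‖e₁‖) ≤ ‖e‖ :=
      max_le (h43.trans he4) (max_le he3 (h42.trans he4))
    refine ⟨e, he0, he1, ?_⟩
    intro P hP Q hQ hPQ
    rw [Set.sUnion_insert] at hP hQ
    rcases hP with hP | hP <;> rcases hQ with hQ | hQ
    · exact (h2 P hP Q hQ).trans (h43.trans he4)
    · exact (h3 P hP Q hQ hPQ).trans hle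
    · rw [chordalDist_comm]
      exact (h3 Q hQ P hP hPQ.symm).trans hle
    · exact (h1 P hP Q hQ hPQ).trans (h42.trans he4)

/-- If the complement of a union of disks meets a residue class without being contained in it, then
each of the disks lies in a residue class. -/
lemma disks_subset_residueClass {S : Set (Set (P1 L))} (hS : ∀ U ∈ S, IsDisk U)
    {c : P1 (ResField L)} (hmeet : ((⋃₀ S)ᶜ ∩ residueClass c).Nonempty)
    (hsub : ¬ (⋃₀ S)ᶜ ⊆ residueClass c) : ∀ U ∈ S, ∃ a : P1 (ResField L), U ⊆ residueClass a := by
  intro U hU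
  obtain ⟨a, h | h⟩ := (hS U hU).dichotomy
  · exact ⟨a, h⟩
  · exfalso
    have h1 : (⋃₀ S)ᶜ ⊆ residueClass a :=
      (Set.compl_subset_compl.mpr (Set.subset_sUnion_of_mem hU)).trans h
    obtain ⟨P, hP, hPc⟩ := hmeet
    have : a = c := (mem_residueClass.mp (h1 hP)).symm.trans hPc
    exact hsub (this ▸ h1)

lemma finite_image_red_sUnion {S : Set (Set (P1 L))} (hS : S.Finite)
    (h : ∀ U ∈ S, ∃ a : P1 (ResField L), U ⊆ residueClass a) : (red '' ⋃₀ S).Finite := by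
  rw [Set.sUnion_eq_biUnion, Set.image_iUnion₂]
  refine hS.biUnion fun U hU => ?_
  obtain ⟨a, ha⟩ := h U hU
  refine (Set.finite_singleton a).subset ?_
  rintro _ ⟨P, hP, rfl⟩
  exact ha hP

/-- A connected affinoid in the Fatou set that meets a residue class is contained in it, provided
that the Julia set meets infinitely many classes. -/
lemma IsConnectedAffinoid.subset_of_julia {φ : RatFunc L} {U : Set (P1 L)}
    (hU : IsConnectedAffinoid U) (hUF : U ⊆ fatou φ) {c : P1 (ResField L)}
    (hmeet : (U ∩ residueClass c).Nonempty)
    (hJ : {a : P1 (ResField L) | (julia φ ∩ residueClass a).Nonempty}.Infinite) :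
    U ⊆ residueClass c := by
  obtain ⟨S, hS, -, hdisk, rfl⟩ := hU
  by_contra hsub
  refine hJ ((finite_image_red_sUnion hS (disks_subset_residueClass hdisk hmeet hsub)).subset ?_)
  rintro a ⟨P, hPJ, hPa⟩
  refine ⟨P, ?_, hPa⟩
  by_contra hP
  exact hPJ (hUF hP)

/-- A disk in the Fatou set that meets a residue class is contained in it, provided that the Julia
set meets two classes. -/
lemma IsDisk.subset_of_julia {φ : RatFunc L} {U : Set (P1 L)}
    (hU : IsDisk U) (hUF : U ⊆ fatou φ) {c : P1 (ResField L)}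
    (hmeet : (U ∩ residueClass c).Nonempty) {a₁ a₂ : P1 (ResField L)} (ha : a₁ ≠ a₂)
    (h₁ : (julia φ ∩ residueClass a₁).Nonempty) (h₂ : (julia φ ∩ residueClass a₂).Nonempty) :
    U ⊆ residueClass c := by
  obtain ⟨a, h | h⟩ := hU.dichotomy
  · obtain ⟨P, hP, hPc⟩ := hmeet
    have : a = c := (mem_residueClass.mp (h hP)).symm.trans hPc
    exact this ▸ h
  · exfalso
    have hJ : julia φ ⊆ residueClass a := (Set.compl_subset_compl.mpr hUF).trans h
    obtain ⟨P, hP, hPa⟩ := h₁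
    obtain ⟨Q, hQ, hQa⟩ := h₂
    exact ha (hPa.symm.trans ((mem_residueClass.mp (hJ hP)).trans
      ((mem_residueClass.mp (hJ hQ)).symm.trans hQa)))

/-- A rational open connected affinoid that meets a residue class without being contained in it has
forward images covering the projective line up to finitely many points. -/
lemma IsRationalOpenConnectedAffinoid.subset_of_omits [Infinite (ResField L)]
    (hL : ∃ e : L, 0 < ‖e‖ ∧ ‖e‖ < 1) {φ : RatFunc L} {ψ : RatFunc (ResField L)}
    (R : ReducedFibres φ ψ) (hdeg : 2 ≤ ratDegree ψ) {U : Set (P1 L)}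
    (hU : IsRationalOpenConnectedAffinoid U) (hφ : OrbitOmitsInfinitely φ U)
    {c : P1 (ResField L)} (hmeet : (U ∩ residueClass c).Nonempty) : U ⊆ residueClass c := by
  obtain ⟨S, hS, -, hdisk, rfl⟩ := hU
  by_contra hsub
  have hclass := disks_subset_residueClass (fun U hU => (hdisk U hU).isDisk) hmeet hsub
  obtain ⟨e, he0, he1, he⟩ := exists_bound_sUnion hL hS hdisk hclass
  have hE : (⋃ n : ℕ, (ratMap φ)^[n] '' (⋃₀ S)ᶜ)ᶜ ⊆ ⋃₀ S := by
    rw [Set.compl_subset_comm]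
    refine Set.subset_iUnion_of_subset 0 ?_
    simp
  refine hφ (R.finite_of_backward_invariant hdeg ?_
    ((finite_image_red_sUnion hS hclass).subset (Set.image_mono hE)) he0 he1
    fun P hP Q hQ => he P (hE hP) Q (hE hQ))
  intro P hP
  contrapose! hP
  simp only [Set.mem_compl_iff, not_not, Set.mem_iUnion] at hP ⊢
  obtain ⟨n, u, hu, rfl⟩ := hP
  exact ⟨n + 1, u, hu, Function.iterate_succ_apply' _ _ _⟩

end Disks

/-! ### Components -/

section Components

variable {L : Type*} [NormedField L] [IsUltrametricDist L]

/-- Suppose that the components of some type are unions of admissible sets, and that a family of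
residue classes `W_{c i n}`, where `φ` maps `W_{c i n}` onto `W_{c i (n + 1)}`, consists of pairwise
distinct maximal admissible sets.  Then the classes `W_{c i 0}` are wandering components in distinct
grand orbits. -/
lemma wanderInDistinctGrandOrbits_of_maximal {φ : RatFunc L}
    (A B : Set (P1 L) → Prop) (comp : P1 L → Set (P1 L))
    (hcomp : ∀ x, comp x = ⋃₀ {W | A W ∧ x ∈ W ∧ B W})
    {ι : Type*} (c : ι → ℕ → P1 (ResField L)) (hinj : ∀ i j m n, c i m = c j n → i = j ∧ m = n)
    (himg : ∀ i n, ratMap φ '' residueClass (c i n) = residueClass (c i (n + 1)))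
    (hF : ∀ i n, residueClass (c i n) ⊆ fatou φ)
    (hA : ∀ i n, A (residueClass (c i n))) (hB : ∀ i n, B (residueClass (c i n)))
    (hmax : ∀ i n U, A U → B U → (U ∩ residueClass (c i n)).Nonempty →
      U ⊆ residueClass (c i n)) :
    WanderInDistinctGrandOrbits φ (comp '' fatou φ) (fun i => residueClass (c i 0)) := by
  have hcompeq : ∀ i n x, x ∈ residueClass (c i n) → comp x = residueClass (c i n) := by
    intro i n x hx
    rw [hcomp]
    refine Set.Subset.antisymm (Set.sUnion_subset ?_)
      (Set.subset_sUnion_of_mem ⟨hA i n, hx, hB i n⟩)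
    rintro U ⟨hUA, hxU, hUB⟩
    exact hmax i n U hUA hUB ⟨x, hxU, hx⟩
  have hmem : ∀ i n, residueClass (c i n) ∈ comp '' fatou φ := by
    intro i n
    obtain ⟨x, hx⟩ := residueClass_nonempty (c i n)
    exact ⟨x, hF i n hx, hcompeq i n x hx⟩
  have hmap : ∀ i n, componentMap φ (comp '' fatou φ) (residueClass (c i n)) =
      residueClass (c i (n + 1)) := by
    intro i n
    refine componentMap_eq φ _ _ _ (hmem i (n + 1)) (himg i n).subset ?_
    rintro _ ⟨x, -, rfl⟩ hx
    rw [himg] at hx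
    obtain ⟨p, hp⟩ := residueClass_nonempty (c i (n + 1))
    have hpx := hx hp
    rw [hcomp] at hpx
    obtain ⟨U, ⟨hUA, hxU, hUB⟩, hpU⟩ := hpx
    exact hcompeq i (n + 1) x (hmax i (n + 1) U hUA hUB ⟨p, hpU, hp⟩ hxU)
  have hiter : ∀ i m n, (componentMap φ (comp '' fatou φ))^[m] (residueClass (c i n)) =
      residueClass (c i (n + m)) := by
    intro i m
    induction m with
    | zero => intro n; rfl
    | succ m ih =>
      intro n
      rw [Function.iterate_succ_apply', ih, hmap]
      rfl
  refine ⟨fun i => ⟨hmem i 0, ?_⟩, fun i j hij => ?_⟩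
  · rintro ⟨m, k, hk, hper⟩
    rw [hiter] at hper
    have h1 := hper.eq
    rw [hiter] at h1
    have := (hinj i i _ _ (residueClass_injective h1)).2
    omega
  · rintro ⟨m, n, h⟩
    rw [hiter, hiter] at h
    exact hij (hinj i j _ _ (residueClass_injective h)).1

end Components

/-! ### Binary forms and lifts to homogeneous coordinates -/

section Homogeneous

variable {F : Type*} [Field F]

/-- The value at `(x, y)` of `f`, regarded as a binary form of degree `d`. -/
def hom (d : ℕ) (f : F[X]) (x y : F) : F :=
  ∑ i ∈ Finset.range (d + 1), f.coeff i * x ^ i * y ^ (d - i)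

lemma hom_zero_right (d : ℕ) (f : F[X]) (x : F) : hom d f x 0 = x ^ d * f.coeff d := by
  rw [hom, Finset.sum_range_succ, Finset.sum_eq_zero]
  · simp [mul_comm]
  · intro i hi
    rw [zero_pow (by have := Finset.mem_range.mp hi; omega), mul_zero]

lemma hom_of_right_ne_zero {d : ℕ} {f : F[X]} (hf : f.natDegree ≤ d) (x : F) {y : F}
    (hy : y ≠ 0) : hom d f x y = y ^ d * f.eval (x / y) := by
  rw [hom, eval_eq_sum_range' (Nat.lt_succ_of_le hf), Finset.mul_sum]
  refine Finset.sum_congr rfl fun i hi => ?_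
  have hi' : i ≤ d := Nat.lt_succ_iff.mp (Finset.mem_range.mp hi)
  obtain ⟨k, rfl⟩ := Nat.exists_eq_add_of_le hi'
  rw [Nat.add_sub_cancel_left, div_pow, pow_add]
  field_simp

lemma natDegree_reflect_le {d : ℕ} {f : F[X]} (hf : f.natDegree ≤ d) :
    (reflect d f).natDegree ≤ d := by
  rw [natDegree_le_iff_coeff_eq_zero]
  intro i hi
  rw [coeff_reflect, revAt_eq_self_of_lt hi]
  exact coeff_eq_zero_of_natDegree_lt (hf.trans_lt hi)

lemma hom_reflect (d : ℕ) (f : F[X]) (x y : F) : hom d (reflect d f) x y = hom d f y x := by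
  rw [hom, hom, ← Finset.sum_range_reflect]
  refine Finset.sum_congr rfl fun i hi => ?_
  have hi' : i ≤ d := Nat.lt_succ_iff.mp (Finset.mem_range.mp hi)
  have h1 : d + 1 - 1 - i = d - i := by omega
  have h2 : d - (d - i) = i := by omega
  rw [h1, h2, coeff_reflect, revAt_le (Nat.sub_le d i), h2]
  ring

lemma hom_of_left_ne_zero {d : ℕ} {f : F[X]} (hf : f.natDegree ≤ d) {x : F} (hx : x ≠ 0)
    (y : F) : hom d f x y = x ^ d * (reflect d f).eval (y / x) := by
  rw [← hom_of_right_ne_zero (natDegree_reflect_le hf) y hx, hom_reflect]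

/-- Up to a factor that does not depend on the form, the value of a form at homogeneous coordinates
is its normalized value at the point. -/
lemma exists_hom_eq_mul_ev (d : ℕ) {x y : F} (h : x ≠ 0 ∨ y ≠ 0) :
    ∃ c : F, c ≠ 0 ∧ ∀ f : F[X], f.natDegree ≤ d → hom d f x y = c * ev d f (ofCoords x y) := by
  by_cases hy : y = 0
  · subst hy
    refine ⟨x ^ d, pow_ne_zero _ (by simpa using h), fun f _ => ?_⟩
    rw [hom_zero_right, ofCoords_zero, ev_infty]
  · refine ⟨y ^ d, pow_ne_zero _ hy, fun f hf => ?_⟩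
    rw [hom_of_right_ne_zero hf x hy, ofCoords_of_ne_zero _ hy, ev_coe]

lemma exists_eq_mul_of_ofCoords_eq {x y x' y' : F} (h : x ≠ 0 ∨ y ≠ 0) (h' : x' ≠ 0 ∨ y' ≠ 0)
    (heq : ofCoords x y = ofCoords x' y') : ∃ c : F, c ≠ 0 ∧ x = c * x' ∧ y = c * y' := by
  by_cases hy : y = 0 <;> by_cases hy' : y' = 0
  · subst hy hy'
    simp only [ne_eq, not_true_eq_false, or_false] at h h'
    exact ⟨x / x', div_ne_zero h h', by field_simp, by simp⟩
  · rw [hy, ofCoords_zero, ofCoords_of_ne_zero _ hy'] at heq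
    exact absurd heq.symm (OnePoint.coe_ne_infty _)
  · rw [hy', ofCoords_zero, ofCoords_of_ne_zero _ hy] at heq
    exact absurd heq (OnePoint.coe_ne_infty _)
  · rw [ofCoords_of_ne_zero _ hy, ofCoords_of_ne_zero _ hy', OnePoint.coe_eq_coe] at heq
    refine ⟨y / y', div_ne_zero hy hy', ?_, by field_simp⟩
    field_simp at heq ⊢
    linear_combination heq

/-- The orbit of homogeneous coordinates under a pair of binary forms. -/
def homOrbit (d : ℕ) (f g : F[X]) (x y : F) : ℕ → F × F
  | 0 => (x, y)
  | n + 1 => (hom d f (homOrbit d f g x y n).1 (homOrbit d f g x y n).2,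
      hom d g (homOrbit d f g x y n).1 (homOrbit d f g x y n).2)

lemma homOrbit_spec {f g : F[X]} (hfg : IsCoprime f g) (hg : g ≠ 0) {φ : RatFunc F}
    (hφ : φ = algebraMap F[X] (RatFunc F) f / algebraMap F[X] (RatFunc F) g) {d : ℕ}
    (hd : d = max f.natDegree g.natDegree) {x y : F} (h : x ≠ 0 ∨ y ≠ 0) (n : ℕ) :
    ((homOrbit d f g x y n).1 ≠ 0 ∨ (homOrbit d f g x y n).2 ≠ 0) ∧
      (ratMap φ)^[n] (ofCoords x y) =
        ofCoords (homOrbit d f g x y n).1 (homOrbit d f g x y n).2 := by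
  induction n with
  | zero => exact ⟨h, rfl⟩
  | succ n ih =>
    obtain ⟨c, hc, hev⟩ := exists_hom_eq_mul_ev d ih.1
    have hf := hev f (hd ▸ le_max_left _ _)
    have hg' := hev g (hd ▸ le_max_right _ _)
    rw [Function.iterate_succ_apply', ih.2, ratMap_eq hfg hg hφ hd, homOrbit, hf, hg',
      ofCoords_mul_left hc]
    refine ⟨?_, rfl⟩
    rcases ev_ne_zero_or hfg hd
      (ofCoords (homOrbit d f g x y n).1 (homOrbit d f g x y n).2) with h0 | h0
    · exact Or.inl (mul_ne_zero hc h0)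
    · exact Or.inr (mul_ne_zero hc h0)

/-- A coprime pair remains coprime when the coordinates of the projective line are exchanged. -/
lemma isCoprime_reflect [IsAlgClosed F] {f g : F[X]} (hfg : IsCoprime f g) {d : ℕ}
    (hd : d = max f.natDegree g.natDegree) : IsCoprime (reflect d f) (reflect d g) := by
  rw [isCoprime_iff_aeval_ne_zero_of_isAlgClosed F F]
  intro y
  obtain ⟨c, hc, hev⟩ := exists_hom_eq_mul_ev d (x := 1) (y := y) (Or.inl one_ne_zero)
  have h : ∀ p : F[X], p.natDegree ≤ d →
      aeval y (reflect d p) = c * ev d p (ofCoords 1 y) := by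
    intro p hp
    rw [← hev p hp, hom_of_left_ne_zero hp one_ne_zero]
    simp
  rw [h f (hd ▸ le_max_left _ _), h g (hd ▸ le_max_right _ _)]
  exact (ev_ne_zero_or hfg hd _).imp (mul_ne_zero hc) (mul_ne_zero hc)

end Homogeneous

/-! ### Wandering points of rational functions over a field with a family of places -/

section Places

variable {F : Type*} [Field F]

/-- A substitute for the product formula on a field `F`: a set of valuation subrings (the finite places) and a set of absolute values (the places at
infinity), such that a nonzero element that is integral at all finite places is not small at some
place at infinity; and an element `t` which is integral at all finite places, and has the same
absolute value `τ > 1` at all places at infinity. -/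
structure PlaceFamily (F : Type*) [Field F] where
  /-- The finite places. -/
  fin : Set (ValuationSubring F)
  /-- The places at infinity. -/
  inf : Set (AbsoluteValue F ℝ)
  /-- The element that is large at infinity. -/
  t : F
  /-- The common absolute value of `t` at the places at infinity. -/
  τ : ℝ
  exists_denom : ∀ z : F, ∃ s : F, s ≠ 0 ∧ ∀ V ∈ fin, s ∈ V ∧ s * z ∈ V
  exists_bound : ∀ z : F, ∃ M : ℝ, ∀ β ∈ inf, β z ≤ M
  exists_one_le : ∀ z : F, z ≠ 0 → (∀ V ∈ fin, z ∈ V) → ∃ β ∈ inf, 1 ≤ β z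
  t_mem : ∀ V ∈ fin, t ∈ V
  abv_t : ∀ β ∈ inf, β t = τ
  one_lt : 1 < τ

lemma eval_mem_valuationSubring {V : ValuationSubring F} {p : F[X]} (hp : ∀ i, p.coeff i ∈ V)
    {x : F} (hx : x ∈ V) : p.eval x ∈ V := by
  rw [eval_eq_sum_range]
  exact V.toSubring.sum_mem fun i _ => V.mul_mem _ _ (hp i) (V.toSubring.pow_mem hx i)

lemma hom_mem_valuationSubring {V : ValuationSubring F} {p : F[X]} (hp : ∀ i, p.coeff i ∈ V)
    (d : ℕ) {x y : F} (hx : x ∈ V) (hy : y ∈ V) : hom d p x y ∈ V :=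
  V.toSubring.sum_mem fun i _ => V.mul_mem _ _
    (V.mul_mem _ _ (hp i) (V.toSubring.pow_mem hx i)) (V.toSubring.pow_mem hy _)

/-- Polynomial identities witnessing that the binary forms `f` and `g` of degree `d` have no common
zero on the projective line, over either of the two standard charts. -/
structure BezoutWitness (d : ℕ) (f g : F[X]) where
  /-- The coefficient of `f` over the chart around `0`. -/
  u : F[X]
  /-- The coefficient of `g` over the chart around `0`. -/
  w : F[X]
  /-- The coefficient of `f` over the chart around `∞`. -/
  u' : F[X]
  /-- The coefficient of `g` over the chart around `∞`. -/
  w' : F[X]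
  /-- The constant in which both identities result; it plays the role of the resultant. -/
  R : F
  R_ne_zero : R ≠ 0
  bezout : u * f + w * g = C R
  bezout' : u' * reflect d f + w' * reflect d g = C R

/-- The polynomials that enter into the identities. -/
def BezoutWitness.polys {d : ℕ} {f g : F[X]} (W : BezoutWitness d f g) : List F[X] :=
  [f, g, W.u, W.w, W.u', W.w', C W.R]

lemma PlaceFamily.exists_common_denom (𝓟 : PlaceFamily F) (S : Finset F) :
    ∃ s : F, s ≠ 0 ∧ ∀ V ∈ 𝓟.fin, s ∈ V ∧ ∀ z ∈ S, s * z ∈ V := by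
  classical
  induction S using Finset.induction_on with
  | empty => exact ⟨1, one_ne_zero, fun V _ => ⟨V.one_mem, by simp⟩⟩
  | insert z S _ ih =>
    obtain ⟨s, hs, h⟩ := ih
    obtain ⟨r, hr, h'⟩ := 𝓟.exists_denom z
    refine ⟨s * r, mul_ne_zero hs hr, fun V hV => ?_⟩
    obtain ⟨h1, h2⟩ := h V hV
    obtain ⟨h3, h4⟩ := h' V hV
    refine ⟨V.mul_mem _ _ h1 h3, fun z' hz' => ?_⟩
    rcases Finset.mem_insert.mp hz' with rfl | hz'
    · rw [mul_assoc]
      exact V.mul_mem _ _ h1 h4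
    · rw [mul_comm s r, mul_assoc]
      exact V.mul_mem _ _ h3 (h2 z' hz')

lemma PlaceFamily.exists_common_denom_polys (𝓟 : PlaceFamily F) (l : List F[X]) :
    ∃ s : F, s ≠ 0 ∧ ∀ V ∈ 𝓟.fin, s ∈ V ∧ ∀ p ∈ l, ∀ i, (C s * p).coeff i ∈ V := by
  classical
  obtain ⟨s, hs, h⟩ := 𝓟.exists_common_denom (l.toFinset.biUnion coeffs)
  refine ⟨s, hs, fun V hV => ⟨(h V hV).1, fun p hp i => ?_⟩⟩
  rw [coeff_C_mul]
  by_cases h0 : p.coeff i = 0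
  · rw [h0, mul_zero]
    exact V.zero_mem
  · exact (h V hV).2 _ (Finset.mem_biUnion.mpr
      ⟨p, List.mem_toFinset.mpr hp, coeff_mem_coeffs h0⟩)

lemma PlaceFamily.exists_bound_polys (𝓟 : PlaceFamily F) (l : List F[X]) :
    ∃ M : ℝ, 1 ≤ M ∧ ∀ β ∈ 𝓟.inf, ∀ p ∈ l, ∀ i, β (p.coeff i) ≤ M := by
  classical
  choose b hb using 𝓟.exists_bound
  refine ⟨1 + ∑ z ∈ l.toFinset.biUnion coeffs, |b z|, ?_, fun β hβ p hp i => ?_⟩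
  · have : 0 ≤ ∑ z ∈ l.toFinset.biUnion coeffs, |b z| :=
      Finset.sum_nonneg fun _ _ => abs_nonneg _
    linarith
  by_cases h0 : p.coeff i = 0
  · rw [h0, map_zero]
    have : 0 ≤ ∑ z ∈ l.toFinset.biUnion coeffs, |b z| :=
      Finset.sum_nonneg fun _ _ => abs_nonneg _
    linarith
  · have h1 : |b (p.coeff i)| ≤ ∑ z ∈ l.toFinset.biUnion coeffs, |b z| :=
      Finset.single_le_sum (f := fun z => |b z|) (fun _ _ => abs_nonneg _)
        (Finset.mem_biUnion.mpr ⟨p, List.mem_toFinset.mpr hp, coeff_mem_coeffs h0⟩)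
    have h2 := (hb (p.coeff i) β hβ).trans (le_abs_self _)
    linarith

/-- A rational function is the quotient of polynomials for which everything in sight is integral
at the finite places. -/
lemma PlaceFamily.exists_bezoutWitness [IsAlgClosed F] (𝓟 : PlaceFamily F) (φ : RatFunc F) {d : ℕ}
    (hd : ratDegree φ = d) :
    ∃ (f g : F[X]) (W : BezoutWitness d f g), IsCoprime f g ∧ g ≠ 0 ∧
      φ = algebraMap F[X] (RatFunc F) f / algebraMap F[X] (RatFunc F) g ∧
      d = max f.natDegree g.natDegree ∧
      ∀ V ∈ 𝓟.fin, ∀ p ∈ W.polys, ∀ i, p.coeff i ∈ V := by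
  subst hd
  have hcop := RatFunc.isCoprime_num_denom φ
  obtain ⟨u, w, h⟩ := id hcop
  obtain ⟨u', w', h'⟩ := isCoprime_reflect hcop (d := ratDegree φ) rfl
  obtain ⟨s, hs, hV⟩ := 𝓟.exists_common_denom_polys [φ.num, φ.denom, u, w, u', w']
  have hsC : (C s : F[X]) ≠ 0 := C_ne_zero.mpr hs
  refine ⟨C s * φ.num, C s * φ.denom,
    ⟨C s * u, C s * w, C s * u', C s * w', s ^ 2, pow_ne_zero 2 hs, ?_, ?_⟩, ?_, ?_, ?_, ?_, ?_⟩
  · rw [C_pow]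
    linear_combination C s ^ 2 * h
  · rw [C_pow, reflect_C_mul, reflect_C_mul]
    linear_combination C s ^ 2 * h'
  · have hu : IsUnit (C s : F[X]) := isUnit_C.mpr (isUnit_iff_ne_zero.mpr hs)
    exact (isCoprime_mul_unit_left_left hu _ _).mpr
      ((isCoprime_mul_unit_left_right hu _ _).mpr hcop)
  · exact mul_ne_zero hsC φ.denom_ne_zero
  · rw [map_mul, map_mul, mul_div_mul_left, RatFunc.num_div_denom]
    exact (map_ne_zero_iff _ (RatFunc.algebraMap_injective F)).mpr hsC
  · rw [natDegree_C_mul hs, natDegree_C_mul hs, ratDegree]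
  · intro V hVm p hp i
    obtain ⟨h1, h2⟩ := hV V hVm
    simp only [BezoutWitness.polys, List.mem_cons, List.not_mem_nil, or_false] at hp
    rcases hp with rfl | rfl | rfl | rfl | rfl | rfl | rfl
    · exact h2 _ (by simp) i
    · exact h2 _ (by simp) i
    · exact h2 _ (by simp) i
    · exact h2 _ (by simp) i
    · exact h2 _ (by simp) i
    · exact h2 _ (by simp) i
    · rw [coeff_C]
      split_ifs
      · exact V.toSubring.pow_mem h1 2
      · exact V.zero_mem

/-! #### Estimates at a finite place -/

/-- The lower bound for the values of two coprime forms, at coordinates that lie in the chart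
around `0`. -/
lemma valuation_mul_pow_le_of_le {V : ValuationSubring F} {d : ℕ} {f g u w : F[X]} {R : F}
    (hf : f.natDegree ≤ d) (hg : g.natDegree ≤ d) (h : u * f + w * g = C R)
    (hu : ∀ i, u.coeff i ∈ V) (hw : ∀ i, w.coeff i ∈ V) {x y : F}
    (hy : y ≠ 0) (hxy : V.valuation x ≤ V.valuation y) :
    V.valuation R * V.valuation y ^ d ≤
      max (V.valuation (hom d f x y)) (V.valuation (hom d g x y)) := by
  have hvy : V.valuation y ≠ 0 := (_root_.map_ne_zero _).mpr hy
  have hz : x / y ∈ V := by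
    rw [← V.valuation_le_one_iff, map_div₀]
    exact div_le_one_of_le₀ hxy zero_le
  have h1 := V.valuation_le_one ⟨_, eval_mem_valuationSubring hu hz⟩
  have h2 := V.valuation_le_one ⟨_, eval_mem_valuationSubring hw hz⟩
  have h3 : R * y ^ d = u.eval (x / y) * hom d f x y + w.eval (x / y) * hom d g x y := by
    have := congrArg (Polynomial.eval (x / y)) h
    simp only [eval_add, eval_mul, eval_C] at this
    rw [hom_of_right_ne_zero hf x hy, hom_of_right_ne_zero hg x hy, ← this]
    ring
  rw [← map_pow, ← map_mul, h3]
  refine (V.valuation.map_add _ _).trans (max_le_max ?_ ?_)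
  · rw [map_mul]
    exact mul_le_of_le_one_left' h1
  · rw [map_mul]
    exact mul_le_of_le_one_left' h2

lemma BezoutWitness.valuation_mul_pow_le {V : ValuationSubring F} {d : ℕ} {f g : F[X]}
    (W : BezoutWitness d f g) (hf : f.natDegree ≤ d) (hg : g.natDegree ≤ d)
    (hW : ∀ p ∈ W.polys, ∀ i, p.coeff i ∈ V) {x y : F} (hxy : x ≠ 0 ∨ y ≠ 0) :
    V.valuation W.R * max (V.valuation x) (V.valuation y) ^ d ≤
      max (V.valuation (hom d f x y)) (V.valuation (hom d g x y)) := by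
  rcases le_total (V.valuation x) (V.valuation y) with h | h
  · rw [max_eq_right h]
    refine valuation_mul_pow_le_of_le hf hg W.bezout (hW _ (by simp [polys]))
      (hW _ (by simp [polys])) ?_ h
    rintro rfl
    rw [map_zero, le_zero_iff, map_eq_zero] at h
    simp [h] at hxy
  · rw [max_eq_left h, ← hom_reflect, ← hom_reflect d g]
    refine valuation_mul_pow_le_of_le (natDegree_reflect_le hf) (natDegree_reflect_le hg)
      W.bezout' (hW _ (by simp [polys])) (hW _ (by simp [polys])) ?_ h
    rintro rfl
    rw [map_zero, le_zero_iff, map_eq_zero] at h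
    simp [h] at hxy

lemma one_add_mul_pow_sub_one_le {d : ℕ} (hd : 2 ≤ d) (n : ℕ) :
    1 + d * (d ^ n - 1) ≤ d ^ (n + 1) - 1 := by
  have h : 1 ≤ d ^ n := Nat.one_le_pow _ _ (by omega)
  obtain ⟨k, hk⟩ := Nat.exists_eq_add_of_le h
  rw [pow_succ, hk, Nat.add_sub_cancel_left, add_mul, one_mul, mul_comm k d]
  omega

/-- A finite place contributes a bounded amount per step to the comparison of the height of an
iterate with `d ^ n` times the initial height. -/
lemma BezoutWitness.homOrbit_valuation {V : ValuationSubring F} {d : ℕ} {f g : F[X]}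
    (W : BezoutWitness d f g) (hd : 2 ≤ d) (hf : f.natDegree ≤ d) (hg : g.natDegree ≤ d)
    (hW : ∀ p ∈ W.polys, ∀ i, p.coeff i ∈ V) {x : F} (hx : x ∈ V) (n : ℕ)
    (h0 : ∀ n, (homOrbit d f g x 1 n).1 ≠ 0 ∨ (homOrbit d f g x 1 n).2 ≠ 0) :
    ((homOrbit d f g x 1 n).1 ∈ V ∧ (homOrbit d f g x 1 n).2 ∈ V) ∧
      V.valuation W.R ^ (d ^ n - 1) ≤ max (V.valuation (homOrbit d f g x 1 n).1)
        (V.valuation (homOrbit d f g x 1 n).2) := by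
  induction n with
  | zero => exact ⟨⟨hx, V.one_mem⟩, by simp [homOrbit]⟩
  | succ n ih =>
    obtain ⟨⟨h1, h2⟩, h3⟩ := ih
    refine ⟨⟨hom_mem_valuationSubring (hW _ (by simp [polys])) d h1 h2,
      hom_mem_valuationSubring (hW _ (by simp [polys])) d h1 h2⟩, ?_⟩
    have hR : V.valuation W.R ≤ 1 := by
      rw [V.valuation_le_one_iff]
      simpa using hW (C W.R) (by simp [polys]) 0
    have hpow := one_add_mul_pow_sub_one_le hd n
    calc V.valuation W.R ^ (d ^ (n + 1) - 1)
        ≤ V.valuation W.R ^ (1 + d * (d ^ n - 1)) := pow_le_pow_right_of_le_one' hR hpow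
      _ = V.valuation W.R * (V.valuation W.R ^ (d ^ n - 1)) ^ d := by
          rw [pow_add, pow_one, mul_comm d, pow_mul]
      _ ≤ V.valuation W.R * max (V.valuation (homOrbit d f g x 1 n).1)
            (V.valuation (homOrbit d f g x 1 n).2) ^ d :=
          mul_le_mul_right (pow_le_pow_left' h3 d) _
      _ ≤ _ := W.valuation_mul_pow_le hf hg hW (h0 n)

end Places

section PlacesAtInfinity

variable {F : Type*} [Field F]

/-! #### Estimates at a place at infinity -/

lemma abv_eval_le {β : AbsoluteValue F ℝ} {M : ℝ} {p : F[X]} (hp : ∀ i, β (p.coeff i) ≤ M)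
    {x : F} (hx : β x ≤ 1) : β (p.eval x) ≤ (p.natDegree + 1) * M := by
  rw [eval_eq_sum_range]
  refine (β.sum_le _ _).trans ?_
  calc ∑ i ∈ Finset.range (p.natDegree + 1), β (p.coeff i * x ^ i)
      ≤ ∑ _i ∈ Finset.range (p.natDegree + 1), M := by
        refine Finset.sum_le_sum fun i _ => ?_
        rw [map_mul, map_pow]
        exact (mul_le_of_le_one_right (β.nonneg _) (pow_le_one₀ (β.nonneg _) hx)).trans (hp i)
    _ = (p.natDegree + 1) * M := by simp

/-- Bounds for the values of two coprime forms, at coordinates that lie in the chart around `0`.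
They depend only on bounds for the coefficients, hence are uniform in the place. -/
lemma abv_hom_bounds_of_le {β : AbsoluteValue F ℝ} {d N : ℕ} {M : ℝ} (hM : 1 ≤ M)
    {f g u w : F[X]} {R : F} (hf : f.natDegree ≤ d) (hg : g.natDegree ≤ d)
    (hN : f.natDegree ≤ N ∧ g.natDegree ≤ N ∧ u.natDegree ≤ N ∧ w.natDegree ≤ N)
    (h : u * f + w * g = C R) (hR : 1 ≤ M * β R)
    (hcf : ∀ i, β (f.coeff i) ≤ M) (hcg : ∀ i, β (g.coeff i) ≤ M)
    (hcu : ∀ i, β (u.coeff i) ≤ M) (hcw : ∀ i, β (w.coeff i) ≤ M) {x y : F}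
    (hy : y ≠ 0) (hxy : β x ≤ β y) :
    max (β (hom d f x y)) (β (hom d g x y)) ≤ 2 * (N + 1) * M ^ 2 * β y ^ d ∧
      β y ^ d ≤ 2 * (N + 1) * M ^ 2 * max (β (hom d f x y)) (β (hom d g x y)) := by
  have hβy : 0 < β y := β.pos hy
  have hz : β (x / y) ≤ 1 := by
    rw [map_div₀]
    exact div_le_one_of_le₀ hxy (β.nonneg _)
  have key : ∀ p : F[X], p.natDegree ≤ N → (∀ i, β (p.coeff i) ≤ M) →
      β (p.eval (x / y)) ≤ (N + 1) * M := by
    intro p hpN hp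
    refine (abv_eval_le hp hz).trans ?_
    gcongr
  have hle : (N + 1 : ℝ) * M ≤ 2 * (N + 1) * M ^ 2 := by
    have h0 : (0 : ℝ) ≤ N := Nat.cast_nonneg N
    nlinarith [mul_nonneg h0 (sub_nonneg.mpr hM), mul_nonneg h0 (sq_nonneg M)]
  rw [hom_of_right_ne_zero hf x hy, hom_of_right_ne_zero hg x hy, map_mul, map_mul, map_pow,
    ← mul_max_of_nonneg _ _ (pow_nonneg hβy.le d)]
  set m := max (β (f.eval (x / y))) (β (g.eval (x / y))) with hm
  have hm0 : 0 ≤ m := (β.nonneg _).trans (le_max_left _ _)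
  have hmle : m ≤ (N + 1) * M := max_le (key f hN.1 hcf) (key g hN.2.1 hcg)
  have hRle : β R ≤ 2 * (N + 1) * M * m := by
    have h1 := congrArg (Polynomial.eval (x / y)) h
    simp only [eval_add, eval_mul, eval_C] at h1
    rw [← h1]
    refine (β.add_le _ _).trans ?_
    rw [map_mul, map_mul]
    have h2 : β (u.eval (x / y)) * β (f.eval (x / y)) ≤ (N + 1) * M * m :=
      mul_le_mul (key u hN.2.2.1 hcu) (le_max_left _ _) (β.nonneg _) (by positivity)
    have h3 : β (w.eval (x / y)) * β (g.eval (x / y)) ≤ (N + 1) * M * m :=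
      mul_le_mul (key w hN.2.2.2 hcw) (le_max_right _ _) (β.nonneg _) (by positivity)
    linarith
  have hone : 1 ≤ 2 * (N + 1) * M ^ 2 * m := by
    calc (1 : ℝ) ≤ M * β R := hR
      _ ≤ M * (2 * (N + 1) * M * m) := by gcongr
      _ = 2 * (N + 1) * M ^ 2 * m := by ring
  have hpos : 0 < β y ^ d := pow_pos hβy d
  constructor
  · rw [mul_comm]
    exact mul_le_mul_of_nonneg_right (hmle.trans hle) hpos.le
  · calc β y ^ d = β y ^ d * 1 := (mul_one _).symm
      _ ≤ β y ^ d * (2 * (N + 1) * M ^ 2 * m) := by gcongr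
      _ = _ := by ring

lemma BezoutWitness.exists_abv_bounds (𝓟 : PlaceFamily F) {d : ℕ} {f g : F[X]}
    (W : BezoutWitness d f g) (hf : f.natDegree ≤ d) (hg : g.natDegree ≤ d) :
    ∃ B : ℝ, 1 ≤ B ∧ ∀ β ∈ 𝓟.inf, β W.R ≤ B ∧ ∀ x y : F, x ≠ 0 ∨ y ≠ 0 →
      max (β (hom d f x y)) (β (hom d g x y)) ≤ B * max (β x) (β y) ^ d ∧
      max (β x) (β y) ^ d ≤ B * max (β (hom d f x y)) (β (hom d g x y)) := by
  obtain ⟨M, hM, hcoeff⟩ := 𝓟.exists_bound_polys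
    (C W.R⁻¹ :: reflect d f :: reflect d g :: W.polys)
  set N := d + W.u.natDegree + W.w.natDegree + W.u'.natDegree + W.w'.natDegree with hN
  have hN0 : (0 : ℝ) ≤ N := Nat.cast_nonneg N
  have hB : M ≤ 2 * (N + 1) * M ^ 2 := by
    nlinarith [mul_nonneg hN0 (sq_nonneg M)]
  refine ⟨2 * (N + 1) * M ^ 2, hM.trans hB, fun β hβ => ?_⟩
  have hc := hcoeff β hβ
  have hR : 1 ≤ M * β W.R := by
    have h1 : β W.R⁻¹ ≤ M := by simpa using hc (C W.R⁻¹) (by simp) 0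
    rw [map_inv₀] at h1
    have h2 := β.pos W.R_ne_zero
    rwa [← div_le_iff₀ h2, one_div]
  refine ⟨?_, fun x y hxy => ?_⟩
  · have h1 : β W.R ≤ M := by simpa using hc (C W.R) (by simp [polys]) 0
    exact h1.trans hB
  rcases le_total (β x) (β y) with h | h
  · rw [max_eq_right h]
    refine abv_hom_bounds_of_le hM hf hg ⟨?_, ?_, ?_, ?_⟩ W.bezout hR (hc _ (by simp [polys]))
      (hc _ (by simp [polys])) (hc _ (by simp [polys])) (hc _ (by simp [polys])) ?_ h
    · omega
    · omega
    · omega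
    · omega
    · rintro rfl
      have hx : x = 0 := by
        rw [map_zero] at h
        exact β.eq_zero.mp (le_antisymm h (β.nonneg _))
      simp [hx] at hxy
  · rw [max_eq_left h, ← hom_reflect, ← hom_reflect d g]
    have hf' := natDegree_reflect_le hf
    have hg' := natDegree_reflect_le hg
    refine abv_hom_bounds_of_le hM hf' hg' ⟨?_, ?_, ?_, ?_⟩ W.bezout' hR
      (hc _ (by simp [polys])) (hc _ (by simp [polys])) (hc _ (by simp [polys]))
      (hc _ (by simp [polys])) ?_ h
    · omega
    · omega
    · omega
    · omega
    · rintro rfl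
      have hy : y = 0 := by
        rw [map_zero] at h
        exact β.eq_zero.mp (le_antisymm h (β.nonneg _))
      simp [hy] at hxy

/-- Iterated bounds for a quantity that is multiplied by `d` on the logarithmic scale, up to a
bounded error. -/
lemma pow_bounds_of_step {d : ℕ} (hd : 2 ≤ d) {B : ℝ} (hB : 1 ≤ B) {m : ℕ → ℝ}
    (hm : ∀ n, 0 ≤ m n) (h1 : ∀ n, m (n + 1) ≤ B * m n ^ d)
    (h2 : ∀ n, m n ^ d ≤ B * m (n + 1)) (n : ℕ) :
    m n ≤ B ^ (d ^ n - 1) * m 0 ^ d ^ n ∧ m 0 ^ d ^ n ≤ B ^ (d ^ n - 1) * m n := by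
  have hB0 : 0 ≤ B := zero_le_one.trans hB
  induction n with
  | zero => simp
  | succ n ih =>
    have hpow := one_add_mul_pow_sub_one_le hd n
    have hBpow : B * (B ^ (d ^ n - 1)) ^ d ≤ B ^ (d ^ (n + 1) - 1) := by
      rw [← pow_mul, mul_comm _ d, ← pow_succ', add_comm]
      exact pow_le_pow_right₀ hB hpow
    have hpos := pow_nonneg (hm 0) (d ^ (n + 1))
    constructor
    · calc m (n + 1) ≤ B * m n ^ d := h1 n
        _ ≤ B * (B ^ (d ^ n - 1) * m 0 ^ d ^ n) ^ d := by
            gcongr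
            · exact hm n
            · exact ih.1
        _ = B * (B ^ (d ^ n - 1)) ^ d * m 0 ^ d ^ (n + 1) := by
            rw [mul_pow, ← pow_mul (m 0), ← pow_succ, mul_assoc]
        _ ≤ _ := by gcongr
    · calc m 0 ^ d ^ (n + 1) = (m 0 ^ d ^ n) ^ d := by rw [pow_succ, pow_mul]
        _ ≤ (B ^ (d ^ n - 1) * m n) ^ d := by
            gcongr
            · exact pow_nonneg (hm 0) _
            · exact ih.2
        _ = (B ^ (d ^ n - 1)) ^ d * m n ^ d := mul_pow _ _ _
        _ ≤ (B ^ (d ^ n - 1)) ^ d * (B * m (n + 1)) := by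
            gcongr
            exact h2 n
        _ = B * (B ^ (d ^ n - 1)) ^ d * m (n + 1) := by ring
        _ ≤ _ := by
            gcongr
            exact hm _

/-! #### Coincidences between the orbits of powers of `t` -/

/-- If the orbits of `t ^ a` and `t ^ b` meet, then `a` and `b` are nearly related by a power of
the degree: the height of `φ^n (t ^ a)` is that of `t` times `a d ^ n`, up to an error of the order
of `d ^ n`. -/
lemma PlaceFamily.exists_coincidence_bound [IsAlgClosed F] (𝓟 : PlaceFamily F) {φ : RatFunc F}
    (hdeg : 2 ≤ ratDegree φ) :
    ∃ K : ℕ, ∀ a b m n : ℕ,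
      (ratMap φ)^[m] ((𝓟.t ^ a : F) : P1 F) = (ratMap φ)^[n] ((𝓟.t ^ b : F) : P1 F) →
      b * ratDegree φ ^ n ≤ a * ratDegree φ ^ m + K * (ratDegree φ ^ m + ratDegree φ ^ n) := by
  generalize hd' : ratDegree φ = d at *
  obtain ⟨f, g, W, hfg, hg, hφ, hd, hW⟩ := 𝓟.exists_bezoutWitness φ hd'
  have hfd : f.natDegree ≤ d := hd ▸ le_max_left _ _
  have hgd : g.natDegree ≤ d := hd ▸ le_max_right _ _
  obtain ⟨B, hB, hbound⟩ := W.exists_abv_bounds 𝓟 hfd hgd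
  obtain ⟨K, hK⟩ := pow_unbounded_of_one_lt (B * B) 𝓟.one_lt
  refine ⟨K, fun a b m n heq => ?_⟩
  have hspec := fun c n => homOrbit_spec hfg hg hφ hd (x := 𝓟.t ^ c) (y := 1)
    (Or.inr one_ne_zero) n
  have hcoord : ∀ c, ((𝓟.t ^ c : F) : P1 F) = ofCoords (𝓟.t ^ c) 1 := by
    intro c
    rw [ofCoords_of_ne_zero _ one_ne_zero, div_one]
  rw [hcoord, hcoord, (hspec a m).2, (hspec b n).2] at heq
  obtain ⟨c, hc, hc1, hc2⟩ := exists_eq_mul_of_ofCoords_eq (hspec a m).1 (hspec b n).1 heq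
  -- The homogeneous coordinates of the common point differ by a factor `c`. At each finite place
  -- the denominators of `c` divide a power of `R`, so `c` is not small at some place at infinity.
  obtain ⟨β, hβ, hone⟩ := 𝓟.exists_one_le (c * W.R ^ (d ^ n - 1))
    (mul_ne_zero hc (pow_ne_zero _ W.R_ne_zero)) (by
      intro V hV
      have hx : ∀ c, 𝓟.t ^ c ∈ V := fun c => V.toSubring.pow_mem (𝓟.t_mem V hV) c
      have h1 := W.homOrbit_valuation hdeg hfd hgd (hW V hV) (hx b) n fun n => (hspec b n).1
      have h2 := W.homOrbit_valuation hdeg hfd hgd (hW V hV) (hx a) m fun n => (hspec a n).1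
      rw [← V.valuation_le_one_iff, map_mul, map_pow]
      refine (mul_le_mul_right h1.2 _).trans ?_
      rw [mul_max, ← map_mul, ← map_mul, ← hc1, ← hc2]
      exact max_le ((V.valuation_le_one_iff _).mpr h2.1.1) ((V.valuation_le_one_iff _).mpr h2.1.2))
  obtain ⟨hRB, hstep⟩ := hbound β hβ
  have hiter := fun c n => pow_bounds_of_step hdeg hB
    (m := fun n => max (β (homOrbit d f g (𝓟.t ^ c) 1 n).1) (β (homOrbit d f g (𝓟.t ^ c) 1 n).2))
    (fun n => (β.nonneg _).trans (le_max_left _ _))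
    (fun n => (hstep _ _ (hspec c n).1).1) (fun n => (hstep _ _ (hspec c n).1).2) n
  have hzero : ∀ c, max (β (homOrbit d f g (𝓟.t ^ c) 1 0).1)
      (β (homOrbit d f g (𝓟.t ^ c) 1 0).2) = 𝓟.τ ^ c := by
    intro c
    simp only [homOrbit, map_pow, map_one, 𝓟.abv_t β hβ]
    exact max_eq_left (one_le_pow₀ 𝓟.one_lt.le)
  simp only [hzero] at hiter
  set x := max (β (homOrbit d f g (𝓟.t ^ a) 1 m).1) (β (homOrbit d f g (𝓟.t ^ a) 1 m).2)
  have hB0 : 0 ≤ B := zero_le_one.trans hB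
  have hτ0 : 0 ≤ 𝓟.τ := zero_le_one.trans 𝓟.one_lt.le
  have hxy : x = β c * max (β (homOrbit d f g (𝓟.t ^ b) 1 n).1)
      (β (homOrbit d f g (𝓟.t ^ b) 1 n).2) := by
    rw [mul_max_of_nonneg _ _ (β.nonneg c), ← map_mul, ← map_mul, ← hc1, ← hc2]
  set y := max (β (homOrbit d f g (𝓟.t ^ b) 1 n).1) (β (homOrbit d f g (𝓟.t ^ b) 1 n).2)
  have hx0 : 0 ≤ x := (β.nonneg _).trans (le_max_left _ _)
  have hy0 : 0 ≤ y := (β.nonneg _).trans (le_max_left _ _)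
  have hcR : 1 ≤ β c * B ^ (d ^ n - 1) := by
    refine hone.trans ?_
    rw [map_mul, map_pow]
    gcongr
  have hpm : B ^ (d ^ m - 1) ≤ B ^ d ^ m := pow_le_pow_right₀ hB (Nat.sub_le _ _)
  have hpn : B ^ (d ^ n - 1) ≤ B ^ d ^ n := pow_le_pow_right₀ hB (Nat.sub_le _ _)
  have hfinal : (𝓟.τ ^ b) ^ d ^ n ≤ (B * B) ^ (d ^ m + d ^ n) * (𝓟.τ ^ a) ^ d ^ m := by
    calc (𝓟.τ ^ b) ^ d ^ n ≤ B ^ (d ^ n - 1) * y := (hiter b n).2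
      _ ≤ B ^ (d ^ n - 1) * (y * (β c * B ^ (d ^ n - 1))) := by
          gcongr
          exact le_mul_of_one_le_right hy0 hcR
      _ = B ^ (d ^ n - 1) * B ^ (d ^ n - 1) * x := by rw [hxy]; ring
      _ ≤ B ^ d ^ n * B ^ d ^ n * (B ^ d ^ m * (𝓟.τ ^ a) ^ d ^ m) := by
          gcongr
          exact (hiter a m).1.trans (by gcongr)
      _ ≤ B ^ d ^ n * B ^ d ^ n * (B ^ d ^ m * B ^ d ^ m * (𝓟.τ ^ a) ^ d ^ m) := by
          gcongr
          exact le_mul_of_one_le_right (pow_nonneg hB0 _) (one_le_pow₀ hB)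
      _ = _ := by rw [pow_add, mul_pow, mul_pow]; ring
  have hpow : 𝓟.τ ^ (b * d ^ n) ≤ 𝓟.τ ^ (a * d ^ m + K * (d ^ m + d ^ n)) := by
    rw [pow_mul, pow_add, pow_mul, pow_mul, mul_comm]
    refine hfinal.trans ?_
    gcongr
  exact (pow_le_pow_iff_right₀ 𝓟.one_lt).mp hpow

end PlacesAtInfinity

/-! ### Exponents with disjoint orbits -/

section WanderingFamily

/-- The numbers `(3K + 1)(d ^ (i + 1) + 1)` are pairwise far from being related by a power of `d`:
`(d ^ (i + 1) + 1) q` and `d ^ (j + 1) + 1`, with `q = d ^ k`, differ by at least `(q + 1) / 3`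
unless `i = j` and `q = 1`. -/
lemma eq_of_near_power {d K i j k : ℕ} (hd : 2 ≤ d)
    (h₁ : (3 * K + 1) * (d ^ (j + 1) + 1) ≤
      (3 * K + 1) * (d ^ (i + 1) + 1) * d ^ k + K * (d ^ k + 1))
    (h₂ : (3 * K + 1) * (d ^ (i + 1) + 1) * d ^ k ≤
      (3 * K + 1) * (d ^ (j + 1) + 1) + K * (d ^ k + 1)) : i = j ∧ k = 0 := by
  have hq : 1 ≤ d ^ k := Nat.one_le_pow _ _ (by omega)
  have hPq : 2 * d ^ k ≤ d ^ (i + 1) * d ^ k := by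
    gcongr
    exact hd.trans (Nat.le_self_pow (by omega) d)
  have hQ : 1 ≤ d ^ (j + 1) := Nat.one_le_pow _ _ (by omega)
  have hdist : (3 * K + 1) * (d ^ (i + 1) + 1) * d ^ k =
      (3 * K + 1) * (d ^ (i + 1) * d ^ k + d ^ k) := by ring
  rw [hdist] at h₁ h₂
  rcases lt_trichotomy j (i + k) with hlt | heq | hgt
  · exfalso
    have hPQ : d ^ (j + 1) + 1 ≤ d ^ (i + 1) * d ^ k := by
      rw [← pow_add]
      exact Nat.pow_lt_pow_right (by omega) (by omega)
    nlinarith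
  · subst heq
    have hPQ : d ^ (i + k + 1) = d ^ (i + 1) * d ^ k := by rw [← pow_add]; congr 1; ring
    rw [hPQ] at h₂
    by_cases hk : k = 0
    · exact ⟨by omega, hk⟩
    · exfalso
      have : 2 ≤ d ^ k := hd.trans (Nat.le_self_pow hk d)
      nlinarith
  · exfalso
    have hPQ : 2 * (d ^ (i + 1) * d ^ k) ≤ d ^ (j + 1) := by
      rw [← pow_add]
      calc 2 * d ^ (i + 1 + k) ≤ d * d ^ (i + 1 + k) := by gcongr
        _ = d ^ (i + 1 + k + 1) := (pow_succ' _ _).symm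
        _ ≤ d ^ (j + 1) := Nat.pow_le_pow_right (by omega) (by omega)
    nlinarith

variable {F : Type*} [Field F]

lemma PlaceFamily.exists_injective_orbits [IsAlgClosed F] (𝓟 : PlaceFamily F) {φ : RatFunc F}
    (hdeg : 2 ≤ ratDegree φ) :
    ∃ b : ℕ → P1 F, Function.Injective fun p : ℕ × ℕ => (ratMap φ)^[p.2] (b p.1) := by
  obtain ⟨K, hK⟩ := 𝓟.exists_coincidence_bound hdeg
  set d := ratDegree φ
  let a : ℕ → ℕ := fun i => (3 * K + 1) * (d ^ (i + 1) + 1)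
  have key : ∀ i j n k : ℕ, (ratMap φ)^[n + k] ((𝓟.t ^ a i : F) : P1 F) =
      (ratMap φ)^[n] ((𝓟.t ^ a j : F) : P1 F) → i = j ∧ k = 0 := by
    intro i j n k h
    have hpos : 0 < d ^ n := Nat.pow_pos (by omega)
    have h₁ := hK _ _ _ _ h
    have h₂ := hK _ _ _ _ h.symm
    refine eq_of_near_power hdeg (K := K) (Nat.le_of_mul_le_mul_right ?_ hpos)
      (Nat.le_of_mul_le_mul_right ?_ hpos)
    · calc _ ≤ _ := h₁
        _ = _ := by rw [pow_add]; ring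
    · calc _ = a i * d ^ (n + k) := by rw [pow_add]; ring
        _ ≤ _ := h₂
        _ = _ := by rw [pow_add]; ring
  refine ⟨fun i => ((𝓟.t ^ a i : F) : P1 F), ?_⟩
  rintro ⟨i, m⟩ ⟨j, n⟩ h
  simp only at h
  rcases le_total n m with hnm | hnm
  · obtain ⟨k, rfl⟩ := Nat.exists_eq_add_of_le hnm
    obtain ⟨rfl, rfl⟩ := key i j n k h
    rfl
  · obtain ⟨k, rfl⟩ := Nat.exists_eq_add_of_le hnm
    obtain ⟨rfl, rfl⟩ := key j i m k h.symm
    rfl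

/-- There are infinitely many wandering points with disjoint orbits that avoid a given finite set:
each point of that set is on at most one of the orbits of an infinite family. -/
lemma PlaceFamily.exists_injective_orbits_avoiding [IsAlgClosed F] (𝓟 : PlaceFamily F)
    {φ : RatFunc F} (hdeg : 2 ≤ ratDegree φ) {T : Set (P1 F)} (hT : T.Finite) :
    ∃ b : ℤ → P1 F, (Function.Injective fun p : ℤ × ℕ => (ratMap φ)^[p.2] (b p.1)) ∧
      ∀ i n, (ratMap φ)^[n] (b i) ∉ T := by
  obtain ⟨b, hb⟩ := 𝓟.exists_injective_orbits hdeg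
  have hfin : {i : ℕ | ∃ n, (ratMap φ)^[n] (b i) ∈ T}.Finite := by
    refine ((hT.preimage hb.injOn).image Prod.fst).subset ?_
    rintro i ⟨n, hn⟩
    exact ⟨(i, n), hn, rfl⟩
  have : Infinite ↑({i : ℕ | ∃ n, (ratMap φ)^[n] (b i) ∈ T}ᶜ) := hfin.infinite_compl.to_subtype
  let e := (Equiv.intEquivNat.toEmbedding.trans
    (Infinite.natEmbedding ↑({i : ℕ | ∃ n, (ratMap φ)^[n] (b i) ∈ T}ᶜ)))
  refine ⟨fun i => b (e i), ?_, fun i n hn => (e i).2 ⟨n, hn⟩⟩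
  rintro ⟨i, m⟩ ⟨j, n⟩ h
  have h' := hb (a₁ := ((e i : ℕ), m)) (a₂ := ((e j : ℕ), n)) h
  obtain ⟨h1, h2⟩ := Prod.mk.inj h'
  rw [e.injective (Subtype.ext h1), h2]

end WanderingFamily

/-! ### Families of places on algebraically closed fields -/

section Existence

lemma multiset_prod_bounds (s : Multiset ℝ) (h : ∀ x ∈ s, 0 ≤ x ∧ x < 1) :
    0 ≤ s.prod ∧ s.prod ≤ 1 ∧ (s ≠ 0 → s.prod < 1) := by
  induction s using Multiset.induction_on with
  | empty => simp
  | cons x s ih =>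
    obtain ⟨h0, h1, -⟩ := ih fun y hy => h y (Multiset.mem_cons_of_mem hy)
    obtain ⟨hx0, hx1⟩ := h x (Multiset.mem_cons_self x s)
    have hlt : (x ::ₘ s).prod < 1 := by
      rw [Multiset.prod_cons]
      exact (mul_le_of_le_one_right hx0 h1).trans_lt hx1
    refine ⟨?_, hlt.le, fun _ => hlt⟩
    rw [Multiset.prod_cons]
    exact mul_nonneg hx0 h0

variable {A Q F Ω : Type*} [CommRing A] [IsDomain A] [IsIntegrallyClosed A] [Field Q]
  [Algebra A Q] [IsFractionRing A Q] [Field F] [Algebra A F] [Algebra Q F] [IsScalarTower A Q F]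
  [Algebra.IsAlgebraic Q F] [Field Ω] [IsAlgClosed Ω] [Algebra Q Ω]

omit [IsDomain A] [IsIntegrallyClosed A] in
lemma isIntegral_iff_forall_mem_valuationSubring (z : F) :
    IsIntegral A z ↔ ∀ V : ValuationSubring F, Set.range (algebraMap A F) ⊆ V → z ∈ V := by
  have h := SetLike.ext_iff.mp
    (iInf_valuationSubring_superset (s := Set.range (algebraMap A F))) z
  have hcl : Subring.closure (Set.range (algebraMap A F)) = (algebraMap A F).range :=
    Subring.closure_eq (algebraMap A F).range
  have hint : IsIntegral A z ↔
      z ∈ (integralClosure (Subring.closure (Set.range (algebraMap A F))) F).toSubring := by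
    rw [hcl]
    change _ ↔ IsIntegral (algebraMap A F).range z
    constructor
    · rintro ⟨p, hp, hpz⟩
      refine ⟨p.map (algebraMap A F).rangeRestrict, hp.map _, ?_⟩
      rw [eval₂_map]
      exact hpz
    · intro hz
      let _ : Algebra A (algebraMap A F).range := (algebraMap A F).rangeRestrict.toAlgebra
      have : IsScalarTower A (algebraMap A F).range F := IsScalarTower.of_algebraMap_eq fun _ => rfl
      have : Algebra.IsIntegral A (algebraMap A F).range := by
        refine ⟨?_⟩
        rintro ⟨_, a, rfl⟩
        exact isIntegral_algebraMap (x := a)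
      exact isIntegral_trans z hz
  rw [hint, ← h, Subring.mem_iInf]
  exact ⟨fun h V hV => h ⟨V, hV⟩, fun h V => h V.1 V.2⟩

/-- An absolute value on `Ω` which is at least `1` at the nonzero elements of `A` yields a family of
places of any algebraic extension `F` of the field of fractions `Q`: the finite places are
the valuation rings containing `A`, the places at infinity come from the embeddings in `Ω`. -/
def PlaceFamily.ofAbsoluteValue (α : AbsoluteValue Ω ℝ)
    (hα : ∀ a : A, a ≠ 0 → 1 ≤ α (algebraMap Q Ω (algebraMap A Q a))) (t : A)
    (ht : 1 < α (algebraMap Q Ω (algebraMap A Q t))) : PlaceFamily F where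
  fin := {V | Set.range (algebraMap A F) ⊆ V}
  inf := Set.range fun σ : F →ₐ[Q] Ω => α.comp (f := (σ : F →+* Ω)) σ.injective
  t := algebraMap A F t
  τ := α (algebraMap Q Ω (algebraMap A Q t))
  exists_denom z := by
    have hz : IsAlgebraic A z := by
      have : Algebra.IsAlgebraic A F :=
        (IsFractionRing.comap_isAlgebraic_iff (K := Q)).mpr inferInstance
      exact Algebra.IsAlgebraic.isAlgebraic z
    obtain ⟨s, hs, hint⟩ := hz.exists_integral_multiple
    have hinj : Function.Injective (algebraMap A F) := by
      rw [IsScalarTower.algebraMap_eq A Q F]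
      exact (algebraMap Q F).injective.comp (IsFractionRing.injective A Q)
    refine ⟨algebraMap A F s, (map_ne_zero_iff _ hinj).mpr hs, fun V hV => ⟨hV ⟨s, rfl⟩, ?_⟩⟩
    rw [← Algebra.smul_def]
    exact (isIntegral_iff_forall_mem_valuationSubring _).mp hint V hV
  exists_bound z := by
    obtain ⟨M, hM⟩ := ((minpoly Q z).rootSet_finite Ω).image α |>.bddAbove
    refine ⟨M, ?_⟩
    rintro _ ⟨σ, rfl⟩
    refine hM ⟨σ z, ?_, rfl⟩
    rw [← Algebra.IsAlgebraic.range_eval_eq_rootSet_minpoly Ω z]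
    exact ⟨σ, rfl⟩
  exists_one_le z hz hV := by
    have hint : IsIntegral A z := (isIntegral_iff_forall_mem_valuationSubring z).mpr hV
    have hmin : minpoly Q z = (minpoly A z).map (algebraMap A Q) :=
      minpoly.isIntegrallyClosed_eq_field_fractions' Q hint
    -- The constant coefficient of the minimal polynomial is, up to sign, the product of the
    -- conjugates in `Ω`, and it lies in `A`.
    have hzQ : IsIntegral Q z := hint.tower_top
    have hc : (minpoly A z).coeff 0 ≠ 0 := by
      intro h0
      apply (minpoly.coeff_zero_ne_zero hzQ hz)
      rw [hmin, coeff_map, h0, map_zero]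
    have h1 := hα _ hc
    have hprod := (IsAlgClosed.splits ((minpoly Q z).map (algebraMap Q Ω))
      ).coeff_zero_eq_prod_roots_of_monic ((minpoly.monic hzQ).map _)
    rw [← coeff_map, ← hmin, ← coeff_map, hprod, map_mul, map_pow, α.map_neg, map_one, one_pow,
      one_mul, map_multiset_prod] at h1
    obtain ⟨ρ, hρ, hρ1⟩ : ∃ ρ ∈ ((minpoly Q z).map (algebraMap Q Ω)).roots, 1 ≤ α ρ := by
      by_contra! hlt
      have hroots : ((minpoly Q z).map (algebraMap Q Ω)).roots ≠ 0 := by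
        intro h0
        have := (IsAlgClosed.splits ((minpoly Q z).map (algebraMap Q Ω))).natDegree_eq_card_roots
        rw [h0, Multiset.card_zero, natDegree_map] at this
        exact (minpoly.natDegree_pos hzQ).ne' this
      refine (h1.trans_lt ((multiset_prod_bounds _ ?_).2.2 ?_)).false
      · intro x hx
        obtain ⟨ρ, hρ, rfl⟩ := Multiset.mem_map.mp hx
        exact ⟨α.nonneg ρ, hlt ρ hρ⟩
      · rwa [ne_eq, Multiset.map_eq_zero]
    have hρ' : ρ ∈ (minpoly Q z).rootSet Ω := by
      rw [mem_rootSet', ← eval_map_algebraMap]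
      exact mem_roots'.mp hρ
    rw [← Algebra.IsAlgebraic.range_eval_eq_rootSet_minpoly Ω z] at hρ'
    obtain ⟨σ, rfl⟩ := hρ'
    exact ⟨_, ⟨σ, rfl⟩, hρ1⟩
  t_mem V hV := hV ⟨t, rfl⟩
  abv_t := by
    rintro _ ⟨σ, rfl⟩
    change α (σ (algebraMap A F t)) = _
    rw [IsScalarTower.algebraMap_apply A Q F, σ.commutes]
  one_lt := ht

end Existence

section Construction

universe u

/-- A nontrivial non-archimedean absolute value extends to some algebraically closed field. -/
lemma exists_extension_isAlgClosed {Q : Type u} [Field Q] (v : AbsoluteValue Q ℝ)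
    (hv : IsNonarchimedean v) (hnt : ∃ x, x ≠ 0 ∧ v x ≠ 1) :
    ∃ (Ω : Type u) (_ : Field Ω) (_ : IsAlgClosed Ω) (i : Q →+* Ω) (α : AbsoluteValue Ω ℝ),
      ∀ x, α (i x) = v x := by
  have hnorm : ∀ x : Q, ‖((WithAbs.toAbs v x : WithAbs v) : v.Completion)‖ = v x := fun x => by
    rw [UniformSpace.Completion.norm_coe]
    rfl
  let _ : NontriviallyNormedField v.Completion := NontriviallyNormedField.ofNormNeOne (by
    obtain ⟨x, hx, hvx⟩ := hnt
    refine ⟨((WithAbs.toAbs v x : WithAbs v) : v.Completion), ?_, by rwa [hnorm]⟩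
    rw [← norm_ne_zero_iff, hnorm]
    exact (v.pos hx).ne')
  have : IsUltrametricDist v.Completion := by
    refine IsUltrametricDist.isUltrametricDist_of_forall_norm_add_le_max_norm fun x y => ?_
    induction x, y using UniformSpace.Completion.induction_on₂ with
    | hp => exact isClosed_le (by fun_prop) (by fun_prop)
    | ih a b =>
      rw [← UniformSpace.Completion.coe_add]
      simp only [UniformSpace.Completion.norm_coe]
      exact hv a.ofAbs b.ofAbs
  let i : Q →+* AlgClos v.Completion := (algebraMap v.Completion (AlgClos v.Completion)).comp
    ((UniformSpace.Completion.coeRingHom (α := WithAbs v)).comp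
      (WithAbs.equiv v).symm.toRingHom)
  refine ⟨AlgClos v.Completion, inferInstance, inferInstance, i,
    NormedField.toAbsoluteValue (AlgClos v.Completion), fun x => ?_⟩
  exact (spectralNorm_extends (K := v.Completion) (L := AlgClos v.Completion) _).trans (hnorm x)

open Classical in
/-- The absolute value of a rational function at the place at infinity, normalized so that the
indeterminate has absolute value `2`. -/
def degreeAbv (k : Type u) [Field k] : AbsoluteValue (RatFunc k) ℝ where
  toFun x := if x = 0 then 0 else 2 ^ x.intDegree
  map_mul' x y := by
    by_cases hx : x = 0
    · simp [hx]
    by_cases hy : y = 0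
    · simp [hy]
    simp only [mul_eq_zero, hx, hy, or_self, if_false, RatFunc.intDegree_mul hx hy]
    exact zpow_add₀ two_ne_zero _ _
  nonneg' x := by split_ifs <;> positivity
  eq_zero' x := by
    by_cases hx : x = 0
    · simp [hx]
    · simp [hx, (zpow_pos (two_pos : (0 : ℝ) < 2) x.intDegree).ne']
  add_le' x y := by
    by_cases hx : x = 0
    · simp [hx]
    by_cases hy : y = 0
    · simp [hy]
    by_cases hxy : x + y = 0
    · simp only [hxy, hx, hy, if_true, if_false]
      positivity
    simp only [hxy, hx, hy, if_false]
    have hpow : ∀ n : ℤ, (0 : ℝ) ≤ 2 ^ n := fun n => by positivity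
    rcases le_max_iff.mp (RatFunc.intDegree_add_le hy hxy) with h | h
    · exact (zpow_le_zpow_right₀ one_le_two h).trans (le_add_of_nonneg_right (hpow _))
    · exact (zpow_le_zpow_right₀ one_le_two h).trans (le_add_of_nonneg_left (hpow _))

lemma degreeAbv_of_ne_zero {k : Type u} [Field k] {x : RatFunc k} (hx : x ≠ 0) :
    degreeAbv k x = 2 ^ x.intDegree := if_neg hx

lemma isNonarchimedean_degreeAbv (k : Type u) [Field k] : IsNonarchimedean (degreeAbv k) := by
  intro x y
  by_cases hx : x = 0
  · simp [hx]
  by_cases hy : y = 0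
  · simp [hy]
  by_cases hxy : x + y = 0
  · simp [hxy]
  rw [degreeAbv_of_ne_zero hx, degreeAbv_of_ne_zero hy, degreeAbv_of_ne_zero hxy]
  exact (le_max_iff.mp (RatFunc.intDegree_add_le hy hxy)).elim
    (fun h => le_max_of_le_left (zpow_le_zpow_right₀ one_le_two h))
    (fun h => le_max_of_le_right (zpow_le_zpow_right₀ one_le_two h))

lemma nonempty_placeFamily_of_transcendental {k F : Type u} [Field k] [Field F] [Algebra k F]
    {t : F} (ht : Transcendental k t) (halg : Algebra.IsAlgebraic (Algebra.adjoin k {t}) F) :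
    Nonempty (PlaceFamily F) := by
  have hinj : Function.Injective (aeval (R := k) t) := transcendental_iff_injective.mp ht
  let _ : Algebra k[X] F := (aeval (R := k) t).toRingHom.toAlgebra
  have hinj' : Function.Injective (algebraMap k[X] F) := hinj
  let _ : Algebra (RatFunc k) F := (IsFractionRing.lift (K := RatFunc k) hinj').toAlgebra
  have htow : IsScalarTower k[X] (RatFunc k) F := IsScalarTower.of_algebraMap_eq fun x =>
    (IsFractionRing.lift_algebraMap hinj' x).symm
  have hF : Algebra.IsAlgebraic k[X] F := by
    refine ⟨fun z => ?_⟩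
    have hmem : ∀ p : k[X], aeval t p ∈ Algebra.adjoin k {t} := fun p =>
      aeval_mem_adjoin_singleton k t
    refine (halg.isAlgebraic z).of_ringHom_of_comp_eq
      ((aeval (R := k) t).codRestrict _ hmem : k[X] →ₐ[k] Algebra.adjoin k {t})
      (RingHom.id F) ?_ Function.injective_id rfl
    rintro ⟨x, hx⟩
    rw [Algebra.adjoin_singleton_eq_range_aeval] at hx
    obtain ⟨p, rfl⟩ := hx
    exact ⟨p, rfl⟩
  have hF' : Algebra.IsAlgebraic (RatFunc k) F :=
    (IsFractionRing.comap_isAlgebraic_iff (A := k[X])).mp hF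
  have hX : degreeAbv k (algebraMap k[X] (RatFunc k) X) = 2 := by
    rw [degreeAbv_of_ne_zero (by simp [RatFunc.X_ne_zero]), RatFunc.intDegree_polynomial, natDegree_X]
    norm_num
  obtain ⟨Ω, _, _, i, α, hα⟩ := exists_extension_isAlgClosed (degreeAbv k)
    (isNonarchimedean_degreeAbv k) ⟨algebraMap k[X] (RatFunc k) X, by simp [RatFunc.X_ne_zero], by rw [hX]; norm_num⟩
  let _ : Algebra (RatFunc k) Ω := i.toAlgebra
  refine ⟨PlaceFamily.ofAbsoluteValue (A := k[X]) (Q := RatFunc k) α (fun a ha => ?_) X ?_⟩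
  · change 1 ≤ α (i _)
    rw [hα, degreeAbv_of_ne_zero (by simpa using ha), RatFunc.intDegree_polynomial, zpow_natCast]
    exact one_le_pow₀ one_le_two
  · change 1 < α (i _)
    rw [hα, hX]
    norm_num

lemma nonempty_placeFamily_of_rat {F : Type u} [Field F] [Algebra ℚ F]
    (halg : Algebra.IsAlgebraic ℚ F) : Nonempty (PlaceFamily F) := by
  refine ⟨PlaceFamily.ofAbsoluteValue (A := ℤ) (Q := ℚ) (NormedField.toAbsoluteValue ℂ)
    (fun a ha => ?_) 2 ?_⟩
  · simp only [algebraMap_int_eq, eq_intCast, map_intCast]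
    change 1 ≤ ‖(a : ℂ)‖
    rw [Complex.norm_intCast]
    exact_mod_cast Int.one_le_abs ha
  · simp only [map_ofNat]
    change 1 < ‖(2 : ℂ)‖
    norm_num

open scoped IntermediateField.algebraAdjoinAdjoin in
lemma nonempty_placeFamily_of_not_isAlgebraic {k F : Type u} [Field k] [Field F] [Algebra k F]
    (halg : ¬ Algebra.IsAlgebraic k F) : Nonempty (PlaceFamily F) := by
  obtain ⟨s, hs⟩ := exists_isTranscendenceBasis k F
  have hne : s.Nonempty := by
    rw [Set.nonempty_iff_ne_empty]
    rintro rfl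
    exact halg (hs.isEmpty_iff_isAlgebraic.mp inferInstance)
  obtain ⟨t, ht⟩ := hne
  have htr : Transcendental (Algebra.adjoin k (s \ {t})) t := by
    have hset : s \ {t} = (Subtype.val : s → F) '' {⟨t, ht⟩}ᶜ := by
      ext x
      simp only [Set.mem_sdiff, Set.mem_singleton_iff, Set.mem_image, Set.mem_compl_iff,
        Subtype.exists, Subtype.mk.injEq, exists_and_right, exists_eq_right]
      exact ⟨fun h => ⟨h.1, h.2⟩, fun ⟨h1, h2⟩ => ⟨h1, h2⟩⟩
    rw [hset]
    exact hs.1.transcendental_adjoin (i := ⟨t, ht⟩) (by simp)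
  have htr' : Transcendental (IntermediateField.adjoin k (s \ {t})) t := fun h =>
    htr ((IsFractionRing.isAlgebraic_iff (Algebra.adjoin k (s \ {t}))
      (IntermediateField.adjoin k (s \ {t})) F).mpr h)
  refine nonempty_placeFamily_of_transcendental htr' ⟨fun z => ?_⟩
  have hz := hs.isAlgebraic.isAlgebraic z
  rw [Subtype.range_coe] at hz
  have hle : ∀ x ∈ Algebra.adjoin k s,
      x ∈ Algebra.adjoin (IntermediateField.adjoin k (s \ {t})) {t} := by
    intro x hx
    induction hx using Algebra.adjoin_induction with
    | mem x hx =>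
      by_cases hxt : x = t
      · exact Algebra.subset_adjoin hxt
      · exact Subalgebra.algebraMap_mem _
          (⟨x, IntermediateField.subset_adjoin _ _ ⟨hx, hxt⟩⟩ :
            IntermediateField.adjoin k (s \ {t}))
    | algebraMap r =>
      exact Subalgebra.algebraMap_mem _
        (algebraMap _ (IntermediateField.adjoin k (s \ {t})) r)
    | add x y _ _ hx hy => exact add_mem hx hy
    | mul x y _ _ hx hy => exact mul_mem hx hy
  exact hz.ringHom_of_comp_eq
    (RingHom.codRestrict (Algebra.adjoin k s).val.toRingHom
      (Algebra.adjoin (IntermediateField.adjoin k (s \ {t})) {t}) fun x => hle x x.2)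
    (RingHom.id F) (fun x y h => by
      have h' := congrArg Subtype.val h
      exact Subtype.ext h') rfl

/-- A field that is not algebraic over a finite field has a suitable family of places: it is either
algebraic over `ℚ`, or algebraic over a field `k(t)` with `t` transcendental over `k`. -/
theorem nonempty_placeFamily {F : Type u} [Field F] (hF : ¬ IsAlgebraicOverFinite F) :
    Nonempty (PlaceFamily F) := by
  by_cases halg : Algebra.IsAlgebraic (⊥ : Subfield F) F
  · have hinf : ¬ Finite (⊥ : Subfield F) := fun hfin => hF ⟨⊥, hfin, halg⟩
    obtain ⟨p, hp⟩ := CharP.exists F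
    rcases CharP.char_is_prime_or_zero F p with hprime | rfl
    · have : Fact p.Prime := ⟨hprime⟩
      refine absurd ?_ hinf
      rw [← ZMod.fieldRange_castHom_eq_bot (K := F) p]
      exact Finite.of_surjective _ (ZMod.castHom (dvd_refl p) F).rangeRestrict_surjective
    · have : CharZero F := CharP.charP_to_charZero F
      refine nonempty_placeFamily_of_rat ⟨fun z => ?_⟩
      refine (halg.isAlgebraic z).of_ringHom_of_comp_eq (algebraMap ℚ (⊥ : Subfield F))
        (RingHom.id F) ?_ Function.injective_id (Subsingleton.elim _ _)
      rintro ⟨x, hx⟩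
      rw [Subfield.bot_eq_of_charZero] at hx
      obtain ⟨q, rfl⟩ := hx
      exact ⟨q, Subtype.ext (by simp)⟩
  · exact nonempty_placeFamily_of_not_isAlgebraic halg

end Construction

/-! ### The fields `C_K` and its residue field are algebraically closed -/

section AlgClosed

/-- A complete non-archimedean field with a dense algebraically closed subfield is algebraically
closed, in any characteristic: by continuity of roots, a root of a polynomial in an algebraic
closure is a limit of elements of the complete field. -/
lemma isAlgClosed_of_denseRange {k L : Type*} [Field k] [IsAlgClosed k] [NontriviallyNormedField L]
    [IsUltrametricDist L] [CompleteSpace L] [Algebra k L] (hd : DenseRange (algebraMap k L)) :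
    IsAlgClosed L := by
  refine IsAlgClosed.of_exists_root L fun f hf hirr => ?_
  let _ : NormedAlgebra L (AlgClos L) := spectralNorm.normedAlgebra L (AlgClos L)
  obtain ⟨a, ha⟩ := IsAlgClosed.exists_aeval_eq_zero (AlgClos L) f hirr.degree_pos.ne'
  have hn : f.natDegree ≠ 0 := hirr.natDegree_pos.ne'
  have hclosed : IsClosed (Set.range (algebraMap L (AlgClos L))) :=
    (algebraMap_isometry L (AlgClos L)).isClosedEmbedding.isClosed_range
  have hmem : a ∈ closure (Set.range (algebraMap L (AlgClos L))) := by
    rw [Metric.mem_closure_iff]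
    intro ε hε
    set m := max ‖a‖ 1 with hm
    have hm0 : 0 < m := zero_lt_one.trans_le (le_max_right _ _)
    have hδ : 0 < (ε / m) ^ f.natDegree / (f.natDegree + 1) := by positivity
    obtain ⟨g, hg, hdeg, hcoeff⟩ :=
      exists_monic_and_natDegree_eq_and_norm_map_algebraMap_coeff_sub_lt hd hf hδ
    have hsplit : (g.map (algebraMap k L)).Splits := (IsAlgClosed.splits g).map _
    obtain ⟨b, hb, hab⟩ := exists_aroots_norm_sub_lt_of_norm_coeff_sub_lt hδ ha hf (hg.map _)
      (by rw [natDegree_map, hdeg]) hcoeff (hsplit.map _)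
    rw [mul_div_cancel₀ _ (by positivity), Real.pow_rpow_inv_natCast (by positivity) hn,
      div_mul_cancel₀ _ hm0.ne'] at hab
    exact ⟨b, hsplit.mem_range_of_isRoot (hg.map _).ne_zero (mem_roots'.mp hb).2,
      by rwa [dist_eq_norm]⟩
  rw [hclosed.closure_eq] at hmem
  obtain ⟨x, rfl⟩ := hmem
  refine ⟨x, ?_⟩
  rw [aeval_algebraMap_apply] at ha
  simpa using ha

variable {L : Type*} [NormedField L] [IsUltrametricDist L]

lemma isAlgClosed_resField [IsAlgClosed L] : IsAlgClosed (ResField L) := by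
  refine IsAlgClosed.of_exists_root _ fun p hp hirr => ?_
  obtain ⟨q, hqp, hqdeg, hq⟩ := lifts_and_natDegree_eq_and_monic
    (f := IsLocalRing.residue (IntRing L))
    ((mem_lifts _).mpr (map_surjective _ IsLocalRing.residue_surjective p)) hp
  have hdeg : (q.map (algebraMap (IntRing L) L)).degree ≠ 0 := by
    rw [hq.degree_map, degree_eq_natDegree hq.ne_zero, hqdeg]
    exact_mod_cast hirr.natDegree_pos.ne'
  obtain ⟨r, hr⟩ := IsAlgClosed.exists_root _ hdeg
  have hr' : eval₂ (algebraMap (IntRing L) L) r q = 0 := by rwa [IsRoot, eval_map] at hr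
  obtain ⟨s, rfl⟩ := IsIntegrallyClosed.isIntegral_iff.mp ⟨q, hq, hr'⟩
  refine ⟨IsLocalRing.residue _ s, ?_⟩
  rw [eval₂_at_apply, map_eq_zero_iff _ (IsFractionRing.injective (IntRing L) L)] at hr'
  rw [← hqp, eval_map, eval₂_at_apply, hr', map_zero]

end AlgClosed

section AlgebraicOverFinite

lemma exists_pow_eq_one_of_isAlgebraic {k F : Type*} [Field k] [Finite k] [Field F] [Algebra k F]
    {x : F} (hx : IsAlgebraic k x) (hx0 : x ≠ 0) : ∃ n, 0 < n ∧ x ^ n = 1 := by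
  have : FiniteDimensional k (IntermediateField.adjoin k {x}) :=
    IntermediateField.adjoin.finiteDimensional hx.isIntegral
  have : Finite (IntermediateField.adjoin k {x}) := Module.finite_of_finite k
  let y : (IntermediateField.adjoin k {x})ˣ :=
    Units.mk0 ⟨x, IntermediateField.mem_adjoin_simple_self k x⟩ fun h => hx0 (congrArg Subtype.val h)
  obtain ⟨n, hn, h⟩ := (isOfFinOrder_of_finite y).exists_pow_eq_one
  refine ⟨n, hn, ?_⟩
  have := congrArg (fun u : (IntermediateField.adjoin k {x})ˣ =>
    ((u : IntermediateField.adjoin k {x}) : F)) h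
  simpa [y] using this

lemma IsAlgebraicOverFinite.of_ringHom {k F : Type*} [Field k] [Field F] (i : k →+* F)
    (h : IsAlgebraicOverFinite F) : IsAlgebraicOverFinite k := by
  obtain ⟨F₀, hfin, halg⟩ := h
  refine ⟨F₀.comap i, Finite.of_injective (fun x => (⟨i x, x.2⟩ : F₀)) fun x y hxy =>
    Subtype.ext (i.injective (congrArg Subtype.val hxy)), ⟨fun x => ?_⟩⟩
  by_cases hx : x = 0
  · rw [hx]
    exact isAlgebraic_zero
  obtain ⟨n, hn, hxn⟩ := exists_pow_eq_one_of_isAlgebraic (halg.isAlgebraic (i x))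
    ((map_ne_zero_iff i i.injective).mpr hx)
  have hxn' : x ^ n = 1 := i.injective (by rw [map_pow, hxn, map_one])
  exact ⟨X ^ n - 1, (monic_X_pow_sub_C 1 hn.ne').ne_zero, by simp [hxn']⟩

end AlgebraicOverFinite

section CK

variable {K : Type*} [NontriviallyNormedField K] [IsUltrametricDist K] [CompleteSpace K]

lemma norm_toCK (x : K) : ‖toCK K x‖ = ‖x‖ := by
  change ‖((algebraMap K (AlgClos K) x : AlgClos K) : CK K)‖ = ‖x‖
  rw [UniformSpace.Completion.norm_coe]
  exact spectralNorm_extends x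

variable (K) in
lemma exists_norm_lt_one_CK : ∃ e : CK K, 0 < ‖e‖ ∧ ‖e‖ < 1 := by
  obtain ⟨x, hx0, hx1⟩ := NormedField.exists_norm_lt_one K
  exact ⟨toCK K x, by rwa [norm_toCK], by rwa [norm_toCK]⟩

variable (K) in
lemma isAlgClosed_CK : IsAlgClosed (CK K) := by
  let _ : NontriviallyNormedField (CK K) := NontriviallyNormedField.ofNormNeOne (by
    obtain ⟨e, he0, he1⟩ := exists_norm_lt_one_CK K
    exact ⟨e, norm_pos_iff.mp he0, he1.ne⟩)
  let _ : Algebra (AlgClos K) (CK K) :=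
    (UniformSpace.Completion.coeRingHom (α := AlgClos K)).toAlgebra
  exact isAlgClosed_of_denseRange (k := AlgClos K) (L := CK K)
    UniformSpace.Completion.denseRange_coe

variable (K) in
/-- The inclusion of residue fields induced by that of `K` in `C_K`. -/
def resFieldToCK : ResField K →+* ResField (CK K) := by
  let f : IntRing K →+* IntRing (CK K) :=
    (toCK K).restrict (IntRing K) (IntRing (CK K)) fun x hx => by
      rw [mem_intRing] at hx ⊢
      rwa [norm_toCK]
  have hf : IsLocalHom ((IsLocalRing.residue (IntRing (CK K))).comp f) := by
    refine ⟨fun x hx => ?_⟩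
    rw [← IsLocalRing.residue_ne_zero_iff_isUnit, ne_eq, residue_eq_zero_iff]
    have h := hx.ne_zero
    rw [RingHom.comp_apply, ne_eq, residue_eq_zero_iff] at h
    intro hlt
    exact h ((norm_toCK (x : K)).trans_lt hlt)
  exact IsLocalRing.ResidueField.lift ((IsLocalRing.residue (IntRing (CK K))).comp f)

end CK

/-! ### Residue classes with wandering reduction -/

section Main

variable {L : Type*} [NormedField L] [IsUltrametricDist L]

/-- The orbit of a residue class omits all other classes of a family with disjoint orbits. -/
lemma orbitOmitsInfinitely_residueClass {φ : RatFunc L} {ψ : RatFunc (ResField L)}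
    (b : ℤ → P1 (ResField L))
    (hinj : Function.Injective fun p : ℤ × ℕ => (ratMap ψ)^[p.2] (b p.1))
    (himg : ∀ i m n, (ratMap φ)^[n] '' residueClass ((ratMap ψ)^[m] (b i)) =
      residueClass ((ratMap ψ)^[n] ((ratMap ψ)^[m] (b i)))) (i : ℤ) (m : ℕ) :
    OrbitOmitsInfinitely φ (residueClass ((ratMap ψ)^[m] (b i))) := by
  choose x hx using fun j => residueClass_nonempty (L := L) (b j)
  have hxinj : Function.Injective x := by
    intro j k hjk
    have h : b j = b k := (mem_residueClass.mp (hx j)).symm.trans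
      (hjk ▸ mem_residueClass.mp (hx k))
    exact (Prod.mk.inj (@hinj (j, 0) (k, 0) h)).1
  refine ((Set.infinite_of_finite_compl (Set.finite_singleton i |>.subset
    (compl_compl {i}).subset)).image (f := x) hxinj.injOn).mono ?_
  rintro _ ⟨j, hj, rfl⟩ hmem
  obtain ⟨n, hn⟩ := Set.mem_iUnion.mp hmem
  rw [himg] at hn
  have h : b j = (ratMap ψ)^[n + m] (b i) := by
    rw [Function.iterate_add_apply]
    exact (mem_residueClass.mp (hx j)).symm.trans (mem_residueClass.mp hn)
  exact hj (Prod.mk.inj (@hinj (j, 0) (i, n + m) h)).1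

/-- The result over any algebraically closed field `L`, complete or not: the field of definition
of `φ` only serves to ensure that the residue field of `L` is not algebraic over a finite field. -/
theorem exists_wandering_residueClasses [IsAlgClosed L] (hL : ∃ e : L, 0 < ‖e‖ ∧ ‖e‖ < 1)
    (hres : ¬ IsAlgebraicOverFinite (ResField L)) {φ : RatFunc L} {ψ : RatFunc (ResField L)}
    (hred : IsNontrivialReduction φ ψ) (hdeg : 2 ≤ ratDegree ψ) :
    ∃ b : ℤ → P1 (ResField L),
      Function.Injective (fun p : ℤ × ℕ => (ratMap ψ)^[p.2] (b p.1)) ∧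
      (∀ (i : ℤ) (n : ℕ), (ratMap φ)^[n] '' residueClass (b i) =
        residueClass ((ratMap ψ)^[n] (b i))) ∧
      WanderInDistinctGrandOrbits φ (dynComponents φ) (fun i => residueClass (b i)) ∧
      WanderInDistinctGrandOrbits φ (dynDComponents φ) (fun i => residueClass (b i)) ∧
      ((∃ a₁ a₂ : P1 (ResField L), a₁ ≠ a₂ ∧ (julia φ ∩ residueClass a₁).Nonempty ∧
          (julia φ ∩ residueClass a₂).Nonempty) →
        WanderInDistinctGrandOrbits φ (dComponents φ) (fun i => residueClass (b i))) ∧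
      ({a : P1 (ResField L) | (julia φ ∩ residueClass a).Nonempty}.Infinite →
        WanderInDistinctGrandOrbits φ (analyticComponents φ) (fun i => residueClass (b i))) := by
  have : IsAlgClosed (ResField L) := isAlgClosed_resField
  obtain ⟨R⟩ := nonempty_reducedFibres hred hdeg
  obtain ⟨𝓟⟩ := nonempty_placeFamily hres
  obtain ⟨b, hinj, hbad⟩ := 𝓟.exists_injective_orbits_avoiding hdeg R.bad.finite_toSet
  have hgood : ∀ i m n, (ratMap ψ)^[n] ((ratMap ψ)^[m] (b i)) ∉ R.bad := fun i m n => by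
    rw [← Function.iterate_add_apply]
    exact hbad i (n + m)
  have himg := fun i m n => R.iterate_image_residueClass (hgood i m) n
  have himg₁ : ∀ i n, ratMap φ '' residueClass ((ratMap ψ)^[n] (b i)) =
      residueClass ((ratMap ψ)^[n + 1] (b i)) := fun i n => by
    rw [R.image_residueClass (hbad i n), Function.iterate_succ_apply']
  have hF := fun i n => R.residueClass_subset_fatou (hgood i n)
  have hB := orbitOmitsInfinitely_residueClass b hinj himg
  have hinj' : ∀ i j m n, (ratMap ψ)^[m] (b i) = (ratMap ψ)^[n] (b j) → i = j ∧ m = n :=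
    fun i j m n h => Prod.mk.inj (@hinj (i, m) (j, n) h)
  refine ⟨b, hinj, fun i n => himg i 0 n, ?_, ?_, ?_, ?_⟩
  · exact wanderInDistinctGrandOrbits_of_maximal IsRationalOpenConnectedAffinoid
      (OrbitOmitsInfinitely φ) (dynComponent φ) (fun _ => rfl) _ hinj' himg₁ hF
      (fun i n => (isRationalOpenDisk_residueClass _).isRationalOpenConnectedAffinoid) hB
      fun i n U hU hφ hmeet => hU.subset_of_omits hL R hdeg hφ hmeet
  · exact wanderInDistinctGrandOrbits_of_maximal IsRationalOpenDisk
      (OrbitOmitsInfinitely φ) (dynDComponent φ) (fun _ => rfl) _ hinj' himg₁ hF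
      (fun i n => isRationalOpenDisk_residueClass _) hB fun i n U hU hφ hmeet =>
        hU.isRationalOpenConnectedAffinoid.subset_of_omits hL R hdeg hφ hmeet
  · rintro ⟨a₁, a₂, ha, h₁, h₂⟩
    exact wanderInDistinctGrandOrbits_of_maximal IsDisk (· ⊆ fatou φ) (dComponent φ)
      (fun _ => rfl) _ hinj' himg₁ hF (fun i n => isDisk_residueClass _) hF
      fun i n U hU hUF hmeet => hU.subset_of_julia hUF hmeet ha h₁ h₂
  · intro hJ
    exact wanderInDistinctGrandOrbits_of_maximal IsConnectedAffinoid (· ⊆ fatou φ)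
      (analyticComponent φ) (fun _ => rfl) _ hinj' himg₁ hF
      (fun i n => (isDisk_residueClass _).isConnectedAffinoid) hF
      fun i n U hU hUF hmeet => hU.subset_of_julia hUF hmeet hJ

end Main

end NonArch

end

theorem theorem4p2 {K : Type*} [NontriviallyNormedField K] [IsUltrametricDist K] [CompleteSpace K]
    (hk : ¬ NonArch.IsAlgebraicOverFinite (NonArch.ResField K))
    (φ : RatFunc K) (ψ : RatFunc (NonArch.CK K))
    (hψ : ψ = NonArch.baseChange (NonArch.toCK K) φ)
    (φbar : RatFunc (NonArch.ResField (NonArch.CK K)))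
    (hred : NonArch.IsNontrivialReduction ψ φbar)
    (hdeg : 2 ≤ NonArch.ratDegree φbar) :
    ∃ b : ℤ → NonArch.P1 (NonArch.ResField (NonArch.CK K)),
      Function.Injective (fun p : ℤ × ℕ => (NonArch.ratMap φbar)^[p.2] (b p.1)) ∧
      (∀ (i : ℤ) (n : ℕ),
        (NonArch.ratMap ψ)^[n] '' NonArch.residueClass (b i) =
          NonArch.residueClass ((NonArch.ratMap φbar)^[n] (b i))) ∧
      NonArch.WanderInDistinctGrandOrbits ψ (NonArch.dynComponents ψ)
        (fun i => NonArch.residueClass (b i)) ∧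
      NonArch.WanderInDistinctGrandOrbits ψ (NonArch.dynDComponents ψ)
        (fun i => NonArch.residueClass (b i)) ∧
      ((∃ a₁ a₂ : NonArch.P1 (NonArch.ResField (NonArch.CK K)), a₁ ≠ a₂ ∧
          (NonArch.julia ψ ∩ NonArch.residueClass a₁).Nonempty ∧
          (NonArch.julia ψ ∩ NonArch.residueClass a₂).Nonempty) →
        NonArch.WanderInDistinctGrandOrbits ψ (NonArch.dComponents ψ)
          (fun i => NonArch.residueClass (b i))) ∧
      ({a : NonArch.P1 (NonArch.ResField (NonArch.CK K)) |
          (NonArch.julia ψ ∩ NonArch.residueClass a).Nonempty}.Infinite →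
        NonArch.WanderInDistinctGrandOrbits ψ (NonArch.analyticComponents ψ)
          (fun i => NonArch.residueClass (b i))) := by
  have := NonArch.isAlgClosed_CK K
  exact NonArch.exists_wandering_residueClasses (NonArch.exists_norm_lt_one_CK K)
    (fun h => hk (h.of_ringHom (NonArch.resFieldToCK K))) hred hdeg
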